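/- Consider the fifth Painlevé equation $$ (\mathrm V)\quad \frac{d^2y}{dx^2}=\Bigl(\frac1{2y}+\frac1{y-1}\Bigr)\Bigl(\frac{dy}{dx}\Bigr)^2-\frac1x\frac{dy}{dx}+\frac{(y-1)^2}{8x^2}\Bigl((\theta_0-\theta_x+\theta_\infty)^2y-\frac{(\theta_0-\theta_x-\theta_\infty)^2}{y}\Bigr)+(1-\theta_0-\theta_x)\frac yx-\frac{y(y+1)}{2(y-1)} $$ with $\theta_0,\theta_x,\theta_\infty\in\mathbb C$. Let $\mathcal R$ be the universal covering of $\mathbb C\setminus\{0\}$, and for $\varepsilon,\Theta>0$ put $$ \Omega^*_\rho(\varepsilon,\Theta)=\{x\in\mathcal R:\ |\rho x|<\varepsilon,\ |x(\rho x)^{-1/2}|<\varepsilon,\ |\arg(\rho x)|<\Theta\},\qquad \Omega^*(\varepsilon,\Theta)=\bigcup_{\rho\in\mathcal R}\{\rho\}\times\Omega^*_\rho(\varepsilon,\Theta)\subset\mathcal R^2 . $$ Given $a\in\mathbb C$, integers $k,m\ge1$ and a subring $R\subset\mathbb C$, we say that (V) has a family of type $(a,k,m,R)$ if there are $c_j\in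 R$ $(j\ge k+1)$ and $c_{jn}\in R$ $(j\ge0,\ n\ge1)$ such that for every $\Theta_0>0$ there are $\varepsilon_0>0$ (depending only on $\Theta_0,\theta_0,\theta_x,\theta_\infty$) and a function $y(\rho,x)$, holomorphic on $\Omega^*(\varepsilon_0,\Theta_0)$, which for every $\rho\in\mathcal R$ is a solution of (V) in $x\in\Omega^*_\rho(\varepsilon_0,\Theta_0)$ (with values different from $0$ and $1$), and which on $\Omega^*(\varepsilon_0,\Theta_0)$ is the sum of the absolutely convergent series $$ y(\rho,x)=1+a\log^{-k}(\rho x)+\sum_{j\ge k+1}c_j\log^{-j}(\rho x)+\sum_{n\ge1}x^n\sum_{j\ge0}c_{jn}\log^{mn-j}(\rho x). $$ Then the following hold. (1) If $\theta_\infty\ne0$ and $\theta_0^2-\theta_x^2\ne0$, then (V) has a family of type $(a,k,m,R)$ with $a=\dfrac{4}{\theta_\infty(\theta_0-\theta_x)}$, $k=2$, $m=2$, $R=\mathbb Q[\theta_0,\theta_x,\theta_\infty,\theta_\infty^{-1},(\theta_0^2-\theta_x^2)^{-1}]$. (2) Let $\theta_\infty\ne0$ and $R=\mathbb Q[\theta_0,\theta_0^{-1},\theta_\infty,\theta_\infty^{-1}]$.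 (i) If $\theta_0=\theta_x\ne0$, then (V) has two families $y^{+},y^{-}$, of types $(a,1,1,R)$ with $a=-2/\theta_\infty$ and $a=2/\theta_\infty$, respectively; the coefficients of $y^{+}$ can moreover be taken with $c_j=0$ for all $j\ge2$. (ii) If $\theta_0=-\theta_x\ne0$, then (V) has a family of type $\bigl(\tfrac{2}{\theta_0\theta_\infty},2,1,R\bigr)$. (3) Let $\theta_\infty=0$. (i) If $\theta_0^2-\theta_x^2\ne0$, then (V) has two families $y^{(l)}$ $(l=1,2)$, of types $\bigl(\tfrac{(-1)^{l+1}2}{\theta_0-\theta_x},1,2,R\bigr)$ with $R=\mathbb Q[\theta_0,\theta_x,(\theta_0^2-\theta_x^2)^{-1}]$. (ii) If $\theta_0=-\theta_x\ne0$, then (V) has a family of type $\bigl(\tfrac1{\theta_0},1,1,R\bigr)$ with $R=\mathbb Q[\theta_0,\theta_0^{-1}]$. -/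

import Mathlib

/-!
The universal covering of `ℂ ∖ {0}` is modelled by `ℂ` with covering map `Complex.exp`: a point of
the covering is its logarithm.  For a point `ξ` of the covering one has `x = exp ξ`, `log x = ξ`,
`arg x = ξ.im`, products of points are sums of logarithms, and `x ^ a` has logarithm `a * ξ`.
-/

namespace PainleveV

/-- The projection of the universal covering onto `ℂ ∖ {0}`. -/
noncomputable def proj (ξ : ℂ) : {z : ℂ // z ≠ 0} := ⟨Complex.exp ξ, Complex.exp_ne_zero ξ⟩

theorem isCoveringMap_proj : IsCoveringMap proj := Complex.isCoveringMap_exp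

theorem simplyConnectedSpace_cover : SimplyConnectedSpace ℂ := inferInstance

/-- The derivative `d/dx` of a function on the universal covering, written in the coordinate
`ξ = log x`. -/
noncomputable def xDeriv (f : ℂ → ℂ) (ξ : ℂ) : ℂ := deriv f ξ / Complex.exp ξ

theorem xDeriv_comp_exp {g : ℂ → ℂ} {ξ : ℂ} (hg : DifferentiableAt ℂ g (Complex.exp ξ)) :
    xDeriv (fun η => g (Complex.exp η)) ξ = deriv g (Complex.exp ξ) := by
  have h : HasDerivAt (fun η => g (Complex.exp η))
      (deriv g (Complex.exp ξ) * Complex.exp ξ) ξ :=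
    hg.hasDerivAt.comp ξ (Complex.hasDerivAt_exp ξ)
  rw [xDeriv, h.deriv, mul_div_cancel_right₀ _ (Complex.exp_ne_zero ξ)]

/-- `f`, a function on the universal covering, is a holomorphic solution on the (open) set `U`
of the fifth Painlevé equation with parameters `θ₀, θₓ, θ_∞`.  The values `0` and `1`, at which
the equation is singular, are not taken. -/
def IsSolution (θ₀ θₓ θinf : ℂ) (U : Set ℂ) (f : ℂ → ℂ) : Prop :=
  DifferentiableOn ℂ f U ∧ ∀ ξ ∈ U, f ξ ≠ 0 ∧ f ξ ≠ 1 ∧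
    xDeriv (xDeriv f) ξ =
      (1 / (2 * f ξ) + 1 / (f ξ - 1)) * xDeriv f ξ ^ 2
        - 1 / Complex.exp ξ * xDeriv f ξ
        + (f ξ - 1) ^ 2 / (8 * Complex.exp ξ ^ 2)
          * ((θ₀ - θₓ + θinf) ^ 2 * f ξ - (θ₀ - θₓ - θinf) ^ 2 / f ξ)
        + (1 - θ₀ - θₓ) * (f ξ / Complex.exp ξ)
        - f ξ * (f ξ + 1) / (2 * (f ξ - 1))

/-- The domain `Ω*_ρ(ε, Θ)`, where `r` is the logarithm of `ρ`:
`|ρ x| < ε`, `|x (ρ x)^(-1/2)| < ε`, `|arg (ρ x)| < Θ`. -/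
def OmegaStarAt (ε Θ : ℝ) (r : ℂ) : Set ℂ :=
  {ξ | ‖Complex.exp (r + ξ)‖ < ε ∧ ‖Complex.exp (ξ + (-1 / 2) * (r + ξ))‖ < ε ∧
    |(r + ξ).im| < Θ}

/-- The domain `Ω*(ε, Θ)`, the union of all `{ρ} × Ω*_ρ(ε, Θ)`. -/
def OmegaStar (ε Θ : ℝ) : Set (ℂ × ℂ) := ⋃ r : ℂ, {r} ×ˢ OmegaStarAt ε Θ r

theorem mem_OmegaStar {ε Θ : ℝ} {p : ℂ × ℂ} :
    p ∈ OmegaStar ε Θ ↔ p.2 ∈ OmegaStarAt ε Θ p.1 := by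
  simp only [OmegaStar, Set.mem_iUnion, Set.mem_prod, Set.mem_singleton_iff]
  exact ⟨fun ⟨r, h1, h2⟩ => h1 ▸ h2, fun h => ⟨p.1, rfl, h⟩⟩

theorem isOpen_OmegaStar (ε Θ : ℝ) : IsOpen (OmegaStar ε Θ) := by
  have h1 : IsOpen {p : ℂ × ℂ | ‖Complex.exp (p.1 + p.2)‖ < ε} :=
    isOpen_lt (by fun_prop) continuous_const
  have h2 : IsOpen {p : ℂ × ℂ | ‖Complex.exp (p.2 + (-1 / 2) * (p.1 + p.2))‖ < ε} :=
    isOpen_lt (by fun_prop) continuous_const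
  have h3 : IsOpen {p : ℂ × ℂ | |(p.1 + p.2).im| < Θ} :=
    isOpen_lt (Complex.continuous_im.comp
      (by fun_prop : Continuous fun p : ℂ × ℂ => p.1 + p.2)).abs continuous_const
  have h : OmegaStar ε Θ = {p : ℂ × ℂ | ‖Complex.exp (p.1 + p.2)‖ < ε} ∩
      ({p : ℂ × ℂ | ‖Complex.exp (p.2 + (-1 / 2) * (p.1 + p.2))‖ < ε} ∩
        {p : ℂ × ℂ | |(p.1 + p.2).im| < Θ}) := by
    ext p
    exact mem_OmegaStar
  rw [h]
  exact h1.inter (h2.inter h3)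

theorem isOpen_OmegaStarAt (ε Θ : ℝ) (r : ℂ) : IsOpen (OmegaStarAt ε Θ r) := by
  have h : OmegaStarAt ε Θ r = (fun ξ : ℂ => (r, ξ)) ⁻¹' OmegaStar ε Θ := by
    ext ξ
    exact (mem_OmegaStar (p := (r, ξ))).symm
  rw [h]
  exact (isOpen_OmegaStar ε Θ).preimage (by fun_prop)

/-- `v` is the sum of the (absolutely) convergent series
`1 + a L^(-k) + ∑_{j ≥ k+1} c_j L^(-j) + ∑_{n ≥ 1} x^n ∑_{j ≥ 0} c_{jn} L^(m n - j)`.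
Here `d j n` stands for `c_{jn}`; the values `c j` with `j ≤ k` and `d j 0` do not occur. -/
def IsInvLogSum (a : ℂ) (k m : ℕ) (c : ℕ → ℂ) (d : ℕ → ℕ → ℂ) (x L v : ℂ) : Prop :=
  ∃ s₁ s₂ : ℂ,
    HasSum (fun i : ℕ => c (k + 1 + i) * L ^ (-((k + 1 + i : ℕ) : ℤ))) s₁ ∧
    HasSum (fun p : ℕ × ℕ =>
      x ^ (p.1 + 1) * (d p.2 (p.1 + 1) * L ^ (((m * (p.1 + 1) : ℕ) : ℤ) - (p.2 : ℤ)))) s₂ ∧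
    v = 1 + a * L ^ (-(k : ℤ)) + s₁ + s₂

/-- The Painlevé equation has a one-parameter family of solutions of inverse logarithmic type with
leading term `1 + a log^(-k)(ρ x)` and series coefficients `c`, `d`: for every `Θ > 0` there are
`ε > 0` and a function `y(ρ, x)`, holomorphic on `Ω*(ε, Θ)`, which solves the equation for every
`ρ` and is there the sum of its series. The variables are the logarithms `r`, `ξ` of `ρ`, `x`. -/
def IsInvLogFamily (θ₀ θₓ θinf : ℂ) (a : ℂ) (k m : ℕ) (c : ℕ → ℂ) (d : ℕ → ℕ → ℂ) : Prop :=
  ∀ Θ : ℝ, 0 < Θ → ∃ ε : ℝ, 0 < ε ∧ ∃ y : ℂ × ℂ → ℂ,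
    DifferentiableOn ℂ y (OmegaStar ε Θ) ∧
    (∀ r : ℂ, IsSolution θ₀ θₓ θinf (OmegaStarAt ε Θ r) fun ξ => y (r, ξ)) ∧
    ∀ r ξ : ℂ, (r, ξ) ∈ OmegaStar ε Θ →
      IsInvLogSum a k m c d (Complex.exp ξ) (r + ξ) (y (r, ξ))

/-- All the coefficients lie in the ring `R`. -/
def CoeffsIn (R : Subalgebra ℚ ℂ) (c : ℕ → ℂ) (d : ℕ → ℕ → ℂ) : Prop :=
  (∀ j, c j ∈ R) ∧ ∀ j n, d j n ∈ R

end PainleveV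

/-! Equation (V) comes from an isomonodromic deformation: for traceless matrices A = [[p, q], [r,
-p]] and N = [[-t, b], [c, t]], t = θ_∞/2, one asks for x A' = [N, A], x b' = x (b - q), x c' = x (r
- c). The determinants of A and of N - A are conserved, and they are fixed to be -θ₀²/4 and -θₓ²/4.
Then y = -(b - q)(p + θ₀/2) / (q (p + t - θₓ/2)) and z = p - θ₀/2 satisfy a first order system that
implies (V) (`hasDerivAt_y`, `rhsZ_eq`, `isSolution_of_system`).

Logarithms appear when the value N₀ of N at x = 0 is nilpotent: the leading part of A is then exp(L
N₀) G exp(-L N₀), a polynomial of degree at most 2 in L = log (ρ x). The unknowns are power series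
in x over ℂ[L], on which x d/dx acts at order n as n + d/dL. This operator is inverted using only
division by n, so coefficients stay in a ℚ-algebra, and [N₀, ·] is nilpotent, so each order is
solved by a finite sum (`resolvent_spec`). A weighted norm on ℂ[L] turns the recursion into
geometric bounds (`IsRec.geometric_bound`). Only L depends on ρ, so one set of coefficients serves
every ρ.

A series whose coefficient of x^n has degree at most M n + D is L^D times a convergent power series
in x L^M and 1/L, and both of these are small on Ω* (`norm_exp_mul_pow_le`). Writing y = 1 + f/g and
inverting g as such a series gives the required expansion (`Ser.exists_ratio`,
`exists_family_of_quotient`). Only the leading coefficient of g is inverted, which is where the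
inverses in R come from.

The cases of the theorem are choices of N₀ and of the leading term compatible with the two
determinants. The last case has q = 0, so the quotient for y breaks down; a linear system replaces
it (`exists_family_of_riccati`). -/

namespace PainleveV

open Polynomial Finset Filter Topology

section

/-! ### Weighted norm on polynomials -/

/-- The weighted `ℓ¹`-norm of the coefficients of a polynomial, with weight `8 ^ j` at `X ^ j`. -/
noncomputable def pnorm (P : ℂ[X]) : ℝ := P.sum fun j a => ‖a‖ * 8 ^ j

theorem pnorm_eq_sum_range {P : ℂ[X]} {n : ℕ} (h : P.natDegree < n) :
    pnorm P = ∑ j ∈ range n, ‖P.coeff j‖ * 8 ^ j :=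
  Polynomial.sum_over_range' _ (by simp) _ h

theorem pnorm_nonneg (P : ℂ[X]) : 0 ≤ pnorm P :=
  Finset.sum_nonneg fun _ _ => by positivity

@[simp] theorem pnorm_zero : pnorm 0 = 0 := by simp [pnorm]

theorem pnorm_monomial (j : ℕ) (a : ℂ) : pnorm (monomial j a) = ‖a‖ * 8 ^ j := by
  simp [pnorm, Polynomial.sum_monomial_index]

theorem pnorm_C (a : ℂ) : pnorm (C a) = ‖a‖ := by
  simpa using pnorm_monomial 0 a

theorem pnorm_add_le (P Q : ℂ[X]) : pnorm (P + Q) ≤ pnorm P + pnorm Q := by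
  set n := max P.natDegree Q.natDegree + 1
  have hP : P.natDegree < n := by omega
  have hQ : Q.natDegree < n := by omega
  have hPQ : (P + Q).natDegree < n := (natDegree_add_le P Q).trans_lt (by omega)
  rw [pnorm_eq_sum_range hP, pnorm_eq_sum_range hQ, pnorm_eq_sum_range hPQ, ← sum_add_distrib]
  refine sum_le_sum fun j _ => ?_
  rw [coeff_add, ← add_mul]
  gcongr
  exact norm_add_le _ _

theorem pnorm_neg (P : ℂ[X]) : pnorm (-P) = pnorm P := by
  rw [pnorm_eq_sum_range (n := P.natDegree + 1) (by simp),
    pnorm_eq_sum_range (n := P.natDegree + 1) (by simp)]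
  simp

theorem pnorm_sub_le (P Q : ℂ[X]) : pnorm (P - Q) ≤ pnorm P + pnorm Q := by
  rw [sub_eq_add_neg, ← pnorm_neg Q]
  exact pnorm_add_le _ _

theorem pnorm_sum_le {ι : Type*} (s : Finset ι) (f : ι → ℂ[X]) :
    pnorm (∑ i ∈ s, f i) ≤ ∑ i ∈ s, pnorm (f i) :=
  Finset.le_sum_of_subadditive pnorm pnorm_zero.le pnorm_add_le s f

theorem pnorm_mul_le (P Q : ℂ[X]) : pnorm (P * Q) ≤ pnorm P * pnorm Q := by
  have h : P * Q = ∑ i ∈ P.support, ∑ j ∈ Q.support,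
      monomial (i + j) (P.coeff i * Q.coeff j) := by
    conv_lhs => rw [P.as_sum_support, Q.as_sum_support, sum_mul_sum]
    simp [monomial_mul_monomial]
  rw [h]
  calc _ ≤ ∑ i ∈ P.support, ∑ j ∈ Q.support,
        pnorm (monomial (i + j) (P.coeff i * Q.coeff j)) :=
      (pnorm_sum_le _ _).trans (sum_le_sum fun i _ => pnorm_sum_le _ _)
    _ = pnorm P * pnorm Q := by
      rw [pnorm, pnorm, Polynomial.sum, Polynomial.sum, sum_mul_sum]
      refine sum_congr rfl fun i _ => sum_congr rfl fun j _ => ?_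
      rw [pnorm_monomial, norm_mul, pow_add]
      ring

theorem pnorm_C_mul (a : ℂ) (P : ℂ[X]) : pnorm (C a * P) = ‖a‖ * pnorm P := by
  rw [pnorm_eq_sum_range (n := P.natDegree + 1) (Nat.lt_succ_of_le (natDegree_C_mul_le a P)),
    pnorm_eq_sum_range (n := P.natDegree + 1) (by simp), mul_sum]
  refine sum_congr rfl fun j _ => ?_
  rw [coeff_C_mul, norm_mul, mul_assoc]

/-- Differentiation costs a factor at most d but lowers the weight by 8. The weight 8 is chosen so
that on degrees up to 4n the derivative is bounded by n/2. -/
theorem pnorm_derivative_le {P : ℂ[X]} {d : ℕ} (h : P.natDegree ≤ d) :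
    pnorm (derivative P) ≤ d / 8 * pnorm P := by
  rw [pnorm_eq_sum_range (n := d + 1) (P := P) (by omega),
    pnorm_eq_sum_range (n := d + 1) (P := derivative P)
      (by have := natDegree_derivative_le P; omega), mul_sum, sum_range_succ, sum_range_succ']
  have h0 : (derivative P).coeff d = 0 := by
    rw [coeff_derivative, coeff_eq_zero_of_natDegree_lt (by omega), zero_mul]
  rw [h0, norm_zero, zero_mul, add_zero]
  have : 0 ≤ (d : ℝ) / 8 * (‖P.coeff 0‖ * 8 ^ 0) := by positivity
  refine le_add_of_le_of_nonneg (sum_le_sum fun j hj => ?_) this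
  rw [coeff_derivative, norm_mul]
  have h1 : ‖(j : ℂ) + 1‖ ≤ d := by
    have : ‖((j + 1 : ℕ) : ℂ)‖ = ((j + 1 : ℕ) : ℝ) := Complex.norm_natCast _
    push_cast at this
    rw [this]
    have := mem_range.1 hj
    exact_mod_cast this
  calc ‖P.coeff (j + 1)‖ * ‖(j : ℂ) + 1‖ * 8 ^ j ≤ ‖P.coeff (j + 1)‖ * d * 8 ^ j := by gcongr
    _ = _ := by rw [pow_succ]; ring

theorem norm_eval_le {P : ℂ[X]} {d : ℕ} (h : P.natDegree ≤ d) {z : ℂ} (hz : 1 ≤ ‖z‖) :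
    ‖P.eval z‖ ≤ pnorm P * ‖z‖ ^ d := by
  rw [eval_eq_sum_range' (n := d + 1) (by omega), pnorm_eq_sum_range (n := d + 1) (by omega),
    sum_mul]
  refine (norm_sum_le _ _).trans (sum_le_sum fun j hj => ?_)
  rw [norm_mul, norm_pow, mul_assoc]
  have h1 : (1 : ℝ) ≤ 8 ^ j := one_le_pow₀ (by norm_num)
  have h2 : ‖z‖ ^ j ≤ ‖z‖ ^ d := pow_le_pow_right₀ hz (by have := mem_range.1 hj; omega)
  gcongr
  nlinarith [pow_nonneg (norm_nonneg z) j]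

/-! ### Coefficient ring and degree -/

/-- The coefficients of `P` lie in `R`, and the degree of `P` is at most `e`. -/
def Adm (R : Subalgebra ℚ ℂ) (e : ℤ) (P : ℂ[X]) : Prop :=
  ∀ j : ℕ, P.coeff j ∈ R ∧ (e < j → P.coeff j = 0)

variable {R : Subalgebra ℚ ℂ} {e e' : ℤ} {P Q : ℂ[X]}

theorem Adm.mono (h : Adm R e P) (he : e ≤ e') : Adm R e' P :=
  fun j => ⟨(h j).1, fun hj => (h j).2 (by omega)⟩

theorem Adm.zero : Adm R e 0 := fun j => by simp

theorem Adm.add (hP : Adm R e P) (hQ : Adm R e Q) : Adm R e (P + Q) := fun j => by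
  refine ⟨by rw [coeff_add]; exact add_mem (hP j).1 (hQ j).1, fun hj => ?_⟩
  rw [coeff_add, (hP j).2 hj, (hQ j).2 hj, add_zero]

theorem Adm.neg (hP : Adm R e P) : Adm R e (-P) := fun j => by
  refine ⟨by rw [coeff_neg]; exact neg_mem (hP j).1, fun hj => ?_⟩
  rw [coeff_neg, (hP j).2 hj, neg_zero]

theorem Adm.sub (hP : Adm R e P) (hQ : Adm R e Q) : Adm R e (P - Q) := by
  rw [sub_eq_add_neg]
  exact hP.add hQ.neg

theorem Adm.sum {ι : Type*} {s : Finset ι} {f : ι → ℂ[X]} (h : ∀ i ∈ s, Adm R e (f i)) :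
    Adm R e (∑ i ∈ s, f i) :=
  Finset.sum_induction f (Adm R e) (fun _ _ => Adm.add) Adm.zero h

theorem Adm.mul (hP : Adm R e P) (hQ : Adm R e' Q) : Adm R (e + e') (P * Q) := fun j => by
  rw [coeff_mul]
  refine ⟨sum_mem fun i _ => mul_mem (hP _).1 (hQ _).1, fun hj => sum_eq_zero fun i hi => ?_⟩
  rw [HasAntidiagonal.mem_antidiagonal] at hi
  by_cases h : e < i.1
  · rw [(hP _).2 h, zero_mul]
  · rw [(hQ _).2 (by omega), mul_zero]

theorem Adm.C {a : ℂ} (ha : a ∈ R) (he : 0 ≤ e) : Adm R e (C a) := fun j => by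
  rw [coeff_C]
  split_ifs with h
  · subst h
    exact ⟨ha, fun hj => absurd hj (by push_cast; omega)⟩
  · exact ⟨zero_mem R, fun _ => rfl⟩

theorem Adm.X (he : 1 ≤ e) : Adm R e X := fun j => by
  rw [coeff_X]
  split_ifs with h
  · subst h
    exact ⟨one_mem R, fun hj => absurd hj (by push_cast; omega)⟩
  · exact ⟨zero_mem R, fun _ => rfl⟩

theorem Adm.C_mul {a : ℂ} (ha : a ∈ R) (hP : Adm R e P) : Adm R e (Polynomial.C a * P) := by
  simpa using (Adm.C ha le_rfl).mul hP

theorem Adm.derivative (hP : Adm R e P) : Adm R e (derivative P) := fun j => by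
  rw [coeff_derivative]
  refine ⟨mul_mem (hP _).1 (add_mem (natCast_mem R j) (one_mem R)), fun hj => ?_⟩
  rw [(hP _).2 (by push_cast; omega), zero_mul]

theorem Adm.natDegree_le (hP : Adm R e P) {d : ℕ} (he : e ≤ d) : P.natDegree ≤ d :=
  natDegree_le_iff_coeff_eq_zero.2 fun j hj => (hP j).2 (by omega)

theorem adm_top_natDegree (P : ℂ[X]) : Adm ⊤ P.natDegree P :=
  fun j => ⟨trivial, fun hj => coeff_eq_zero_of_natDegree_lt (by exact_mod_cast hj)⟩

/-! ### The operator `n + d/dL` and its inverse -/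

/-- The inverse of the operator `Q ↦ n Q + Q'` on polynomials. -/
noncomputable def shiftInv (n : ℕ) (P : ℂ[X]) : ℂ[X] :=
  ∑ i ∈ range (P.natDegree + 1),
    C ((-1) ^ i * ((n : ℂ)⁻¹) ^ (i + 1)) * derivative^[i] P

/-- The Neumann series of (n + d/dL)⁻¹ telescopes, and its remainder is a derivative of order
exceeding the degree. -/
theorem shiftInv_spec {n : ℕ} (hn : n ≠ 0) (P : ℂ[X]) :
    C (n : ℂ) * shiftInv n P + derivative (shiftInv n P) = P := by
  have hn' : (n : ℂ) ≠ 0 := Nat.cast_ne_zero.2 hn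
  have key : ∀ N : ℕ,
      C (n : ℂ) * (∑ i ∈ range N, C ((-1) ^ i * ((n : ℂ)⁻¹) ^ (i + 1)) * derivative^[i] P) +
        derivative (∑ i ∈ range N, C ((-1) ^ i * ((n : ℂ)⁻¹) ^ (i + 1)) * derivative^[i] P) =
      P - C ((-1) ^ N * ((n : ℂ)⁻¹) ^ N) * derivative^[N] P := by
    intro N
    induction N with
    | zero => simp
    | succ N ih =>
      rw [sum_range_succ, mul_add, derivative_add, add_add_add_comm, ih, derivative_C_mul,
        ← Function.iterate_succ_apply' derivative N P, ← mul_assoc, ← C_mul]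
      have h1 : (n : ℂ) * ((-1) ^ N * ((n : ℂ)⁻¹) ^ (N + 1)) = (-1) ^ N * ((n : ℂ)⁻¹) ^ N := by
        rw [pow_succ]; field_simp
      have h2 : (-1 : ℂ) ^ (N + 1) * ((n : ℂ)⁻¹) ^ (N + 1)
          = -((-1) ^ N * ((n : ℂ)⁻¹) ^ (N + 1)) := by
        rw [pow_succ (-1 : ℂ)]; ring
      rw [h1, h2, C_neg]
      ring
  rw [shiftInv, key, iterate_derivative_eq_zero (Nat.lt_succ_self _), mul_zero, sub_zero]

theorem Adm.shiftInv (hP : Adm R e P) (n : ℕ) : Adm R e (shiftInv n P) := by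
  refine Adm.sum fun i _ => Adm.C_mul ?_ ?_
  · have h : ((-1 : ℂ) ^ i * ((n : ℂ)⁻¹) ^ (i + 1))
        = algebraMap ℚ ℂ ((-1) ^ i * ((n : ℚ)⁻¹) ^ (i + 1)) := by simp
    rw [h]
    exact R.algebraMap_mem _
  · clear * - hP
    induction i with
    | zero => exact hP
    | succ i ih => rw [Function.iterate_succ_apply']; exact ih.derivative

theorem natDegree_shiftInv_le (n : ℕ) (P : ℂ[X]) : (shiftInv n P).natDegree ≤ P.natDegree :=
  ((adm_top_natDegree P).shiftInv n).natDegree_le le_rfl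

/-- From n Q = P - Q' and ‖Q'‖ ≤ (n/2) ‖Q‖ the derivative is absorbed on the left. The decay in n is
needed later to beat the number of terms in a convolution. -/
theorem pnorm_shiftInv_le {n : ℕ} (hn : n ≠ 0) (h : P.natDegree ≤ 4 * n) :
    pnorm (shiftInv n P) ≤ 2 / n * pnorm P := by
  have hn' : (0 : ℝ) < n := by positivity
  set Q := shiftInv n P with hQ
  have h1 : C (n : ℂ) * Q = P - derivative Q := by
    rw [eq_sub_iff_add_eq]; exact shiftInv_spec hn P
  have h2 : n * pnorm Q ≤ pnorm P + n / 2 * pnorm Q := by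
    calc n * pnorm Q = pnorm (C (n : ℂ) * Q) := by rw [pnorm_C_mul, Complex.norm_natCast]
      _ ≤ pnorm P + pnorm (derivative Q) := by rw [h1]; exact pnorm_sub_le _ _
      _ ≤ pnorm P + ((4 * n : ℕ) : ℝ) / 8 * pnorm Q := by
        gcongr
        exact pnorm_derivative_le ((natDegree_shiftInv_le n P).trans h)
      _ = _ := by push_cast; ring
  rw [div_mul_eq_mul_div, le_div_iff₀ hn']
  nlinarith

/-- The derivative does not reach the top degree, where only n times the leading coefficient
remains. -/
theorem eq_zero_of_shift_eq_zero {n : ℕ} (hn : n ≠ 0)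
    (h : C (n : ℂ) * P + derivative P = 0) : P = 0 := by
  by_contra h0
  have h1 := congrArg (fun Q => coeff Q P.natDegree) h
  simp only [coeff_add, coeff_C_mul, coeff_derivative, coeff_zero] at h1
  rw [coeff_eq_zero_of_natDegree_lt (Nat.lt_succ_self _), zero_mul, add_zero] at h1
  rcases mul_eq_zero.1 h1 with h2 | h2
  · exact hn (by exact_mod_cast h2)
  · exact h0 (leadingCoeff_eq_zero.1 h2)

end

section

/-! ### Formal solutions of the isomonodromic system -/

/-- Bracket of `[[0, b], [c, 0]]` with `[[p, q], [r, -p]]`, as the triple of entries `p, q, r`. -/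
noncomputable def bracket (l : ℂ[X] × ℂ[X]) (v : ℂ[X] × ℂ[X] × ℂ[X]) : ℂ[X] × ℂ[X] × ℂ[X] :=
  (l.1 * v.2.2 - l.2 * v.2.1, -(2 * l.1 * v.1), 2 * l.2 * v.1)

/-- Bracket of the constant matrix `[[-t, b], [c, t]]` with `[[p, q], [r, -p]]`. -/
noncomputable def adConst (t b c : ℂ) (v : ℂ[X] × ℂ[X] × ℂ[X]) : ℂ[X] × ℂ[X] × ℂ[X] :=
  (C b * v.2.2 - C c * v.2.1, -(2 * C t * v.2.1) - 2 * C b * v.1, 2 * C c * v.1 + 2 * C t * v.2.2)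

noncomputable def shiftInv₃ (n : ℕ) (v : ℂ[X] × ℂ[X] × ℂ[X]) : ℂ[X] × ℂ[X] × ℂ[X] :=
  (shiftInv n v.1, shiftInv n v.2.1, shiftInv n v.2.2)

noncomputable def shift₃ (n : ℕ) (v : ℂ[X] × ℂ[X] × ℂ[X]) : ℂ[X] × ℂ[X] × ℂ[X] :=
  (C (n : ℂ) * v.1 + derivative v.1, C (n : ℂ) * v.2.1 + derivative v.2.1,
    C (n : ℂ) * v.2.2 + derivative v.2.2)

noncomputable def pnorm₃ (v : ℂ[X] × ℂ[X] × ℂ[X]) : ℝ := pnorm v.1 + pnorm v.2.1 + pnorm v.2.2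

/-- The weight h tilts the degrees of the two off-diagonal entries in opposite directions. This
grading is respected by matrix brackets, and it is needed for strictly triangular N₀, where the
three entries have different degrees. -/
def Adm₃ (R : Subalgebra ℚ ℂ) (e h : ℤ) (v : ℂ[X] × ℂ[X] × ℂ[X]) : Prop :=
  Adm R e v.1 ∧ Adm R (e + h) v.2.1 ∧ Adm R (e - h) v.2.2

/-- The solution of `n F + F' - [N, F] = g`, where `N = [[-t, b], [c, t]]` is nilpotent. -/
noncomputable def resolvent (t b c : ℂ) (n : ℕ) (g : ℂ[X] × ℂ[X] × ℂ[X]) :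
    ℂ[X] × ℂ[X] × ℂ[X] :=
  shiftInv₃ n g + adConst t b c (shiftInv₃ n (shiftInv₃ n g)) +
    adConst t b c (adConst t b c (shiftInv₃ n (shiftInv₃ n (shiftInv₃ n g))))

variable {R : Subalgebra ℚ ℂ} {e h : ℤ} {t b₀ c₀ : ℂ}

theorem shift₃_shiftInv₃ {n : ℕ} (hn : n ≠ 0) (v : ℂ[X] × ℂ[X] × ℂ[X]) :
    shift₃ n (shiftInv₃ n v) = v := by
  simp only [shift₃, shiftInv₃, shiftInv_spec hn]

theorem shift₃_add (n : ℕ) (v w : ℂ[X] × ℂ[X] × ℂ[X]) :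
    shift₃ n (v + w) = shift₃ n v + shift₃ n w := by
  ext1
  · simp [shift₃]; ring
  · ext1 <;> simp [shift₃] <;> ring

theorem shift₃_adConst (n : ℕ) (v : ℂ[X] × ℂ[X] × ℂ[X]) :
    shift₃ n (adConst t b₀ c₀ v) = adConst t b₀ c₀ (shift₃ n v) := by
  ext1
  · simp [shift₃, adConst, derivative_mul]; ring
  · ext1 <;> simp [shift₃, adConst, derivative_mul] <;> ring

theorem adConst_add (v w : ℂ[X] × ℂ[X] × ℂ[X]) :
    adConst t b₀ c₀ (v + w) = adConst t b₀ c₀ v + adConst t b₀ c₀ w := by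
  ext1
  · simp [adConst]; ring
  · ext1 <;> simp [adConst] <;> ring

/-- The hypothesis says N² = 0, and every term of the threefold commutator contains N² on one side.
-/
theorem adConst_cube (hN : b₀ * c₀ = -t ^ 2) (v : ℂ[X] × ℂ[X] × ℂ[X]) :
    adConst t b₀ c₀ (adConst t b₀ c₀ (adConst t b₀ c₀ v)) = 0 := by
  have h : C b₀ * C c₀ = -C t ^ 2 := by rw [← C_mul, hN]; simp
  refine Prod.ext ?_ (Prod.ext ?_ ?_)
  · simp only [adConst, Prod.fst_zero]
    linear_combination (4 * (C b₀ * v.2.2 - C c₀ * v.2.1)) * h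
  · simp only [adConst, Prod.fst_zero, Prod.snd_zero]
    linear_combination (-(8 * C b₀ * v.1) - 8 * C t * v.2.1) * h
  · simp only [adConst, Prod.snd_zero]
    linear_combination (8 * C c₀ * v.1 + 8 * C t * v.2.2) * h

/-- With S = n + d/dL and T = [N, ·], which commute, the inverse of S - T is S⁻¹ + T S⁻² + T² S⁻³,
because T³ = 0. -/
theorem resolvent_spec (hN : b₀ * c₀ = -t ^ 2) {n : ℕ} (hn : n ≠ 0)
    (g : ℂ[X] × ℂ[X] × ℂ[X]) :
    shift₃ n (resolvent t b₀ c₀ n g) = g + adConst t b₀ c₀ (resolvent t b₀ c₀ n g) := by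
  simp only [resolvent, shift₃_add, shift₃_adConst, adConst_add, shift₃_shiftInv₃ hn,
    adConst_cube hN]
  abel

/-! ### Degrees, coefficient rings and norms under the bracket and the resolvent -/

theorem Adm₃.add {v w : ℂ[X] × ℂ[X] × ℂ[X]} (hv : Adm₃ R e h v) (hw : Adm₃ R e h w) :
    Adm₃ R e h (v + w) :=
  ⟨hv.1.add hw.1, hv.2.1.add hw.2.1, hv.2.2.add hw.2.2⟩

theorem Adm₃.sum {ι : Type*} {s : Finset ι} {f : ι → ℂ[X] × ℂ[X] × ℂ[X]}
    (hf : ∀ i ∈ s, Adm₃ R e h (f i)) : Adm₃ R e h (∑ i ∈ s, f i) :=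
  Finset.sum_induction f (Adm₃ R e h) (fun _ _ => Adm₃.add)
    ⟨Adm.zero, Adm.zero, Adm.zero⟩ hf

theorem Adm₃.shiftInv₃ {v : ℂ[X] × ℂ[X] × ℂ[X]} (hv : Adm₃ R e h v) (n : ℕ) :
    Adm₃ R e h (shiftInv₃ n v) :=
  ⟨hv.1.shiftInv n, hv.2.1.shiftInv n, hv.2.2.shiftInv n⟩

theorem Adm.two_mul {P : ℂ[X]} (hP : Adm R e P) : Adm R e (2 * P) := by
  rw [_root_.two_mul]
  exact hP.add hP

theorem Adm₃.bracket {l : ℂ[X] × ℂ[X]} {v : ℂ[X] × ℂ[X] × ℂ[X]} {e' : ℤ}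
    (hv : Adm₃ R e h v) (hb : Adm R (e' + h) l.1) (hc : Adm R (e' - h) l.2) :
    Adm₃ R (e' + e) h (bracket l v) := by
  refine ⟨((hb.mul hv.2.2).mono ?_).sub ((hc.mul hv.2.1).mono ?_),
    ((hb.two_mul.mul hv.1).mono ?_).neg, (hc.two_mul.mul hv.1).mono ?_⟩ <;> omega

theorem Adm₃.adConst {v : ℂ[X] × ℂ[X] × ℂ[X]} (hv : Adm₃ R e h v) (ht : t ∈ R)
    (hb : Adm R h (C b₀)) (hc : Adm R (-h) (C c₀)) : Adm₃ R e h (adConst t b₀ c₀ v) := by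
  have ht' : Adm R 0 (C t) := Adm.C ht le_rfl
  refine ⟨((hb.mul hv.2.2).mono ?_).sub ((hc.mul hv.2.1).mono ?_),
    ((ht'.two_mul.mul hv.2.1).mono ?_).neg.sub ((hb.two_mul.mul hv.1).mono ?_),
    ((hc.two_mul.mul hv.1).mono ?_).add ((ht'.two_mul.mul hv.2.2).mono ?_)⟩ <;> omega

theorem Adm₃.resolvent {v : ℂ[X] × ℂ[X] × ℂ[X]} (hv : Adm₃ R e h v) (ht : t ∈ R)
    (hb : Adm R h (C b₀)) (hc : Adm R (-h) (C c₀)) (n : ℕ) :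
    Adm₃ R e h (resolvent t b₀ c₀ n v) :=
  ((hv.shiftInv₃ n).add (((hv.shiftInv₃ n).shiftInv₃ n).adConst ht hb hc)).add
    (((((hv.shiftInv₃ n).shiftInv₃ n).shiftInv₃ n).adConst ht hb hc).adConst ht hb hc)

theorem pnorm₃_nonneg (v : ℂ[X] × ℂ[X] × ℂ[X]) : 0 ≤ pnorm₃ v :=
  add_nonneg (add_nonneg (pnorm_nonneg _) (pnorm_nonneg _)) (pnorm_nonneg _)

theorem pnorm₃_add_le (v w : ℂ[X] × ℂ[X] × ℂ[X]) : pnorm₃ (v + w) ≤ pnorm₃ v + pnorm₃ w := by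
  have h1 := pnorm_add_le v.1 w.1
  have h2 := pnorm_add_le v.2.1 w.2.1
  have h3 := pnorm_add_le v.2.2 w.2.2
  simp only [pnorm₃, Prod.fst_add, Prod.snd_add]
  linarith

theorem pnorm₃_sum_le {ι : Type*} (s : Finset ι) (f : ι → ℂ[X] × ℂ[X] × ℂ[X]) :
    pnorm₃ (∑ i ∈ s, f i) ≤ ∑ i ∈ s, pnorm₃ (f i) :=
  Finset.le_sum_of_subadditive pnorm₃ (by simp [pnorm₃]) pnorm₃_add_le s f

theorem pnorm_two_mul_mul_le (P Q : ℂ[X]) : pnorm (2 * P * Q) ≤ 2 * (pnorm P * pnorm Q) := by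
  rw [mul_assoc, show (2 : ℂ[X]) = C 2 from rfl, pnorm_C_mul]
  simpa using pnorm_mul_le P Q

theorem pnorm₃_bracket_le (l : ℂ[X] × ℂ[X]) (v : ℂ[X] × ℂ[X] × ℂ[X]) :
    pnorm₃ (bracket l v) ≤ 2 * ((pnorm l.1 + pnorm l.2) * pnorm₃ v) := by
  have h1 := (pnorm_sub_le (l.1 * v.2.2) (l.2 * v.2.1)).trans
    (add_le_add (pnorm_mul_le _ _) (pnorm_mul_le _ _))
  have h2 := pnorm_two_mul_mul_le l.1 v.1
  have h3 := pnorm_two_mul_mul_le l.2 v.1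
  have hb := pnorm_nonneg l.1
  have hc := pnorm_nonneg l.2
  have hq := pnorm_nonneg v.2.1
  have hr := pnorm_nonneg v.2.2
  simp only [pnorm₃, bracket, pnorm_neg]
  nlinarith [mul_nonneg hb hq, mul_nonneg hb hr, mul_nonneg hc hq, mul_nonneg hc hr]

theorem pnorm₃_adConst_le (v : ℂ[X] × ℂ[X] × ℂ[X]) :
    pnorm₃ (adConst t b₀ c₀ v) ≤ 2 * (‖t‖ + ‖b₀‖ + ‖c₀‖) * pnorm₃ v := by
  have h1 := (pnorm_sub_le (C b₀ * v.2.2) (C c₀ * v.2.1))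
  have h2 := pnorm_sub_le (-(2 * C t * v.2.1)) (2 * C b₀ * v.1)
  have h3 := pnorm_add_le (2 * C c₀ * v.1) (2 * C t * v.2.2)
  have h4 := pnorm_two_mul_mul_le (C t) v.2.1
  have h5 := pnorm_two_mul_mul_le (C b₀) v.1
  have h6 := pnorm_two_mul_mul_le (C c₀) v.1
  have h7 := pnorm_two_mul_mul_le (C t) v.2.2
  rw [pnorm_neg] at h2
  rw [pnorm_C_mul, pnorm_C_mul] at h1
  rw [pnorm_C] at h4 h5 h6 h7
  have hp := pnorm_nonneg v.1
  have hq := pnorm_nonneg v.2.1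
  have hr := pnorm_nonneg v.2.2
  simp only [pnorm₃, adConst]
  nlinarith [mul_nonneg (norm_nonneg t) hp, mul_nonneg (norm_nonneg b₀) hq,
    mul_nonneg (norm_nonneg b₀) hr, mul_nonneg (norm_nonneg c₀) hq,
    mul_nonneg (norm_nonneg c₀) hr]

/-- All three entries have degree at most `d`. -/
def DegLE₃ (d : ℕ) (v : ℂ[X] × ℂ[X] × ℂ[X]) : Prop :=
  v.1.natDegree ≤ d ∧ v.2.1.natDegree ≤ d ∧ v.2.2.natDegree ≤ d

theorem DegLE₃.shiftInv₃ {d : ℕ} {v : ℂ[X] × ℂ[X] × ℂ[X]} (hv : DegLE₃ d v) (n : ℕ) :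
    DegLE₃ d (shiftInv₃ n v) :=
  ⟨(natDegree_shiftInv_le n _).trans hv.1, (natDegree_shiftInv_le n _).trans hv.2.1,
    (natDegree_shiftInv_le n _).trans hv.2.2⟩

theorem pnorm₃_shiftInv₃_le {n : ℕ} (hn : n ≠ 0) {v : ℂ[X] × ℂ[X] × ℂ[X]}
    (hv : DegLE₃ (4 * n) v) : pnorm₃ (shiftInv₃ n v) ≤ 2 / n * pnorm₃ v := by
  have h1 := pnorm_shiftInv_le hn hv.1
  have h2 := pnorm_shiftInv_le hn hv.2.1
  have h3 := pnorm_shiftInv_le hn hv.2.2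
  simp only [pnorm₃, shiftInv₃]
  linarith

/-- Only the first of the inverse shifts keeps its factor 2/n; the further ones are bounded by 2 and
each commutator by τ, whence 1 + 2τ + 4τ². -/
theorem pnorm₃_resolvent_le {n : ℕ} (hn : n ≠ 0) {v : ℂ[X] × ℂ[X] × ℂ[X]}
    (hv : DegLE₃ (4 * n) v) {τ : ℝ} (hτ : τ = 2 * (‖t‖ + ‖b₀‖ + ‖c₀‖)) :
    pnorm₃ (resolvent t b₀ c₀ n v) ≤ (1 + 2 * τ + 4 * τ ^ 2) * (2 / n * pnorm₃ v) := by
  have hτ0 : 0 ≤ τ := by rw [hτ]; positivity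
  have h2n : (2 : ℝ) / n ≤ 2 := by
    rw [div_le_iff₀ (by positivity)]
    have : (1 : ℝ) ≤ n := by exact_mod_cast Nat.one_le_iff_ne_zero.2 hn
    linarith
  set u₁ := shiftInv₃ n v with hu₁
  set u₂ := shiftInv₃ n u₁ with hu₂
  set u₃ := shiftInv₃ n u₂ with hu₃
  have d₁ : DegLE₃ (4 * n) u₁ := hv.shiftInv₃ n
  have d₂ : DegLE₃ (4 * n) u₂ := d₁.shiftInv₃ n
  have b₁ : pnorm₃ u₁ ≤ 2 / n * pnorm₃ v := pnorm₃_shiftInv₃_le hn hv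
  have b₂ : pnorm₃ u₂ ≤ 2 * pnorm₃ u₁ :=
    (pnorm₃_shiftInv₃_le hn d₁).trans (by gcongr; exact pnorm₃_nonneg _)
  have b₃ : pnorm₃ u₃ ≤ 2 * pnorm₃ u₂ :=
    (pnorm₃_shiftInv₃_le hn d₂).trans (by gcongr; exact pnorm₃_nonneg _)
  have hT : ∀ w, pnorm₃ (adConst t b₀ c₀ w) ≤ τ * pnorm₃ w := fun w => by
    rw [hτ]; exact pnorm₃_adConst_le w
  calc pnorm₃ (resolvent t b₀ c₀ n v)
      ≤ pnorm₃ u₁ + pnorm₃ (adConst t b₀ c₀ u₂) +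
          pnorm₃ (adConst t b₀ c₀ (adConst t b₀ c₀ u₃)) :=
        (pnorm₃_add_le _ _).trans (by gcongr; exact pnorm₃_add_le _ _)
    _ ≤ pnorm₃ u₁ + τ * (2 * pnorm₃ u₁) + τ * (τ * (2 * (2 * pnorm₃ u₁))) := by
        gcongr
        · exact (hT _).trans (by gcongr)
        · exact (hT _).trans (by gcongr; exact (hT _).trans (by gcongr; exact b₃.trans (by gcongr)))
    _ = (1 + 2 * τ + 4 * τ ^ 2) * pnorm₃ u₁ := by ring
    _ ≤ _ := by gcongr

/-- Recursive construction of a sequence whose next term depends on all the previous ones. -/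
theorem exists_seq_of_step {α : Type*} (a : α) (step : ℕ → (ℕ → α) → α)
    (hstep : ∀ n F G, (∀ k ≤ n, F k = G k) → step n F = step n G) :
    ∃ F : ℕ → α, F 0 = a ∧ ∀ n, F (n + 1) = step n F := by
  -- At stage n a whole sequence is kept, with final values up to index n and the junk value `a`
  -- beyond; `hstep` makes the junk harmless.
  let hist : ℕ → ℕ → α := fun n => Nat.rec (fun _ => a)
    (fun n H => Function.update H (n + 1) (step n H)) n
  have h1 : ∀ n, hist (n + 1) = Function.update (hist n) (n + 1) (step n (hist n)) := fun _ => rfl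
  have h2 : ∀ n k, k ≤ n → hist n k = hist k k := by
    intro n
    induction n with
    | zero => intro k hk; rw [Nat.le_zero.1 hk]
    | succ n ih =>
      intro k hk
      rcases hk.lt_or_eq with hk | rfl
      · rw [h1, Function.update_of_ne hk.ne, ih k (Nat.lt_succ_iff.1 hk)]
      · rfl
  refine ⟨fun n => hist n n, rfl, fun n => ?_⟩
  simp only
  rw [h1, Function.update_self]
  exact hstep n _ _ fun k hk => h2 n k hk

/-- Data of a nilpotent leading term for the isomonodromic system: `m` and `h` control the
degrees in the logarithm. -/
structure LeadingTerm (R : Subalgebra ℚ ℂ) (m : ℕ) (h : ℤ) (t b₀ c₀ : ℂ)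
    (A₀ : ℂ[X] × ℂ[X] × ℂ[X]) : Prop where
  one_le : 1 ≤ m
  le_two : m + |h| ≤ 2
  nilpotent : b₀ * c₀ = -t ^ 2
  t_mem : t ∈ R
  adm_b : Adm R h (C b₀)
  adm_c : Adm R (-h) (C c₀)
  adm : Adm₃ R m h A₀
  eqn : shift₃ 0 A₀ = adConst t b₀ c₀ A₀

/-! ### The recursion in powers of x: degrees and geometric growth -/

section Recursion

/-- The recursion step for the coefficients `((p, q, r), (b, c))`. -/
noncomputable def stepFun (t b₀ c₀ : ℂ) (n : ℕ)
    (F : ℕ → (ℂ[X] × ℂ[X] × ℂ[X]) × (ℂ[X] × ℂ[X])) :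
    (ℂ[X] × ℂ[X] × ℂ[X]) × (ℂ[X] × ℂ[X]) :=
  let l : ℂ[X] × ℂ[X] := (shiftInv (n + 1) ((F n).2.1 - (F n).1.2.1),
    shiftInv (n + 1) ((F n).1.2.2 - (F n).2.2))
  (resolvent t b₀ c₀ (n + 1)
    (∑ i ∈ range n, bracket (F (i + 1)).2 (F (n - i)).1 + bracket l (F 0).1), l)

/-- The coefficient sequences produced by the recursion. -/
structure IsRec (t b₀ c₀ : ℂ) (A₀ : ℂ[X] × ℂ[X] × ℂ[X])
    (F : ℕ → (ℂ[X] × ℂ[X] × ℂ[X]) × (ℂ[X] × ℂ[X])) : Prop where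
  zero : F 0 = (A₀, (C b₀, C c₀))
  b_succ : ∀ n, (F (n + 1)).2.1 = shiftInv (n + 1) ((F n).2.1 - (F n).1.2.1)
  c_succ : ∀ n, (F (n + 1)).2.2 = shiftInv (n + 1) ((F n).1.2.2 - (F n).2.2)
  A_succ : ∀ n, (F (n + 1)).1 = resolvent t b₀ c₀ (n + 1)
      (∑ i ∈ range n, bracket (F (i + 1)).2 (F (n - i)).1 + bracket (F (n + 1)).2 (F 0).1)

theorem exists_isRec (t b₀ c₀ : ℂ) (A₀ : ℂ[X] × ℂ[X] × ℂ[X]) : ∃ F, IsRec t b₀ c₀ A₀ F := by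
  obtain ⟨F, hF0, hF⟩ := exists_seq_of_step (A₀, (C b₀, C c₀)) (stepFun t b₀ c₀) (by
    intro n F G hFG
    have h1 : ∀ i ∈ range n, bracket (F (i + 1)).2 (F (n - i)).1 =
        bracket (G (i + 1)).2 (G (n - i)).1 := fun i hi => by
      rw [hFG _ (Nat.succ_le_of_lt (mem_range.1 hi)), hFG _ (Nat.sub_le n i)]
    simp only [stepFun, hFG n le_rfl, hFG 0 (Nat.zero_le n), sum_congr rfl h1])
  have hl : ∀ n, (F (n + 1)).2 = (shiftInv (n + 1) ((F n).2.1 - (F n).1.2.1),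
      shiftInv (n + 1) ((F n).1.2.2 - (F n).2.2)) := fun n => by rw [hF, stepFun]
  refine ⟨F, hF0, fun n => by rw [hl], fun n => by rw [hl], fun n => ?_⟩
  rw [hl, hF, stepFun]

variable {m : ℕ} {A₀ : ℂ[X] × ℂ[X] × ℂ[X]}
  {F : ℕ → (ℂ[X] × ℂ[X] × ℂ[X]) × (ℂ[X] × ℂ[X])}

theorem IsRec.adm_source {n : ℕ} (h1 : ∀ k ≤ n, Adm₃ R (m * k + m) h (F k).1)
    (h2 : ∀ k ≤ n + 1, Adm R (m * k + h) (F k).2.1 ∧ Adm R (m * k - h) (F k).2.2) :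
    Adm₃ R (m * (n + 1 : ℕ) + m) h
      (∑ i ∈ range n, bracket (F (i + 1)).2 (F (n - i)).1 +
        bracket (F (n + 1)).2 (F 0).1) := by
  refine Adm₃.add (Adm₃.sum fun i hi => ?_) ?_
  · have hi := mem_range.1 hi
    have h3 := h2 (i + 1) (by omega)
    have h4 := (h1 (n - i) (by omega)).bracket h3.1 h3.2
    have h5 : (m : ℤ) * (i + 1 : ℕ) + (m * (n - i : ℕ) + m) = m * (n + 1 : ℕ) + m := by
      push_cast [Nat.cast_sub hi.le]
      ring
    rwa [h5] at h4
  · have h3 := h2 (n + 1) le_rfl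
    have h4 := (h1 0 (by omega)).bracket h3.1 h3.2
    have h5 : (m : ℤ) * (n + 1 : ℕ) + (m * (0 : ℕ) + m) = m * (n + 1 : ℕ) + m := by
      push_cast
      ring
    rwa [h5] at h4

/-- The factor x in the equations for b and c passes the degree m n + m ± h of the off-diagonal
entries of A at order n to b and c at order n + 1, without further loss; brackets then add degrees.
So each power of x costs m powers of L. -/
theorem IsRec.adm (hF : IsRec t b₀ c₀ A₀ F) (H : LeadingTerm R m h t b₀ c₀ A₀) (n : ℕ) :
    Adm₃ R (m * n + m) h (F n).1 ∧ Adm R (m * n + h) (F n).2.1 ∧ Adm R (m * n - h) (F n).2.2 := by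
  have hm := H.one_le
  have adm : ∀ n : ℕ, ∀ k ≤ n, Adm₃ R (m * k + m) h (F k).1 ∧ Adm R (m * k + h) (F k).2.1 ∧
      Adm R (m * k - h) (F k).2.2 := by
    intro n
    induction n with
    | zero =>
      intro k hk
      obtain rfl := Nat.le_zero.1 hk
      rw [hF.zero]
      refine ⟨?_, ?_, ?_⟩
      · simpa using H.adm
      · simpa using H.adm_b
      · simpa using H.adm_c
    | succ n ih =>
      intro k hk
      rcases hk.lt_or_eq with hk | rfl
      · exact ih k (Nat.lt_succ_iff.1 hk)
      · obtain ⟨⟨hp, hq, hr⟩, hb', hc'⟩ := ih n le_rfl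
        have e1 : Adm R (m * (n + 1 : ℕ) + h) (F (n + 1)).2.1 := by
          rw [hF.b_succ]
          refine Adm.shiftInv ((hb'.mono ?_).sub (hq.mono ?_)) _ <;> push_cast <;> linarith
        have e2 : Adm R (m * (n + 1 : ℕ) - h) (F (n + 1)).2.2 := by
          rw [hF.c_succ]
          refine Adm.shiftInv ((hr.mono ?_).sub (hc'.mono ?_)) _ <;> push_cast <;> linarith
        refine ⟨?_, e1, e2⟩
        rw [hF.A_succ]
        refine (IsRec.adm_source (fun k hk => (ih k hk).1) fun k hk => ?_).resolvent H.t_mem H.adm_b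
          H.adm_c _
        rcases hk.lt_or_eq with hk | rfl
        · exact (ih k (Nat.lt_succ_iff.1 hk)).2
        · exact ⟨e1, e2⟩
  exact adm n n le_rfl

/-- A majorant argument with unequal constants: A at order n is bounded by B Kⁿ, but b and c at
orders n ≥ 1 by c Kⁿ with c small. The n + 1 brackets of the source are compensated by the factor
2/(n + 1) of the resolvent, and smallness of c closes the induction. -/
theorem IsRec.geometric_bound (hF : IsRec t b₀ c₀ A₀ F) (H : LeadingTerm R m h t b₀ c₀ A₀) :
    ∃ B K : ℝ, ∀ n, pnorm₃ (F n).1 ≤ B * K ^ n ∧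
      pnorm (F n).2.1 + pnorm (F n).2.2 ≤ B * K ^ n := by
  have hm := H.one_le
  have hh := H.le_two
  have adm' := hF.adm H
  -- Here m + |h| ≤ 2 enters: the degrees are at most 2 (n + 1) + 2 ≤ 4 (n + 1), the range in which
  -- the inverse shift is controlled.
  have deg_g : ∀ (n : ℕ), DegLE₃ (4 * (n + 1)) (∑ i ∈ range n,
      bracket (F (i + 1)).2 (F (n - i)).1 + bracket (F (n + 1)).2 (F 0).1) := by
    intro n
    obtain ⟨h1, h2, h3⟩ := IsRec.adm_source (n := n) (fun k _ => (adm' k).1) fun k _ => (adm' k).2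
    have hm2 : (m : ℤ) ≤ 2 := by linarith [abs_nonneg h]
    have := le_abs_self h
    have := neg_abs_le h
    refine ⟨h1.natDegree_le ?_, h2.natDegree_le ?_, h3.natDegree_le ?_⟩ <;> push_cast <;>
      nlinarith
  have deg_l : ∀ n : ℕ, ((F n).2.1 - (F n).1.2.1).natDegree ≤ 4 * (n + 1) ∧
      ((F n).1.2.2 - (F n).2.2).natDegree ≤ 4 * (n + 1) := by
    intro n
    obtain ⟨⟨hp, hq, hr⟩, hb', hc'⟩ := adm' n
    have hm2 : (m : ℤ) ≤ 2 := by linarith [abs_nonneg h]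
    have := le_abs_self h
    have := neg_abs_le h
    refine ⟨((hb'.mono ?_).sub hq).natDegree_le ?_, (hr.sub (hc'.mono ?_)).natDegree_le ?_⟩ <;>
      push_cast <;> nlinarith
  set τ : ℝ := 2 * (‖t‖ + ‖b₀‖ + ‖c₀‖) with hτ
  have hτ0 : 0 ≤ τ := by positivity
  set κ : ℝ := 1 + 2 * τ + 4 * τ ^ 2 with hκ
  have hκ1 : 1 ≤ κ := by rw [hκ]; nlinarith [sq_nonneg τ]
  -- Chosen so that κ · 2/(n+1) · (n+1) · 2c = 1 in the estimate for A.
  set c : ℝ := 1 / (4 * κ) with hc_def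
  have hc0 : 0 < c := by positivity
  have hcκ : 4 * κ * c = 1 := by rw [hc_def]; field_simp
  set B : ℝ := pnorm₃ (F 0).1 + pnorm (F 0).2.1 + pnorm (F 0).2.2 + c with hB
  have hn1 := pnorm₃_nonneg (F 0).1
  have hn2 := pnorm_nonneg (F 0).2.1
  have hn3 := pnorm_nonneg (F 0).2.2
  have hBc : c ≤ B := by linarith
  -- Chosen so that the bound 4B Kⁿ obtained for b and c at order n + 1 equals c Kⁿ⁺¹.
  set K : ℝ := 4 * B / c with hK
  have hKc : K * c = 4 * B := by rw [hK]; field_simp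
  have hK1 : 0 < K := by have : 0 < B := by linarith
                         positivity
  set l : ℕ → ℝ := fun n => pnorm (F n).2.1 + pnorm (F n).2.2 with hl
  have bound : ∀ n : ℕ, ∀ k ≤ n, pnorm₃ (F k).1 ≤ B * K ^ k ∧ (k ≠ 0 → l k ≤ c * K ^ k) := by
    intro n
    induction n with
    | zero =>
      intro k hk
      obtain rfl := Nat.le_zero.1 hk
      exact ⟨by rw [pow_zero]; linarith, fun h => absurd rfl h⟩
    | succ n ih =>
      intro k hk
      rcases hk.lt_or_eq with hk | rfl
      · exact ih k (Nat.lt_succ_iff.1 hk)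
      have hn0 : (0 : ℝ) < (n + 1 : ℕ) := by positivity
      have h2n : (2 : ℝ) / (n + 1 : ℕ) ≤ 2 := by
        rw [div_le_iff₀ hn0]
        have : (1 : ℝ) ≤ (n + 1 : ℕ) := by exact_mod_cast Nat.succ_le_succ (Nat.zero_le n)
        linarith
      have hKn : 0 < K ^ n := by positivity
      have el : l (n + 1) ≤ c * K ^ (n + 1) := by
        have h1 : l (n + 1) ≤ 2 * (l n + pnorm₃ (F n).1) := by
          have e1 := pnorm_shiftInv_le n.succ_ne_zero (deg_l n).1
          have e2 := pnorm_shiftInv_le n.succ_ne_zero (deg_l n).2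
          have e3 := pnorm_sub_le (F n).2.1 (F n).1.2.1
          have e4 := pnorm_sub_le (F n).1.2.2 (F n).2.2
          have e5 : ∀ x : ℝ, 0 ≤ x → 2 / ((n + 1 : ℕ) : ℝ) * x ≤ 2 * x :=
            fun x hx => by gcongr
          have e6 := e5 _ (pnorm_nonneg ((F n).2.1 - (F n).1.2.1))
          have e7 := e5 _ (pnorm_nonneg ((F n).1.2.2 - (F n).2.2))
          have e8 := pnorm_nonneg (F n).1.1
          simp only [hl, pnorm₃]
          rw [hF.b_succ, hF.c_succ]
          linarith
        have h2 : l n ≤ B * K ^ n := by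
          rcases Nat.eq_zero_or_pos n with rfl | hn
          · rw [pow_zero]; simp only [hl]; linarith
          · exact ((ih n le_rfl).2 hn.ne').trans (by gcongr)
        have h3 := (ih n le_rfl).1
        calc l (n + 1) ≤ 2 * (l n + pnorm₃ (F n).1) := h1
          _ ≤ (4 * B) * K ^ n := by linarith
          _ = c * K ^ (n + 1) := by rw [← hKc, pow_succ]; ring
      refine ⟨?_, fun _ => el⟩
      have hg : pnorm₃ (∑ i ∈ range n, bracket (F (i + 1)).2 (F (n - i)).1 +
          bracket (F (n + 1)).2 (F 0).1) ≤ (n + 1 : ℕ) * (2 * (c * B * K ^ (n + 1))) := by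
        have h1 : ∀ i ≤ n, l (i + 1) ≤ c * K ^ (i + 1) → pnorm₃ (F (n - i)).1 ≤ B * K ^ (n - i) →
            pnorm₃ (bracket (F (i + 1)).2 (F (n - i)).1) ≤ 2 * (c * B * K ^ (n + 1)) := by
          intro i hi h1 h2
          calc _ ≤ 2 * (l (i + 1) * pnorm₃ (F (n - i)).1) := pnorm₃_bracket_le _ _
            _ ≤ 2 * ((c * K ^ (i + 1)) * (B * K ^ (n - i))) := by
              have := pnorm₃_nonneg (F (n - i)).1
              gcongr
            _ = 2 * (c * B * (K ^ (i + 1) * K ^ (n - i))) := by ring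
            _ = _ := by rw [← pow_add, show i + 1 + (n - i) = n + 1 by omega]
        refine (pnorm₃_add_le _ _).trans ?_
        have h2 := (pnorm₃_sum_le (range n) fun i => bracket (F (i + 1)).2 (F (n - i)).1).trans
          (sum_le_sum fun i hi => h1 i (mem_range.1 hi).le
            ((ih (i + 1) (mem_range.1 hi)).2 i.succ_ne_zero) (ih _ (Nat.sub_le n i)).1)
        have h3 := h1 n le_rfl el (by simpa using (ih 0 (Nat.zero_le n)).1)
        rw [Nat.sub_self] at h3
        rw [sum_const, card_range, nsmul_eq_mul] at h2
        push_cast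
        linarith
      rw [hF.A_succ]
      calc _ ≤ κ * (2 / ((n + 1 : ℕ) : ℝ) * ((n + 1 : ℕ) * (2 * (c * B * K ^ (n + 1))))) := by
            refine (pnorm₃_resolvent_le n.succ_ne_zero (deg_g n) hτ).trans ?_
            gcongr
        _ = (4 * κ * c) * (B * K ^ (n + 1)) := by field_simp; ring
        _ = _ := by rw [hcκ, one_mul]
  refine ⟨B, K, fun n => ⟨(bound n n le_rfl).1, ?_⟩⟩
  rcases Nat.eq_zero_or_pos n with rfl | hn
  · rw [pow_zero]; linarith
  · exact ((bound n n le_rfl).2 hn.ne').trans (by gcongr)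

end Recursion

end

section

/-! ### Power series in `x` with coefficients polynomial in `L = log (ρ x)` -/

/-- The derivation `x ∂/∂x + ∂/∂L`. -/
noncomputable def euler (f : PowerSeries ℂ[X]) : PowerSeries ℂ[X] :=
  PowerSeries.mk fun n => C (n : ℂ) * PowerSeries.coeff n f + derivative (PowerSeries.coeff n f)

@[simp] theorem coeff_euler (n : ℕ) (f : PowerSeries ℂ[X]) : PowerSeries.coeff n (euler f) =
    C (n : ℂ) * PowerSeries.coeff n f + derivative (PowerSeries.coeff n f) :=
  PowerSeries.coeff_mk _ _

theorem euler_add (f g : PowerSeries ℂ[X]) : euler (f + g) = euler f + euler g := by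
  ext1 n; simp; ring

theorem euler_sub (f g : PowerSeries ℂ[X]) : euler (f - g) = euler f - euler g := by
  ext1 n; simp; ring

theorem euler_mul (f g : PowerSeries ℂ[X]) : euler (f * g) = euler f * g + f * euler g := by
  ext1 n
  simp only [coeff_euler, map_add, PowerSeries.coeff_mul, mul_sum, derivative_sum,
    ← sum_add_distrib]
  refine sum_congr rfl fun i hi => ?_
  rw [← HasAntidiagonal.mem_antidiagonal.1 hi, derivative_mul]
  push_cast
  rw [C_add]
  ring

/-- A constant, as a power series with polynomial coefficients. -/
noncomputable def constSeries (a : ℂ) : PowerSeries ℂ[X] := PowerSeries.C (C a)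

theorem coeff_constSeries (n : ℕ) (a : ℂ) :
    PowerSeries.coeff n (constSeries a) = if n = 0 then C a else 0 := by
  rw [constSeries, PowerSeries.coeff_C]

@[simp] theorem euler_constSeries (a : ℂ) : euler (constSeries a) = 0 := by
  ext1 n
  rw [coeff_euler, coeff_constSeries]
  split_ifs with h <;> simp [h]

/-- Conserved quantities are thereby known from their value at order 0, since n + d/dL is injective
for n ≥ 1. -/
theorem eq_constSeries_of_euler_eq_zero {f : PowerSeries ℂ[X]} (h : euler f = 0) {a : ℂ}
    (h0 : PowerSeries.coeff 0 f = C a) : f = constSeries a := by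
  ext1 n
  rw [coeff_constSeries]
  split_ifs with hn
  · rw [hn, h0]
  · exact eq_zero_of_shift_eq_zero hn (by rw [← coeff_euler, h, map_zero])

/-- A series with coefficients in `R`, degree in `L` of the coefficient of `x ^ n` at most
`M n + D`, and geometrically bounded coefficients. -/
structure Ser (R : Subalgebra ℚ ℂ) (M : ℕ) (D : ℤ) (f : PowerSeries ℂ[X]) : Prop where
  adm : ∀ n : ℕ, Adm R (M * n + D) (PowerSeries.coeff n f)
  bdd : ∃ B K : ℝ, 0 ≤ B ∧ 1 ≤ K ∧ ∀ n, pnorm (PowerSeries.coeff n f) ≤ B * K ^ n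

variable {R : Subalgebra ℚ ℂ} {M M' : ℕ} {D D' : ℤ} {f g : PowerSeries ℂ[X]}

theorem Ser.mk' (h : ∀ n : ℕ, Adm R (M * n + D) (PowerSeries.coeff n f)) {B K : ℝ}
    (hb : ∀ n, pnorm (PowerSeries.coeff n f) ≤ B * K ^ n) : Ser R M D f := by
  refine ⟨h, |B|, |K| + 1, abs_nonneg B, by linarith [abs_nonneg K], fun n => (hb n).trans ?_⟩
  refine (le_abs_self _).trans ?_
  rw [abs_mul, abs_pow]
  gcongr
  linarith

theorem Ser.mono (h : Ser R M D f) (hM : M ≤ M') (hD : D ≤ D') : Ser R M' D' f := by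
  refine ⟨fun n => (h.adm n).mono ?_, h.bdd⟩
  have : (M : ℤ) * n ≤ M' * n := by gcongr
  linarith

/-- The degree in `L` may be lowered at the expense of `x`, if that of the leading term allows. -/
theorem Ser.shift (h : Ser R M D f) {k : ℕ} (hD : D ≤ D' + k)
    (h0 : Adm R D' (PowerSeries.coeff 0 f)) : Ser R (M + k) D' f := by
  refine ⟨fun n => ?_, h.bdd⟩
  rcases Nat.eq_zero_or_pos n with rfl | hn
  · simpa using h0
  · refine (h.adm n).mono ?_
    have h1 : (1 : ℤ) ≤ n := by exact_mod_cast hn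
    have h2 : (k : ℤ) ≤ k * n := le_mul_of_one_le_right (by positivity) h1
    push_cast
    linarith

theorem Ser.add (hf : Ser R M D f) (hg : Ser R M D g) : Ser R M D (f + g) := by
  obtain ⟨B, K, hB, hK, h1⟩ := hf.bdd
  obtain ⟨B', K', hB', hK', h2⟩ := hg.bdd
  refine ⟨fun n => by rw [map_add]; exact (hf.adm n).add (hg.adm n), B + B', K + K', by positivity,
    by linarith, fun n => ?_⟩
  rw [map_add]
  refine (pnorm_add_le _ _).trans ((add_le_add (h1 n) (h2 n)).trans ?_)
  rw [add_mul]
  gcongr <;> linarith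

theorem Ser.neg (hf : Ser R M D f) : Ser R M D (-f) := by
  refine ⟨fun n => by rw [map_neg]; exact (hf.adm n).neg, ?_⟩
  simpa only [map_neg, pnorm_neg] using hf.bdd

theorem Ser.sub (hf : Ser R M D f) (hg : Ser R M D g) : Ser R M D (f - g) := by
  rw [sub_eq_add_neg]
  exact hf.add hg.neg

theorem natCast_add_one_le_two_pow (n : ℕ) : (n : ℝ) + 1 ≤ 2 ^ n := by
  exact_mod_cast Nat.succ_le_of_lt n.lt_two_pow_self

theorem Ser.mul (hf : Ser R M D f) (hg : Ser R M D' g) : Ser R M (D + D') (f * g) := by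
  obtain ⟨B, K, hB, hK, h1⟩ := hf.bdd
  obtain ⟨B', K', hB', hK', h2⟩ := hg.bdd
  -- The factor 2 in the ratio absorbs the n + 1 ≤ 2ⁿ terms of the Cauchy product.
  refine ⟨fun n => ?_, B * B', 2 * (K * K'), by positivity, by nlinarith, fun n => ?_⟩
  · rw [PowerSeries.coeff_mul]
    refine Adm.sum fun i hi => ((hf.adm _).mul (hg.adm _)).mono ?_
    rw [← HasAntidiagonal.mem_antidiagonal.1 hi]
    push_cast
    linarith
  · rw [PowerSeries.coeff_mul]
    calc _ ≤ ∑ i ∈ antidiagonal n, B * B' * (K * K') ^ n := by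
          refine (pnorm_sum_le _ _).trans (sum_le_sum fun i hi => (pnorm_mul_le _ _).trans ?_)
          have hi := HasAntidiagonal.mem_antidiagonal.1 hi
          calc _ ≤ (B * K ^ i.1) * (B' * K' ^ i.2) :=
                mul_le_mul (h1 _) (h2 _) (pnorm_nonneg _) (by positivity)
            _ ≤ (B * K ^ n) * (B' * K' ^ n) := by gcongr <;> omega
            _ = _ := by rw [mul_pow]; ring
      _ = B * B' * (K * K') ^ n * ((n : ℝ) + 1) := by
          rw [sum_const, Nat.card_antidiagonal, nsmul_eq_mul]; push_cast; ring
      _ ≤ B * B' * (K * K') ^ n * 2 ^ n := by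
          gcongr; exact natCast_add_one_le_two_pow n
      _ = _ := by rw [mul_pow]; ring

theorem Ser.const {a : ℂ} (ha : a ∈ R) (hD : 0 ≤ D) : Ser R M D (constSeries a) := by
  refine Ser.mk' (B := ‖a‖) (K := 1) (fun n => ?_) fun n => ?_
  · rw [coeff_constSeries]
    split_ifs
    · exact Adm.C ha (by positivity)
    · exact Adm.zero
  · rw [coeff_constSeries]
    split_ifs <;> simp [pnorm_C]

theorem Ser.natDegree_le (hf : Ser R M D f) (n : ℕ) :
    (PowerSeries.coeff n f).natDegree ≤ M * n + D.toNat := by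
  refine (hf.adm n).natDegree_le ?_
  push_cast
  linarith [Int.self_le_toNat D]

theorem natCast_le_mul_two_pow (M D n : ℕ) :
    ((M * n + D : ℕ) : ℝ) ≤ (M + D : ℕ) * 2 ^ n := by
  have h1 := natCast_add_one_le_two_pow n
  have h2 : (0 : ℝ) ≤ n := by positivity
  push_cast
  have hM : (0 : ℝ) ≤ M := by positivity
  have hD : (0 : ℝ) ≤ D := by positivity
  nlinarith [mul_nonneg hM h2]

/-- Geometric bounds for the coefficients and their derivatives. -/
theorem Ser.bdd_derivative (hf : Ser R M D f) : ∃ B K : ℝ, 0 ≤ B ∧ 1 ≤ K ∧ ∀ n,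
    pnorm (PowerSeries.coeff n f) ≤ B * K ^ n ∧
    n * pnorm (PowerSeries.coeff n f) + 2 * pnorm (derivative (PowerSeries.coeff n f)) ≤
      B * K ^ n := by
  obtain ⟨B, K, hB, hK, h⟩ := hf.bdd
  refine ⟨(1 + (M + D.toNat : ℕ)) * B, 2 * K, by positivity, by linarith, fun n => ⟨?_, ?_⟩⟩
  · refine (h n).trans ?_
    gcongr
    · exact le_mul_of_one_le_left hB (by linarith [Nat.cast_nonneg (α := ℝ) (M + D.toNat)])
    · linarith
  · have h1 := pnorm_derivative_le (hf.natDegree_le n)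
    have h2 := natCast_le_mul_two_pow M D.toNat n
    have h3 := natCast_add_one_le_two_pow n
    have h4 := pnorm_nonneg (PowerSeries.coeff n f)
    have h5 : (0 : ℝ) ≤ ((M * n + D.toNat : ℕ) : ℝ) := by positivity
    calc _ ≤ (n + ((M * n + D.toNat : ℕ) : ℝ)) * pnorm (PowerSeries.coeff n f) := by nlinarith
      _ ≤ (2 ^ n + (M + D.toNat : ℕ) * 2 ^ n) * (B * K ^ n) := by
        gcongr
        · linarith
        · exact h n
      _ = _ := by rw [mul_pow]; ring

/-! ### The isomonodromic system -/

/-- A formal solution of the isomonodromic system, with residue matrices `[[p, q], [r, -p]]` and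
`[[-t - p, b - q], [c - r, t + p]]`. -/
structure IsFormalSol (t : ℂ) (p q r b c : PowerSeries ℂ[X]) : Prop where
  euler_p : euler p = b * r - c * q
  euler_q : euler q = -(2 * constSeries t * q) - 2 * b * p
  euler_r : euler r = 2 * c * p + 2 * constSeries t * r
  euler_b : euler b = PowerSeries.X * (b - q)
  euler_c : euler c = PowerSeries.X * (r - c)

variable {m : ℕ} {h : ℤ} {t b₀ c₀ : ℂ} {A₀ : ℂ[X] × ℂ[X] × ℂ[X]}
  {F : ℕ → (ℂ[X] × ℂ[X] × ℂ[X]) × (ℂ[X] × ℂ[X])}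

theorem sum_antidiagonal_succ_eq {α : Type*} [AddCommMonoid α] (n : ℕ) (f : ℕ → ℕ → α) :
    ∑ i ∈ antidiagonal (n + 1), f i.1 i.2 =
      f 0 (n + 1) + (∑ i ∈ range n, f (i + 1) (n - i) + f (n + 1) 0) := by
  rw [Nat.sum_antidiagonal_eq_sum_range_succ f, sum_range_succ', sum_range_succ, add_comm]
  simp

theorem IsRec.isFormalSol (hF : IsRec t b₀ c₀ A₀ F) (H : LeadingTerm R m h t b₀ c₀ A₀) :
    IsFormalSol t (PowerSeries.mk fun n => (F n).1.1) (PowerSeries.mk fun n => (F n).1.2.1)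
      (PowerSeries.mk fun n => (F n).1.2.2) (PowerSeries.mk fun n => (F n).2.1)
      (PowerSeries.mk fun n => (F n).2.2) := by
  -- In the convolution of (b, c) with A, the term containing b and c at order 0, together with the
  -- constant diagonal t, forms [N₀, ·]; the remaining terms are the source of the recursion.
  have hA : ∀ n, shift₃ n (F n).1 = adConst t b₀ c₀ (F n).1 +
      if n = 0 then 0 else (∑ i ∈ range (n - 1), bracket (F (i + 1)).2 (F (n - 1 - i)).1 +
        bracket (F n).2 (F 0).1) := by
    intro n
    cases n with
    | zero => rw [hF.zero]; simpa using H.eqn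
    | succ n =>
      simp only [n.succ_ne_zero, if_false, Nat.add_sub_cancel]
      refine (congrArg (shift₃ (n + 1)) (hF.A_succ n)).trans
        ((resolvent_spec H.nilpotent n.succ_ne_zero _).trans ?_)
      rw [← hF.A_succ n]
      exact add_comm _ _
  have h2 : (2 : PowerSeries ℂ[X]) = constSeries 2 := rfl
  have hC : ∀ (a : ℂ) (f : PowerSeries ℂ[X]) n, PowerSeries.coeff n (constSeries a * f) =
      C a * PowerSeries.coeff n f := fun a f n => PowerSeries.coeff_C_mul _ _ _
  refine ⟨?_, ?_, ?_, ?_, ?_⟩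
  · ext1 n
    have := congrArg Prod.fst (hA n)
    cases n with
    | zero => simpa [shift₃, adConst, hF.zero, PowerSeries.coeff_mul] using this
    | succ n =>
      simp only [map_sub, PowerSeries.coeff_mul, PowerSeries.coeff_mk, coeff_euler]
      rw [sum_antidiagonal_succ_eq n fun i j => (F i).2.1 * (F j).1.2.2,
        sum_antidiagonal_succ_eq n fun i j => (F i).2.2 * (F j).1.2.1]
      simp only [shift₃, adConst, bracket, Prod.fst_add, Prod.fst_sum, n.succ_ne_zero, if_false,
        Nat.add_sub_cancel, sum_sub_distrib] at this
      rw [this, show (F 0).2 = (C b₀, C c₀) by rw [hF.zero]]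
      ring
  · ext1 n
    have := congrArg (fun v => v.2.1) (hA n)
    cases n with
    | zero =>
      simp only [mul_assoc, h2, map_sub, map_neg, hC, PowerSeries.coeff_mul, PowerSeries.coeff_mk,
        coeff_euler]
      simpa [shift₃, adConst, hF.zero, mul_assoc, show (C 2 : ℂ[X]) = 2 from rfl] using this
    | succ n =>
      simp only [mul_assoc, h2, map_sub, map_neg, hC, PowerSeries.coeff_mul, PowerSeries.coeff_mk,
        coeff_euler]
      rw [sum_antidiagonal_succ_eq n fun i j => (F i).2.1 * (F j).1.1]
      simp only [shift₃, adConst, bracket, Prod.fst_add, Prod.snd_add, Prod.fst_sum, Prod.snd_sum,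
        n.succ_ne_zero, if_false, Nat.add_sub_cancel, mul_assoc, sum_neg_distrib, ← mul_sum] at this
      rw [this, show (F 0).2 = (C b₀, C c₀) by rw [hF.zero], show (C 2 : ℂ[X]) = 2 from rfl]
      ring
  · ext1 n
    have := congrArg (fun v => v.2.2) (hA n)
    cases n with
    | zero =>
      simp only [mul_assoc, h2, map_add, hC, PowerSeries.coeff_mul, PowerSeries.coeff_mk,
        coeff_euler]
      simpa [shift₃, adConst, hF.zero, mul_assoc, show (C 2 : ℂ[X]) = 2 from rfl] using this
    | succ n =>
      simp only [mul_assoc, h2, map_add, hC, PowerSeries.coeff_mul, PowerSeries.coeff_mk,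
        coeff_euler]
      rw [sum_antidiagonal_succ_eq n fun i j => (F i).2.2 * (F j).1.1]
      simp only [shift₃, adConst, bracket, Prod.snd_add, Prod.snd_sum,
        n.succ_ne_zero, if_false, Nat.add_sub_cancel, mul_assoc, ← mul_sum] at this
      rw [this, show (F 0).2 = (C b₀, C c₀) by rw [hF.zero], show (C 2 : ℂ[X]) = 2 from rfl]
      ring
  · ext1 n
    cases n with
    | zero => simp [hF.zero]
    | succ n =>
      rw [PowerSeries.coeff_succ_X_mul]
      simp only [map_sub, PowerSeries.coeff_mk, coeff_euler]
      rw [hF.b_succ]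
      exact shiftInv_spec n.succ_ne_zero _
  · ext1 n
    cases n with
    | zero => simp [hF.zero]
    | succ n =>
      rw [PowerSeries.coeff_succ_X_mul]
      simp only [map_sub, PowerSeries.coeff_mk, coeff_euler]
      rw [hF.c_succ]
      exact shiftInv_spec n.succ_ne_zero _

theorem exists_isFormalSol (H : LeadingTerm R m h t b₀ c₀ A₀) :
    ∃ p q r b c : PowerSeries ℂ[X], IsFormalSol t p q r b c ∧
      Ser R m m p ∧ Ser R m (m + h) q ∧ Ser R m (m - h) r ∧ Ser R m h b ∧ Ser R m (-h) c ∧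
      PowerSeries.coeff 0 p = A₀.1 ∧ PowerSeries.coeff 0 q = A₀.2.1 ∧
      PowerSeries.coeff 0 r = A₀.2.2 ∧ PowerSeries.coeff 0 b = C b₀ ∧
      PowerSeries.coeff 0 c = C c₀ := by
  obtain ⟨F, hF⟩ := exists_isRec t b₀ c₀ A₀
  obtain ⟨B, K, hBK⟩ := hF.geometric_bound H
  have adm := hF.adm H
  refine ⟨PowerSeries.mk fun n => (F n).1.1, PowerSeries.mk fun n => (F n).1.2.1,
    PowerSeries.mk fun n => (F n).1.2.2, PowerSeries.mk fun n => (F n).2.1,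
    PowerSeries.mk fun n => (F n).2.2, hF.isFormalSol H, ?_, ?_, ?_, ?_, ?_, ?_⟩
  · refine Ser.mk' (B := B) (K := K) (fun n => ?_) fun n => ?_ <;> rw [PowerSeries.coeff_mk]
    · exact (adm n).1.1
    · have := (hBK n).1
      simp only [pnorm₃] at this
      linarith [pnorm_nonneg (F n).1.2.1, pnorm_nonneg (F n).1.2.2]
  · refine Ser.mk' (B := B) (K := K) (fun n => ?_) fun n => ?_ <;> rw [PowerSeries.coeff_mk]
    · exact (adm n).1.2.1.mono (by linarith)
    · have := (hBK n).1
      simp only [pnorm₃] at this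
      linarith [pnorm_nonneg (F n).1.1, pnorm_nonneg (F n).1.2.2]
  · refine Ser.mk' (B := B) (K := K) (fun n => ?_) fun n => ?_ <;> rw [PowerSeries.coeff_mk]
    · exact (adm n).1.2.2.mono (by linarith)
    · have := (hBK n).1
      simp only [pnorm₃] at this
      linarith [pnorm_nonneg (F n).1.2.1, pnorm_nonneg (F n).1.1]
  · refine Ser.mk' (B := B) (K := K) (fun n => ?_) fun n => ?_ <;> rw [PowerSeries.coeff_mk]
    · exact (adm n).2.1
    · linarith [(hBK n).2, pnorm_nonneg (F n).2.2]
  · refine Ser.mk' (B := B) (K := K) (fun n => ?_) fun n => ?_ <;> rw [PowerSeries.coeff_mk]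
    · exact (adm n).2.2.mono (by linarith)
    · linarith [(hBK n).2, pnorm_nonneg (F n).2.1]
  · simp [hF.zero]

variable {p q r b c : PowerSeries ℂ[X]}

/-- The Lax form x A' = [N, A] preserves det A = -(p² + q r). -/
theorem IsFormalSol.det_zero (hS : IsFormalSol t p q r b c) {a : ℂ}
    (h0 : PowerSeries.coeff 0 (p * p + q * r) = C a) : p * p + q * r = constSeries a := by
  refine eq_constSeries_of_euler_eq_zero ?_ h0
  rw [euler_add, euler_mul, euler_mul, hS.euler_p, hS.euler_q, hS.euler_r]
  ring

/-- N - A also evolves by a commutator, with N + (x/2) diag(1, -1), so its determinant is conserved.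
-/
theorem IsFormalSol.det_one (hS : IsFormalSol t p q r b c) {a : ℂ}
    (h0 : PowerSeries.coeff 0 ((p + constSeries t) * (p + constSeries t) + (b - q) * (c - r)) =
      C a) :
    (p + constSeries t) * (p + constSeries t) + (b - q) * (c - r) = constSeries a := by
  refine eq_constSeries_of_euler_eq_zero ?_ h0
  simp only [euler_add, euler_mul, euler_sub, hS.euler_p, hS.euler_q, hS.euler_r, hS.euler_b,
    hS.euler_c, euler_constSeries]
  ring

end

section

/-! ### The filter of the domains `Ω*(ε, Θ)` as `ε → 0` -/

/-- The filter generated by the domains `Ω*(ε, Θ)`, `ε > 0`. -/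
noncomputable def nearZero (Θ : ℝ) : Filter (ℂ × ℂ) := ⨅ ε ∈ Set.Ioi (0 : ℝ), 𝓟 (OmegaStar ε Θ)

theorem OmegaStar_mono {ε ε' Θ : ℝ} (h : ε ≤ ε') : OmegaStar ε Θ ⊆ OmegaStar ε' Θ := by
  intro w hw
  rw [mem_OmegaStar] at hw ⊢
  exact ⟨hw.1.trans_le h, hw.2.1.trans_le h, hw.2.2⟩

theorem eventually_nearZero {Θ : ℝ} {P : ℂ × ℂ → Prop} :
    (∀ᶠ w in nearZero Θ, P w) ↔ ∃ ε > 0, ∀ w ∈ OmegaStar ε Θ, P w := by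
  have h := hasBasis_biInf_principal (s := fun ε => OmegaStar ε Θ) (S := Set.Ioi (0 : ℝ))
    (fun a ha b hb => ⟨min a b, Set.mem_Ioi.2 (lt_min ha hb), OmegaStar_mono (min_le_left _ _),
      OmegaStar_mono (min_le_right _ _)⟩) ⟨1, Set.mem_Ioi.2 one_pos⟩
  exact h.eventually_iff

/-- The condition on x (ρ x)^(-1/2) gives |x| ≤ ε |ρ x|^(1/2), which is exponentially small in -u =
-log |ρ x|, while |L| ≤ -u + Θ grows only linearly. The bound is uniform in ρ. -/
theorem norm_exp_mul_pow_le {ε Θ : ℝ} (hε : ε ≤ 1) (hΘ : 0 < Θ) {w : ℂ × ℂ}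
    (hw : w ∈ OmegaStar ε Θ) (B : ℕ) :
    ‖Complex.exp w.2‖ * ‖w.1 + w.2‖ ^ B ≤
      ε * (2 ^ B * B.factorial * Real.exp (Θ / 2)) := by
  obtain ⟨h1, h2, h3⟩ := mem_OmegaStar.1 hw
  set u := (w.1 + w.2).re with hu
  rw [Complex.norm_exp] at h1 h2 ⊢
  have hu0 : u < 0 := by
    by_contra! h
    linarith [Real.one_le_exp h]
  have h4 : Real.exp w.2.re ≤ ε * Real.exp (u / 2) := by
    have : w.2.re = (w.2 + (-1 / 2) * (w.1 + w.2)).re + u / 2 := by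
      have : (-1 / 2 : ℂ) = ((-1 / 2 : ℝ) : ℂ) := by push_cast; ring
      rw [Complex.add_re, this, Complex.re_ofReal_mul]
      ring
    rw [this, Real.exp_add]
    gcongr
  have h5 : ‖w.1 + w.2‖ ≤ 2 * ((-u + Θ) / 2) := by
    have := Complex.norm_le_abs_re_add_abs_im (w.1 + w.2)
    rw [← hu, abs_of_neg hu0] at this
    linarith
  have hv : 0 ≤ (-u + Θ) / 2 := by linarith
  have hε0 : 0 < ε := (Real.exp_pos _).trans h1
  -- The halved argument is what cancels exp (u/2), leaving the constant exp (Θ/2).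
  have h6 : ((-u + Θ) / 2) ^ B ≤ B.factorial * Real.exp ((-u + Θ) / 2) := by
    have := Real.pow_div_factorial_le_exp _ hv B
    rwa [div_le_iff₀' (by positivity)] at this
  calc Real.exp w.2.re * ‖w.1 + w.2‖ ^ B
      ≤ (ε * Real.exp (u / 2)) * (2 * ((-u + Θ) / 2)) ^ B := by gcongr
    _ ≤ (ε * Real.exp (u / 2)) * (2 ^ B * (B.factorial * Real.exp ((-u + Θ) / 2))) := by
      rw [mul_pow]; gcongr
    _ = ε * (2 ^ B * B.factorial * (Real.exp (u / 2) * Real.exp ((-u + Θ) / 2))) := by ring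
    _ = _ := by rw [← Real.exp_add]; ring_nf

theorem tendsto_norm_exp_mul_pow {Θ : ℝ} (hΘ : 0 < Θ) (B : ℕ) :
    Tendsto (fun w : ℂ × ℂ => ‖Complex.exp w.2‖ * ‖w.1 + w.2‖ ^ B) (nearZero Θ) (𝓝 0) := by
  rw [Metric.tendsto_nhds]
  intro δ hδ
  set c : ℝ := 2 ^ B * B.factorial * Real.exp (Θ / 2) with hc
  have hc0 : 0 < c := by positivity
  refine eventually_nearZero.2 ⟨min 1 (δ / (2 * c)), by positivity, fun w hw => ?_⟩
  have h := norm_exp_mul_pow_le (min_le_left _ _) hΘ hw B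
  rw [Real.dist_eq, sub_zero, abs_of_nonneg (by positivity)]
  calc _ ≤ min 1 (δ / (2 * c)) * c := h
    _ ≤ δ / (2 * c) * c := by gcongr; exact min_le_right _ _
    _ = δ / 2 := by field_simp
    _ < δ := by linarith

theorem tendsto_norm_log (Θ : ℝ) :
    Tendsto (fun w : ℂ × ℂ => ‖w.1 + w.2‖) (nearZero Θ) atTop := by
  refine tendsto_atTop.2 fun N => eventually_nearZero.2 ⟨Real.exp (-N), Real.exp_pos _,
    fun w hw => ?_⟩
  have h1 := (mem_OmegaStar.1 hw).1
  rw [Complex.norm_exp, Real.exp_lt_exp] at h1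
  have := Complex.abs_re_le_norm (w.1 + w.2)
  linarith [neg_abs_le (w.1 + w.2).re]

theorem tendsto_inv_log (Θ : ℝ) :
    Tendsto (fun w : ℂ × ℂ => (w.1 + w.2)⁻¹) (nearZero Θ) (𝓝 0) := by
  rw [tendsto_zero_iff_norm_tendsto_zero]
  simp only [norm_inv]
  exact (tendsto_norm_log Θ).inv_tendsto_atTop

/-- The domains are open, so identities valid on them may be differentiated. -/
theorem eventually_mem_nhds_nearZero {Θ : ℝ} {P : ℂ × ℂ → Prop}
    (h : ∀ᶠ w in nearZero Θ, P w) : ∀ᶠ w in nearZero Θ, ∀ᶠ v in 𝓝 w, P v := by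
  obtain ⟨ε, hε, h⟩ := eventually_nearZero.1 h
  exact eventually_nearZero.2 ⟨ε, hε, fun w hw =>
    ((isOpen_OmegaStar ε Θ).eventually_mem hw).mono fun v hv => h v hv⟩

/-! ### Sums of power series with polynomial coefficients -/

/-- The term of index `n` of the series `∑ xⁿ fₙ(L)` at `x = exp ξ`, `L = r + ξ`. -/
noncomputable def evTerm (f : PowerSeries ℂ[X]) (w : ℂ × ℂ) (n : ℕ) : ℂ :=
  Complex.exp w.2 ^ n * (PowerSeries.coeff n f).eval (w.1 + w.2)

/-- The sum of the series `∑ xⁿ fₙ(L)` at `x = exp ξ`, `L = r + ξ`. -/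
noncomputable def ev (f : PowerSeries ℂ[X]) (w : ℂ × ℂ) : ℂ := ∑' n, evTerm f w n

variable {R : Subalgebra ℚ ℂ} {M : ℕ} {D : ℤ} {f g : PowerSeries ℂ[X]} {w : ℂ × ℂ} {Θ : ℝ}

theorem evTerm_mul (f g : PowerSeries ℂ[X]) (w : ℂ × ℂ) (n : ℕ) :
    evTerm (f * g) w n = ∑ i ∈ antidiagonal n, evTerm f w i.1 * evTerm g w i.2 := by
  rw [evTerm, PowerSeries.coeff_mul, eval_finsetSum, mul_sum]
  refine sum_congr rfl fun i hi => ?_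
  rw [← HasAntidiagonal.mem_antidiagonal.1 hi, evTerm, evTerm, pow_add, eval_mul]
  ring

theorem summable_evTerm_mul (hf : Summable fun n => ‖evTerm f w n‖)
    (hg : Summable fun n => ‖evTerm g w n‖) : Summable fun n => ‖evTerm (f * g) w n‖ := by
  simp only [evTerm_mul]
  exact summable_norm_sum_mul_antidiagonal_of_summable_norm hf hg

theorem summable_evTerm_add (hf : Summable fun n => ‖evTerm f w n‖)
    (hg : Summable fun n => ‖evTerm g w n‖) : Summable fun n => ‖evTerm (f + g) w n‖ := by
  refine Summable.of_nonneg_of_le (fun n => norm_nonneg _) (fun n => ?_) (hf.add hg)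
  rw [evTerm, map_add, eval_add, mul_add]
  exact norm_add_le _ _

theorem summable_evTerm_sub (hf : Summable fun n => ‖evTerm f w n‖)
    (hg : Summable fun n => ‖evTerm g w n‖) : Summable fun n => ‖evTerm (f - g) w n‖ := by
  refine Summable.of_nonneg_of_le (fun n => norm_nonneg _) (fun n => ?_) (hf.add hg)
  rw [evTerm, map_sub, eval_sub, mul_sub]
  exact norm_sub_le _ _

theorem summable_evTerm_const (a : ℂ) (w : ℂ × ℂ) :
    Summable fun n => ‖evTerm (constSeries a) w n‖ := by
  refine summable_of_ne_finset_zero (s := {0}) fun n hn => ?_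
  rw [evTerm, coeff_constSeries, if_neg (by simpa using hn)]
  simp

theorem ev_mul (hf : Summable fun n => ‖evTerm f w n‖) (hg : Summable fun n => ‖evTerm g w n‖) :
    ev (f * g) w = ev f w * ev g w := by
  rw [ev, ev, ev, tsum_mul_tsum_eq_tsum_sum_antidiagonal_of_summable_norm hf hg]
  exact tsum_congr fun n => evTerm_mul f g w n

theorem ev_add (hf : Summable fun n => ‖evTerm f w n‖) (hg : Summable fun n => ‖evTerm g w n‖) :
    ev (f + g) w = ev f w + ev g w := by
  rw [ev, ev, ev, ← hf.of_norm.tsum_add hg.of_norm]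
  refine tsum_congr fun n => ?_
  simp [evTerm, mul_add]

theorem ev_neg (f : PowerSeries ℂ[X]) (w : ℂ × ℂ) : ev (-f) w = -ev f w := by
  rw [ev, ev, ← tsum_neg]
  refine tsum_congr fun n => ?_
  simp [evTerm]

theorem ev_sub (hf : Summable fun n => ‖evTerm f w n‖) (hg : Summable fun n => ‖evTerm g w n‖) :
    ev (f - g) w = ev f w - ev g w := by
  rw [ev, ev, ev, ← hf.of_norm.tsum_sub hg.of_norm]
  refine tsum_congr fun n => ?_
  simp [evTerm, mul_sub]

@[simp] theorem ev_constSeries (a : ℂ) (w : ℂ × ℂ) : ev (constSeries a) w = a := by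
  rw [ev, tsum_eq_single 0 fun n hn => by rw [evTerm, coeff_constSeries, if_neg hn]; simp]
  simp [evTerm, coeff_constSeries]

theorem ev_X_mul (hf : Summable fun n => ‖evTerm f w n‖) :
    ev (PowerSeries.X * f) w = Complex.exp w.2 * ev f w := by
  have h1 : ∀ n, evTerm (PowerSeries.X * f) w (n + 1) = Complex.exp w.2 * evTerm f w n := fun n => by
    rw [evTerm, PowerSeries.coeff_succ_X_mul, evTerm, pow_succ']; ring
  have h2 : Summable fun n => evTerm (PowerSeries.X * f) w (n + 1) := by
    simp only [h1]
    exact hf.of_norm.mul_left _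
  rw [ev, ((summable_nat_add_iff 1).1 h2).tsum_eq_zero_add, ev, ← tsum_mul_left]
  simp only [h1]
  simp [evTerm]

/-- The n-th term is at most a fixed power of |L| times (K |x| |L|^M)ⁿ, so smallness of x L^M gives
ratio 1/2. -/
theorem Ser.norm_evTerm_le (hf : Ser R M D f) {B K : ℝ} {n : ℕ}
    (hK : 0 ≤ K) (hB : pnorm (PowerSeries.coeff n f) ≤ B * K ^ n) (hL : 1 ≤ ‖w.1 + w.2‖)
    (hx : K * (‖Complex.exp w.2‖ * ‖w.1 + w.2‖ ^ M) ≤ 1 / 2) (hB0 : 0 ≤ B) :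
    ‖evTerm f w n‖ ≤ B * ‖w.1 + w.2‖ ^ D.toNat * (1 / 2) ^ n := by
  have h1 := norm_eval_le (hf.natDegree_le n) hL
  rw [evTerm, norm_mul, norm_pow]
  calc _ ≤ ‖Complex.exp w.2‖ ^ n * (B * K ^ n * ‖w.1 + w.2‖ ^ (M * n + D.toNat)) := by
        gcongr
        exact h1.trans (by gcongr)
    _ = B * ‖w.1 + w.2‖ ^ D.toNat * (K * (‖Complex.exp w.2‖ * ‖w.1 + w.2‖ ^ M)) ^ n := by
        rw [mul_pow, mul_pow, ← pow_mul, pow_add]; ring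
    _ ≤ _ := by gcongr

theorem eventually_log_and_exp (hΘ : 0 < Θ) (M : ℕ) (K : ℝ) :
    ∀ᶠ w in nearZero Θ, 1 ≤ ‖w.1 + w.2‖ ∧
      K * (‖Complex.exp w.2‖ * ‖w.1 + w.2‖ ^ M) ≤ 1 / 2 := by
  refine ((tendsto_norm_log Θ).eventually_ge_atTop 1).and ?_
  have h := (tendsto_norm_exp_mul_pow hΘ M).const_mul K
  rw [mul_zero] at h
  exact h.eventually_le_const (by norm_num)

theorem Ser.summable (hf : Ser R M D f) (hΘ : 0 < Θ) :
    ∀ᶠ w in nearZero Θ, Summable fun n => ‖evTerm f w n‖ := by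
  obtain ⟨B, K, hB, hK, h⟩ := hf.bdd
  filter_upwards [eventually_log_and_exp hΘ M K] with w hw
  refine Summable.of_nonneg_of_le (fun n => norm_nonneg _)
    (fun n => hf.norm_evTerm_le (by linarith) (h n) hw.1 hw.2 hB) ?_
  exact (summable_geometric_of_lt_one (by norm_num) (by norm_num)).mul_left _

/-! ### Termwise differentiation -/

theorem hasDerivAt_exp_pow (n : ℕ) (z : ℂ) :
    HasDerivAt (fun z => Complex.exp z ^ n) (n * Complex.exp z ^ n) z := by
  refine ((Complex.hasDerivAt_exp z).fun_pow n).congr_deriv ?_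
  cases n with
  | zero => simp
  | succ n => rw [Nat.add_sub_cancel, pow_succ]; ring

/-- The derivative of a term of the series. -/
noncomputable def evTermDeriv (f : PowerSeries ℂ[X]) (n : ℕ) (w : ℂ × ℂ) : ℂ × ℂ →L[ℂ] ℂ :=
  (Complex.exp w.2 ^ n * (n * (PowerSeries.coeff n f).eval (w.1 + w.2))) •
      ContinuousLinearMap.snd ℂ ℂ ℂ +
    (Complex.exp w.2 ^ n * (derivative (PowerSeries.coeff n f)).eval (w.1 + w.2)) •
      (ContinuousLinearMap.fst ℂ ℂ ℂ + ContinuousLinearMap.snd ℂ ℂ ℂ)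

theorem hasFDerivAt_evTerm (f : PowerSeries ℂ[X]) (n : ℕ) (w : ℂ × ℂ) :
    HasFDerivAt (fun v => evTerm f v n) (evTermDeriv f n w) w := by
  have h1 : HasFDerivAt (fun v : ℂ × ℂ => Complex.exp v.2 ^ n)
      ((n * Complex.exp w.2 ^ n) • ContinuousLinearMap.snd ℂ ℂ ℂ) w :=
    (hasDerivAt_exp_pow n w.2).comp_hasFDerivAt w hasFDerivAt_snd
  have h2 : HasFDerivAt (fun v : ℂ × ℂ => (PowerSeries.coeff n f).eval (v.1 + v.2))
      ((derivative (PowerSeries.coeff n f)).eval (w.1 + w.2) •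
        (ContinuousLinearMap.fst ℂ ℂ ℂ + ContinuousLinearMap.snd ℂ ℂ ℂ)) w :=
    HasDerivAt.comp_hasFDerivAt (f := fun v : ℂ × ℂ => v.1 + v.2) w
      ((PowerSeries.coeff n f).hasDerivAt (w.1 + w.2)) (hasFDerivAt_fst.add hasFDerivAt_snd)
  refine (h1.mul h2).congr_fderiv ?_
  rw [evTermDeriv]
  module

theorem Ser.norm_evTermDeriv_le (hf : Ser R M D f) {B K : ℝ} {n : ℕ}
    (hK : 0 ≤ K) (hB : n * pnorm (PowerSeries.coeff n f) +
      2 * pnorm (derivative (PowerSeries.coeff n f)) ≤ B * K ^ n) (hL : 1 ≤ ‖w.1 + w.2‖)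
    (hx : K * (‖Complex.exp w.2‖ * ‖w.1 + w.2‖ ^ M) ≤ 1 / 2) (hB0 : 0 ≤ B) :
    ‖evTermDeriv f n w‖ ≤ B * ‖w.1 + w.2‖ ^ D.toNat * (1 / 2) ^ n := by
  have h1 := norm_eval_le (hf.natDegree_le n) hL
  have h2 := norm_eval_le ((natDegree_derivative_le _).trans
    ((Nat.sub_le _ _).trans (hf.natDegree_le n))) hL
  have h3 := ContinuousLinearMap.norm_fst_le ℂ ℂ ℂ
  have h4 := ContinuousLinearMap.norm_snd_le ℂ ℂ ℂ
  have h5 : ‖ContinuousLinearMap.fst ℂ ℂ ℂ + ContinuousLinearMap.snd ℂ ℂ ℂ‖ ≤ 2 :=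
    (norm_add_le _ _).trans (by linarith)
  set P := PowerSeries.coeff n f
  have hX : 0 ≤ ‖Complex.exp w.2‖ ^ n := by positivity
  calc ‖evTermDeriv f n w‖
      ≤ ‖Complex.exp w.2‖ ^ n * (n * (pnorm P * ‖w.1 + w.2‖ ^ (M * n + D.toNat))) * 1 +
        ‖Complex.exp w.2‖ ^ n * (pnorm (derivative P) * ‖w.1 + w.2‖ ^ (M * n + D.toNat)) * 2 := by
        rw [evTermDeriv]
        refine (norm_add_le _ _).trans ?_
        rw [norm_smul, norm_smul, norm_mul, norm_mul, norm_mul, norm_pow, Complex.norm_natCast]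
        have := pnorm_nonneg P
        have := pnorm_nonneg (derivative P)
        gcongr
    _ = ‖Complex.exp w.2‖ ^ n * ((n * pnorm P + 2 * pnorm (derivative P)) *
          ‖w.1 + w.2‖ ^ (M * n + D.toNat)) := by ring
    _ ≤ ‖Complex.exp w.2‖ ^ n * (B * K ^ n * ‖w.1 + w.2‖ ^ (M * n + D.toNat)) := by gcongr
    _ = B * ‖w.1 + w.2‖ ^ D.toNat * (K * (‖Complex.exp w.2‖ * ‖w.1 + w.2‖ ^ M)) ^ n := by
        rw [mul_pow, mul_pow, ← pow_mul, pow_add]; ring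
    _ ≤ _ := by gcongr

/-- Joint differentiability in (r, ξ) gives holomorphy of the family; the direction (0, 1) is x d/dx
at fixed ρ, in which both x = exp ξ and L = r + ξ vary. -/
theorem Ser.exists_hasFDerivAt (hf : Ser R M D f) (hΘ : 0 < Θ) :
    ∀ᶠ w in nearZero Θ, ∃ f' : ℂ × ℂ →L[ℂ] ℂ, HasFDerivAt (ev f) f' w ∧
      f' (0, 1) = ev (PainleveV.euler f) w := by
  obtain ⟨B, K, hB, hK, h⟩ := hf.bdd_derivative
  obtain ⟨ε, hε, hΩ⟩ := eventually_nearZero.1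
    ((hf.summable hΘ).and (eventually_log_and_exp hΘ M K))
  refine eventually_nearZero.2 ⟨ε, hε, fun w hw => ?_⟩
  obtain ⟨ρ, hρ, hball⟩ := Metric.isOpen_iff.1 (isOpen_OmegaStar ε Θ) w hw
  -- Radius at most 1 keeps |L| within 2 of its value at the centre, so one summable majorant serves
  -- the whole ball.
  set s := Metric.ball w (min ρ 1) with hs
  have hws : w ∈ s := Metric.mem_ball_self (by positivity)
  have hsΩ : ∀ v ∈ s, v ∈ OmegaStar ε Θ := fun v hv =>
    hball (Metric.ball_subset_ball (min_le_left _ _) hv)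
  have hL : ∀ v ∈ s, ‖v.1 + v.2‖ ≤ ‖w.1 + w.2‖ + 2 := by
    intro v hv
    have h1 : ‖v - w‖ < 1 := by
      rw [← dist_eq_norm]
      exact (Metric.mem_ball.1 hv).trans_le (min_le_right _ _)
    have h2 := norm_fst_le (v - w)
    have h3 := norm_snd_le (v - w)
    have h4 : v.1 + v.2 = (w.1 + w.2) + ((v - w).1 + (v - w).2) := by
      rw [Prod.fst_sub, Prod.snd_sub]; ring
    rw [h4]
    refine (norm_add_le _ _).trans ?_
    gcongr
    exact (norm_add_le _ _).trans (by linarith)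
  set u : ℕ → ℝ := fun n => B * (‖w.1 + w.2‖ + 2) ^ D.toNat * (1 / 2) ^ n with hu
  have hus : Summable u :=
    (summable_geometric_of_lt_one (by norm_num) (by norm_num)).mul_left _
  have hbound : ∀ n v, v ∈ s → ‖evTermDeriv f n v‖ ≤ u n := fun n v hv => by
    obtain ⟨-, h1, h2⟩ := hΩ v (hsΩ v hv)
    refine (hf.norm_evTermDeriv_le (by linarith) (h n).2 h1 h2 hB).trans ?_
    simp only [hu]
    gcongr
    exact hL v hv
  refine ⟨∑' n, evTermDeriv f n w, ?_, ?_⟩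
  · exact hasFDerivAt_tsum_of_isPreconnected hus Metric.isOpen_ball
      (convex_ball w _).isPreconnected (fun n v _ => hasFDerivAt_evTerm f n v) hbound hws
      (hΩ w hw).1.of_norm hws
  · have hsum : Summable fun n => evTermDeriv f n w :=
      Summable.of_norm_bounded hus fun n => hbound n w hws
    have := (ContinuousLinearMap.apply ℂ ℂ ((0, 1) : ℂ × ℂ)).map_tsum hsum
    simp only [ContinuousLinearMap.apply_apply] at this
    rw [this, ev]
    refine tsum_congr fun n => ?_
    simp [evTermDeriv, evTerm]
    ring

end

section

/-! ### Absolutely convergent power series in two variables -/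

/-- The monomial `z ^ α₀ * s ^ α₁`. -/
def mon {A : Type*} [CommSemiring A] (z s : A) (α : Fin 2 →₀ ℕ) : A := z ^ α 0 * s ^ α 1

theorem mon_add {A : Type*} [CommSemiring A] (z s : A) (α β : Fin 2 →₀ ℕ) :
    mon z s (α + β) = mon z s α * mon z s β := by
  simp only [mon, Finsupp.add_apply, pow_add]
  ring

theorem norm_mon (z s : ℂ) (α : Fin 2 →₀ ℕ) : ‖mon z s α‖ = mon ‖z‖ ‖s‖ α := by
  simp [mon]

theorem mon_nonneg {δ η : ℝ} (hδ : 0 ≤ δ) (hη : 0 ≤ η) (α : Fin 2 →₀ ℕ) : 0 ≤ mon δ η α := by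
  unfold mon; positivity

theorem mon_le_mon {δ η δ' η' : ℝ} (hδ : 0 ≤ δ) (hη : 0 ≤ η) (h1 : δ ≤ δ') (h2 : η ≤ η')
    (α : Fin 2 →₀ ℕ) : mon δ η α ≤ mon δ' η' α :=
  mul_le_mul (pow_le_pow_left₀ hδ h1 _) (pow_le_pow_left₀ hη h2 _) (pow_nonneg hη _)
    (pow_nonneg (hδ.trans h1) _)

/-- Absolute convergence on the polydisc of radii `δ`, `η`. -/
def WSum (φ : MvPowerSeries (Fin 2) ℂ) (δ η : ℝ) : Prop :=
  Summable fun α => ‖MvPowerSeries.coeff α φ‖ * mon δ η α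

/-- The sum of a power series in two variables. -/
noncomputable def eval₂ (φ : MvPowerSeries (Fin 2) ℂ) (z s : ℂ) : ℂ :=
  ∑' α, MvPowerSeries.coeff α φ * mon z s α

variable {φ ψ : MvPowerSeries (Fin 2) ℂ} {δ η δ' η' : ℝ}

theorem WSum.mono (h : WSum φ δ' η') (hδ : 0 ≤ δ) (hη : 0 ≤ η) (h1 : δ ≤ δ') (h2 : η ≤ η') :
    WSum φ δ η :=
  Summable.of_nonneg_of_le (fun α => mul_nonneg (norm_nonneg _) (mon_nonneg hδ hη α))
    (fun α => mul_le_mul_of_nonneg_left (mon_le_mon hδ hη h1 h2 α) (norm_nonneg _)) h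

theorem WSum.summable_norm (h : WSum φ δ η) {z s : ℂ} (hz : ‖z‖ ≤ δ) (hs : ‖s‖ ≤ η) :
    Summable fun α => ‖MvPowerSeries.coeff α φ * mon z s α‖ := by
  simp only [norm_mul, norm_mon]
  exact h.mono (norm_nonneg z) (norm_nonneg s) hz hs

theorem coeff_mul_mon {A : Type*} [CommSemiring A] (φ ψ : MvPowerSeries (Fin 2) A) (z s : A)
    (α : Fin 2 →₀ ℕ) : MvPowerSeries.coeff α (φ * ψ) * mon z s α =
      ∑ x ∈ antidiagonal α, MvPowerSeries.coeff x.1 φ * mon z s x.1 *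
        (MvPowerSeries.coeff x.2 ψ * mon z s x.2) := by
  classical
  rw [MvPowerSeries.coeff_mul, sum_mul]
  refine sum_congr rfl fun x hx => ?_
  rw [← HasAntidiagonal.mem_antidiagonal.1 hx, mon_add]
  ring

theorem tsum_mul_tsum_antidiagonal {A : Type*} [AddCommMonoid A] [HasAntidiagonal A] {a b : A → ℂ}
    (ha : Summable fun i => ‖a i‖) (hb : Summable fun i => ‖b i‖) :
    (∑' i, a i) * ∑' i, b i = ∑' i, ∑ x ∈ antidiagonal i, a x.1 * b x.2 :=
  ha.of_norm.tsum_mul_tsum_eq_tsum_sum_antidiagonal hb.of_norm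
    (summable_mul_of_summable_norm ha hb)

theorem summable_sum_antidiagonal_of_nonneg {A : Type*} [AddCommMonoid A] [HasAntidiagonal A]
    {a b : A → ℝ} (ha : Summable a) (hb : Summable b) (ha0 : ∀ i, 0 ≤ a i) (hb0 : ∀ i, 0 ≤ b i) :
    Summable fun i => ∑ x ∈ antidiagonal i, a x.1 * b x.2 :=
  summable_sum_mul_antidiagonal_of_summable_mul (Summable.mul_of_nonneg ha hb ha0 hb0)

theorem eval₂_mul (hφ : WSum φ δ η) (hψ : WSum ψ δ η) {z s : ℂ} (hz : ‖z‖ ≤ δ) (hs : ‖s‖ ≤ η) :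
    eval₂ (φ * ψ) z s = eval₂ φ z s * eval₂ ψ z s := by
  have h1 := hφ.summable_norm hz hs
  have h2 := hψ.summable_norm hz hs
  exact (tsum_congr fun α => coeff_mul_mon φ ψ z s α).trans
    (tsum_mul_tsum_antidiagonal h1 h2).symm

theorem WSum.mul (hφ : WSum φ δ η) (hψ : WSum ψ δ η) (hδ : 0 ≤ δ) (hη : 0 ≤ η) :
    WSum (φ * ψ) δ η := by
  have h0 : ∀ (χ : MvPowerSeries (Fin 2) ℂ) α, 0 ≤ ‖MvPowerSeries.coeff α χ‖ * mon δ η α :=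
    fun χ α => mul_nonneg (norm_nonneg _) (mon_nonneg hδ hη α)
  have h := summable_sum_antidiagonal_of_nonneg hφ hψ (h0 φ) (h0 ψ)
  refine Summable.of_nonneg_of_le (fun α => mul_nonneg (norm_nonneg _) (mon_nonneg hδ hη α))
    (fun α => ?_) h
  classical
  rw [MvPowerSeries.coeff_mul]
  refine (mul_le_mul_of_nonneg_right (norm_sum_le _ _) (mon_nonneg hδ hη α)).trans ?_
  rw [sum_mul]
  refine sum_le_sum fun x hx => ?_
  rw [← HasAntidiagonal.mem_antidiagonal.1 hx, mon_add, norm_mul]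
  exact le_of_eq (by ring)

theorem eval₂_one (z s : ℂ) : eval₂ 1 z s = 1 := by
  classical
  rw [eval₂, tsum_eq_single 0 fun α hα => by rw [MvPowerSeries.coeff_one, if_neg hα, zero_mul]]
  simp [MvPowerSeries.coeff_one, mon]

theorem one_le_of_ne_zero {α : Fin 2 →₀ ℕ} (hα : α ≠ 0) : 1 ≤ α 0 + α 1 := by
  by_contra! h
  exact hα (Finsupp.ext fun i => by fin_cases i <;> simp <;> omega)

/-- The inverse of an absolutely convergent power series converges on a smaller polydisc. -/
theorem WSum.inv (h : WSum φ δ η) (hδ : 0 < δ) (hη : 0 < η)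
    (hc : MvPowerSeries.constantCoeff φ ≠ 0) :
    ∃ l, 0 < l ∧ l ≤ 1 ∧ WSum φ⁻¹ (l * δ) (l * η) := by
  classical
  set c := MvPowerSeries.constantCoeff φ with hcdef
  have hc0 : 0 < ‖c‖ := norm_pos_iff.2 hc
  set S := ∑' α, ‖MvPowerSeries.coeff α φ‖ * mon δ η α with hS
  have hS0 : 0 ≤ S := tsum_nonneg fun α => mul_nonneg (norm_nonneg _) (mon_nonneg hδ.le hη.le α)
  -- Scaling both radii by l multiplies every nonconstant monomial by at most l, so the nonconstant
  -- part of φ has weighted sum at most l S ≤ ‖c‖/2.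
  set l : ℝ := min 1 (‖c‖ / (2 * (S + 1))) with hl
  have hl0 : 0 < l := by positivity
  have hl1 : l ≤ 1 := min_le_left _ _
  have hlS : l * S ≤ ‖c‖ / 2 := by
    calc l * S ≤ ‖c‖ / (2 * (S + 1)) * (S + 1) := by
          gcongr
          · exact min_le_right _ _
          · linarith
      _ = ‖c‖ / 2 := by field_simp
  refine ⟨l, hl0, hl1, ?_⟩
  have hmon : ∀ α, 0 ≤ mon (l * δ) (l * η) α := mon_nonneg (by positivity) (by positivity)
  set ψ := φ⁻¹ with hψ
  have hmul : φ * ψ = 1 := MvPowerSeries.mul_inv_cancel φ hc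
  set k : (Fin 2 →₀ ℕ) → ℝ := fun α =>
    if α = 0 then 0 else ‖MvPowerSeries.coeff α φ‖ * mon (l * δ) (l * η) α with hk
  set a : (Fin 2 →₀ ℕ) → ℝ := fun α =>
    ‖MvPowerSeries.coeff α ψ‖ * mon (l * δ) (l * η) α with ha
  have ha0 : ∀ α, 0 ≤ a α := fun α => mul_nonneg (norm_nonneg _) (hmon α)
  have hk0 : ∀ α, 0 ≤ k α := fun α => by
    simp only [hk]
    split_ifs
    · exact le_rfl
    · exact mul_nonneg (norm_nonneg _) (hmon α)
  have hk1 : ∀ α, k α ≤ l * (‖MvPowerSeries.coeff α φ‖ * mon δ η α) := fun α => by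
    simp only [hk]
    split_ifs with h0
    · exact mul_nonneg hl0.le (mul_nonneg (norm_nonneg _) (mon_nonneg hδ.le hη.le α))
    · have h1 : mon (l * δ) (l * η) α = l ^ (α 0 + α 1) * mon δ η α := by
        simp only [mon, mul_pow, pow_add]; ring
      have h2 : l ^ (α 0 + α 1) ≤ l := pow_le_of_le_one hl0.le hl1 (by
        have := one_le_of_ne_zero h0; omega)
      rw [h1]
      have := mon_nonneg hδ.le hη.le α
      calc _ ≤ ‖MvPowerSeries.coeff α φ‖ * (l * mon δ η α) := by gcongr
        _ = _ := by ring
  have hksum : ∀ s : Finset (Fin 2 →₀ ℕ), ∑ α ∈ s, k α ≤ ‖c‖ / 2 := fun s => by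
    refine (sum_le_sum fun α _ => hk1 α).trans ?_
    rw [← mul_sum]
    refine (mul_le_mul_of_nonneg_left (h.sum_le_tsum s fun α _ => ?_) hl0.le).trans hlS
    exact mul_nonneg (norm_nonneg _) (mon_nonneg hδ.le hη.le α)
  -- The coefficient identity of φ ψ = 1, with the term containing the constant coefficient of φ
  -- isolated.
  have hrec : ∀ α, ‖c‖ * a α ≤ (if α = 0 then 1 else 0) +
      ∑ x ∈ antidiagonal α, k x.1 * a x.2 := fun α => by
    have h1 : MvPowerSeries.coeff α (φ * ψ) = if α = 0 then 1 else 0 := by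
      rw [hmul, MvPowerSeries.coeff_one]
    have h2 : c * MvPowerSeries.coeff α ψ = (if α = 0 then 1 else 0) -
        ∑ x ∈ (antidiagonal α).erase (0, α),
          MvPowerSeries.coeff x.1 φ * MvPowerSeries.coeff x.2 ψ := by
      rw [← h1, MvPowerSeries.coeff_mul,
        ← add_sum_erase (antidiagonal α) (fun x => MvPowerSeries.coeff x.1 φ *
          MvPowerSeries.coeff x.2 ψ)
          (show ((0 : Fin 2 →₀ ℕ), α) ∈ antidiagonal α from
            HasAntidiagonal.mem_antidiagonal.2 (zero_add α))]
      simp [hcdef]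
    have h3 : ‖c‖ * ‖MvPowerSeries.coeff α ψ‖ ≤ (if α = 0 then 1 else 0) +
        ∑ x ∈ (antidiagonal α).erase (0, α),
          ‖MvPowerSeries.coeff x.1 φ‖ * ‖MvPowerSeries.coeff x.2 ψ‖ := by
      rw [← norm_mul, h2]
      refine (norm_sub_le _ _).trans (add_le_add ?_ ((norm_sum_le _ _).trans ?_))
      · split_ifs <;> simp
      · exact sum_le_sum fun x _ => (norm_mul _ _).le
    calc ‖c‖ * a α = ‖c‖ * ‖MvPowerSeries.coeff α ψ‖ * mon (l * δ) (l * η) α := by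
          simp only [ha]; ring
      _ ≤ _ := mul_le_mul_of_nonneg_right h3 (hmon α)
      _ ≤ _ := by
          rw [add_mul]
          refine add_le_add ?_ ?_
          · split_ifs with h0
            · simp [h0, mon]
            · simp
          · rw [sum_mul]
            refine (sum_le_sum fun x hx => ?_).trans (sum_le_sum_of_subset_of_nonneg
              (erase_subset (0, α) (antidiagonal α)) fun x _ _ => mul_nonneg (hk0 _) (ha0 _))
            have hx' := mem_erase.1 hx
            have hx1 : x.1 ≠ 0 := fun h0 => hx'.1 (by
              have := HasAntidiagonal.mem_antidiagonal.1 hx'.2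
              rw [h0, zero_add] at this
              exact Prod.ext h0 this)
            simp only [hk, ha, if_neg hx1]
            rw [← HasAntidiagonal.mem_antidiagonal.1 hx'.2, mon_add]
            exact le_of_eq (by ring)
  -- A box contains both parts of every splitting of its elements. For the finite sum T over it,
  -- summing the recursion gives ‖c‖ T ≤ 1 + (‖c‖/2) T, and finiteness of T permits the subtraction.
  have hbox : ∀ N : Fin 2 →₀ ℕ, ∑ α ∈ Finset.Iic N, a α ≤ 2 / ‖c‖ := fun N => by
    have h1 : ∑ α ∈ Finset.Iic N, ∑ x ∈ antidiagonal α, k x.1 * a x.2 ≤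
        (∑ α ∈ Finset.Iic N, k α) * ∑ α ∈ Finset.Iic N, a α := by
      rw [sum_mul_sum, ← sum_product' (f := fun x y => k x * a y)]
      refine le_trans (le_of_eq (sum_congr rfl fun α hα => ?_))
        (sum_fiberwise_le_sum_of_sum_fiber_nonneg (t := Finset.Iic N)
          (g := fun x : (Fin 2 →₀ ℕ) × (Fin 2 →₀ ℕ) => x.1 + x.2)
          fun y _ => sum_nonneg fun x _ => mul_nonneg (hk0 _) (ha0 _))
      refine sum_congr ?_ fun _ _ => rfl
      ext x
      have hα := Finset.mem_Iic.1 hα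
      simp only [HasAntidiagonal.mem_antidiagonal, mem_filter, mem_product, Finset.mem_Iic]
      refine ⟨fun hx => ⟨⟨?_, ?_⟩, hx⟩, fun hx => hx.2⟩
      · exact (le_self_add.trans hx.le).trans hα
      · exact (le_add_self.trans hx.le).trans hα
    have h2 := sum_le_sum fun α (_ : α ∈ Finset.Iic N) => hrec α
    rw [← mul_sum, sum_add_distrib, sum_ite_eq' (Finset.Iic N) 0 (fun _ => (1 : ℝ))] at h2
    have h3 : (if (0 : Fin 2 →₀ ℕ) ∈ Finset.Iic N then (1 : ℝ) else 0) ≤ 1 := by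
      split_ifs <;> norm_num
    have h4 := mul_le_mul_of_nonneg_right (hksum (Finset.Iic N))
      (sum_nonneg fun α (_ : α ∈ Finset.Iic N) => ha0 α)
    rw [le_div_iff₀ hc0]
    linarith
  refine summable_of_sum_le (c := 2 / ‖c‖) ha0 fun u => ?_
  refine (sum_le_sum_of_subset_of_nonneg (fun α hα => ?_) fun α _ _ => ha0 α).trans
    (hbox (u.sup id))
  exact Finset.mem_Iic.2 (le_sup (f := id) hα)

/-- The inverse already exists over R, where the constant coefficient is a unit; by uniqueness its
image is the inverse over ℂ. -/
theorem coeff_inv_mem {R : Subalgebra ℚ ℂ} (hφ : ∀ α, MvPowerSeries.coeff α φ ∈ R)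
    (hc : MvPowerSeries.constantCoeff φ ≠ 0) (hu : (MvPowerSeries.constantCoeff φ)⁻¹ ∈ R)
    (α : Fin 2 →₀ ℕ) : MvPowerSeries.coeff α φ⁻¹ ∈ R := by
  let φ' : MvPowerSeries (Fin 2) R := fun α => ⟨MvPowerSeries.coeff α φ, hφ α⟩
  have hmap : MvPowerSeries.map (algebraMap R ℂ) φ' = φ := by
    ext α
    rw [MvPowerSeries.coeff_map]
    rfl
  have hcc : ((MvPowerSeries.constantCoeff φ' : R) : ℂ) = MvPowerSeries.constantCoeff φ := rfl
  let u : Rˣ := ⟨MvPowerSeries.constantCoeff φ', ⟨_, hu⟩,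
    Subtype.ext (by simpa [hcc] using mul_inv_cancel₀ hc),
    Subtype.ext (by simpa [hcc] using inv_mul_cancel₀ hc)⟩
  have h1 := congrArg (MvPowerSeries.map (algebraMap R ℂ))
    (MvPowerSeries.invOfUnit_mul φ' u rfl)
  rw [map_mul, hmap, map_one] at h1
  rw [← (MvPowerSeries.eq_inv_iff_mul_eq_one hc).2 h1, MvPowerSeries.coeff_map]
  exact (MvPowerSeries.coeff α (MvPowerSeries.invOfUnit φ' u)).2

theorem coeff_mul_mem {R : Subalgebra ℚ ℂ} (hφ : ∀ α, MvPowerSeries.coeff α φ ∈ R)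
    (hψ : ∀ α, MvPowerSeries.coeff α ψ ∈ R) (α : Fin 2 →₀ ℕ) :
    MvPowerSeries.coeff α (φ * ψ) ∈ R := by
  classical
  rw [MvPowerSeries.coeff_mul]
  exact sum_mem fun x _ => mul_mem (hφ _) (hψ _)

/-- Pairs of exponents as finitely supported functions. -/
noncomputable def expEquiv : (Fin 2 →₀ ℕ) ≃ ℕ × ℕ :=
  Finsupp.equivFunOnFinite.trans (finTwoArrowEquiv ℕ)

theorem expEquiv_apply (α : Fin 2 →₀ ℕ) : expEquiv α = (α 0, α 1) := rfl

theorem expEquiv_symm_zero (n j : ℕ) : expEquiv.symm (n, j) 0 = n :=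
  congrArg Prod.fst (expEquiv.apply_symm_apply (n, j))

theorem expEquiv_symm_one (n j : ℕ) : expEquiv.symm (n, j) 1 = j :=
  congrArg Prod.snd (expEquiv.apply_symm_apply (n, j))

/-! ### Expansion in `z = x L ^ M` and `s = L⁻¹` -/

/-- The coefficients of `L ^ (-D) f` as a series in `z = x L ^ M` and `s = L⁻¹`. -/
noncomputable def expand (M D : ℕ) (f : PowerSeries ℂ[X]) : MvPowerSeries (Fin 2) ℂ := fun α =>
  if α 1 ≤ M * α 0 + D then (PowerSeries.coeff (α 0) f).coeff (M * α 0 + D - α 1) else 0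

theorem coeff_expand (M D : ℕ) (f : PowerSeries ℂ[X]) (n j : ℕ) :
    MvPowerSeries.coeff (expEquiv.symm (n, j)) (expand M D f) =
      if j ≤ M * n + D then (PowerSeries.coeff n f).coeff (M * n + D - j) else 0 := by
  have : MvPowerSeries.coeff (expEquiv.symm (n, j)) (expand M D f) =
    expand M D f (expEquiv.symm (n, j)) := rfl
  rw [this, expand, expEquiv_symm_zero, expEquiv_symm_one]

theorem constantCoeff_expand (M D : ℕ) (f : PowerSeries ℂ[X]) :
    MvPowerSeries.constantCoeff (expand M D f) = (PowerSeries.coeff 0 f).coeff D := by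
  have : MvPowerSeries.constantCoeff (expand M D f) = expand M D f 0 := rfl
  rw [this, expand]
  simp

variable {R : Subalgebra ℚ ℂ} {M D : ℕ} {f g : PowerSeries ℂ[X]}

theorem Ser.coeff_expand_mem (hf : Ser R M D f) (α : Fin 2 →₀ ℕ) :
    MvPowerSeries.coeff α (expand M D f) ∈ R := by
  obtain ⟨⟨n, j⟩, rfl⟩ := expEquiv.symm.surjective α
  rw [coeff_expand]
  split_ifs
  · exact (hf.adm n _).1
  · exact zero_mem R

/-- For each n the row is finite and lists the coefficients of one polynomial in reverse order, so
its sum is at most the weighted norm B Kⁿ. Radius 1/(2K) in z makes the rows geometric. -/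
theorem Ser.wsum_expand (hf : Ser R M D f) : ∃ δ, 0 < δ ∧ WSum (expand M D f) δ 1 := by
  obtain ⟨B, K, hB, hK, h⟩ := hf.bdd
  have hK0 : 0 < K := by linarith
  refine ⟨1 / (2 * K), by positivity, ?_⟩
  rw [WSum, ← expEquiv.symm.summable_iff]
  have hterm : ∀ n j, ‖MvPowerSeries.coeff (expEquiv.symm (n, j)) (expand M D f)‖ *
      mon (1 / (2 * K)) 1 (expEquiv.symm (n, j)) =
      if j ≤ M * n + D then
        ‖(PowerSeries.coeff n f).coeff (M * n + D - j)‖ * (1 / (2 * K)) ^ n else 0 := by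
    intro n j
    rw [coeff_expand, mon, expEquiv_symm_zero, expEquiv_symm_one, one_pow, mul_one]
    split_ifs <;> simp
  have hrow : ∀ n, HasSum (fun j => ‖MvPowerSeries.coeff (expEquiv.symm (n, j)) (expand M D f)‖ *
      mon (1 / (2 * K)) 1 (expEquiv.symm (n, j)))
      (∑ j ∈ range (M * n + D + 1),
        ‖(PowerSeries.coeff n f).coeff (M * n + D - j)‖ * (1 / (2 * K)) ^ n) := by
    intro n
    simp only [hterm]
    rw [← sum_congr rfl fun j hj => if_pos (Nat.lt_succ_iff.1 (mem_range.1 hj))]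
    exact hasSum_sum_of_ne_finset_zero fun j hj =>
      if_neg (fun h => hj (mem_range.2 (Nat.lt_succ_of_le h)))
  have hle : ∀ n, ∑ j ∈ range (M * n + D + 1),
      ‖(PowerSeries.coeff n f).coeff (M * n + D - j)‖ * (1 / (2 * K)) ^ n ≤ B * (1 / 2) ^ n := by
    intro n
    rw [← sum_mul]
    have h1 : ∑ j ∈ range (M * n + D + 1), ‖(PowerSeries.coeff n f).coeff (M * n + D - j)‖ ≤
        pnorm (PowerSeries.coeff n f) := by
      have h2 := sum_range_reflect (fun j => ‖(PowerSeries.coeff n f).coeff j‖) (M * n + D + 1)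
      simp only [Nat.add_sub_cancel] at h2
      have h3 := hf.natDegree_le n
      rw [Int.toNat_natCast] at h3
      rw [h2, pnorm_eq_sum_range (n := M * n + D + 1) (by omega)]
      exact sum_le_sum fun j _ => le_mul_of_one_le_right (norm_nonneg _)
        (one_le_pow₀ (by norm_num))
    calc _ ≤ (B * K ^ n) * (1 / (2 * K)) ^ n := by
          gcongr
          exact h1.trans (h n)
      _ = B * (K * (1 / (2 * K))) ^ n := by rw [mul_pow]; ring
      _ = _ := by congr 2; field_simp
  refine (summable_prod_of_nonneg fun x => ?_).2 ⟨fun n => (hrow n).summable, ?_⟩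
  · exact mul_nonneg (norm_nonneg _) (mon_nonneg (by positivity) zero_le_one _)
  · refine Summable.of_nonneg_of_le (fun n => tsum_nonneg fun j =>
      mul_nonneg (norm_nonneg _) (mon_nonneg (by positivity) zero_le_one _)) (fun n => ?_)
      ((summable_geometric_of_lt_one (by norm_num : (0 : ℝ) ≤ 1 / 2) (by norm_num)).mul_left B)
    exact (hrow n).tsum_eq.trans_le (hle n)

/-- Termwise this is x^n L^i = L^D z^n s^(M n + D - i). -/
theorem Ser.ev_eq_eval₂ (hf : Ser R M D f) {δ : ℝ} (hW : WSum (expand M D f) δ 1) {w : ℂ × ℂ}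
    (hL : 1 ≤ ‖w.1 + w.2‖) (hz : ‖Complex.exp w.2 * (w.1 + w.2) ^ M‖ ≤ δ) :
    ev f w = (w.1 + w.2) ^ D *
      eval₂ (expand M D f) (Complex.exp w.2 * (w.1 + w.2) ^ M) (w.1 + w.2)⁻¹ := by
  set L := w.1 + w.2 with hLdef
  set z := Complex.exp w.2 * L ^ M with hzdef
  have hL0 : L ≠ 0 := norm_pos_iff.1 (by linarith)
  have hs : ‖L⁻¹‖ ≤ 1 := by rw [norm_inv]; exact inv_le_one_of_one_le₀ hL
  have hsum := (hW.summable_norm hz hs).of_norm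
  have hsum' : Summable fun p : ℕ × ℕ =>
      MvPowerSeries.coeff (expEquiv.symm p) (expand M D f) * mon z L⁻¹ (expEquiv.symm p) :=
    expEquiv.symm.summable_iff.2 hsum
  rw [eval₂, ← expEquiv.symm.tsum_eq, hsum'.tsum_prod, ev, ← tsum_mul_left]
  refine tsum_congr fun n => ?_
  have hN : (PowerSeries.coeff n f).natDegree < M * n + D + 1 := by
    have := hf.natDegree_le n
    rw [Int.toNat_natCast] at this
    omega
  rw [tsum_eq_sum (s := range (M * n + D + 1)) fun j hj => by
    rw [coeff_expand, if_neg (fun h => hj (mem_range.2 (Nat.lt_succ_of_le h))), zero_mul]]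
  rw [evTerm, eval_eq_sum_range' hN, ← sum_range_reflect, mul_sum, mul_sum]
  refine sum_congr rfl fun j hj => ?_
  have hj := Nat.lt_succ_iff.1 (mem_range.1 hj)
  rw [coeff_expand, if_pos hj, mon, expEquiv_symm_zero, expEquiv_symm_one, Nat.add_sub_cancel,
    hzdef, mul_pow, ← hLdef]
  have h1 : L ^ (M * n + D - j) = L ^ D * (L ^ M) ^ n * L⁻¹ ^ j := by
    rw [inv_pow, ← pow_mul, ← pow_add, add_comm D, pow_sub₀ _ hL0 hj]
  rw [h1]
  ring

theorem eventually_small {Θ : ℝ} (hΘ : 0 < Θ) (M : ℕ) {δ η : ℝ} (hδ : 0 < δ) (hη : 0 < η) :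
    ∀ᶠ w in nearZero Θ, ‖Complex.exp w.2 * (w.1 + w.2) ^ M‖ ≤ δ ∧ ‖(w.1 + w.2)⁻¹‖ ≤ η ∧
      1 ≤ ‖w.1 + w.2‖ := by
  simp only [norm_mul, norm_pow]
  have h := (tendsto_inv_log Θ).norm
  rw [norm_zero] at h
  exact ((tendsto_norm_exp_mul_pow hΘ M).eventually_le_const hδ).and
    ((h.eventually_le_const hη).and ((tendsto_norm_log Θ).eventually_ge_atTop 1))

/-- The quotient of two series is given by an absolutely convergent expansion in `x L ^ M` and
`L⁻¹` if the leading coefficient of the denominator is invertible. -/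
theorem Ser.exists_ratio (hf : Ser R M D f) (hg : Ser R M D g)
    (hu : (PowerSeries.coeff 0 g).coeff D ≠ 0) (hu' : ((PowerSeries.coeff 0 g).coeff D)⁻¹ ∈ R) :
    ∃ Y : MvPowerSeries (Fin 2) ℂ, (∀ α, MvPowerSeries.coeff α Y ∈ R) ∧
      Y * expand M D g = expand M D f ∧ ∀ Θ : ℝ, 0 < Θ → ∀ᶠ w in nearZero Θ, ev g w ≠ 0 ∧
        HasSum (fun α => MvPowerSeries.coeff α Y *
          mon (Complex.exp w.2 * (w.1 + w.2) ^ M) (w.1 + w.2)⁻¹ α) (ev f w / ev g w) := by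
  rw [← constantCoeff_expand M D g] at hu hu'
  obtain ⟨δ₁, hδ₁, hW₁⟩ := hf.wsum_expand
  obtain ⟨δ₂, hδ₂, hW₂⟩ := hg.wsum_expand
  obtain ⟨l, hl0, hl1, hWi⟩ := hW₂.inv hδ₂ one_pos hu
  have hinv := MvPowerSeries.inv_mul_cancel _ hu
  have hY : (expand M D f * (expand M D g)⁻¹) * expand M D g = expand M D f := by
    rw [mul_assoc, hinv, mul_one]
  refine ⟨expand M D f * (expand M D g)⁻¹,
    coeff_mul_mem hf.coeff_expand_mem (coeff_inv_mem hg.coeff_expand_mem hu hu'), hY,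
    fun Θ hΘ => ?_⟩
  set δ := min δ₁ (l * δ₂) with hδ
  have hδ0 : 0 < δ := by positivity
  have hηl : 0 < l * 1 := by positivity
  have hδ2 : δ ≤ δ₂ := (min_le_right _ _).trans (mul_le_of_le_one_left hδ₂.le hl1)
  have v₁ : WSum (expand M D f) δ (l * 1) :=
    hW₁.mono hδ0.le hηl.le (min_le_left _ _) (by linarith)
  have v₂ : WSum (expand M D g) δ (l * 1) := hW₂.mono hδ0.le hηl.le hδ2 (by linarith)
  have v₃ : WSum (expand M D g)⁻¹ δ (l * 1) := hWi.mono hδ0.le hηl.le (min_le_right _ _) le_rfl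
  filter_upwards [eventually_small hΘ M hδ0 hηl] with w ⟨hz, hs, hL⟩
  have hL0 : w.1 + w.2 ≠ 0 := norm_pos_iff.1 (by linarith)
  have ef := hf.ev_eq_eval₂ hW₁ hL (hz.trans (min_le_left _ _))
  have eg := hg.ev_eq_eval₂ hW₂ hL (hz.trans hδ2)
  have h1 := eval₂_mul v₃ v₂ hz hs
  rw [hinv, eval₂_one] at h1
  have hg0 : eval₂ (expand M D g) (Complex.exp w.2 * (w.1 + w.2) ^ M) (w.1 + w.2)⁻¹ ≠ 0 :=
    fun h => by simp [h] at h1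
  refine ⟨by rw [eg]; exact mul_ne_zero (pow_ne_zero _ hL0) hg0, ?_⟩
  have v₄ := v₁.mul v₃ hδ0.le hηl.le
  have h2 := eval₂_mul v₄ v₂ hz hs
  rw [hY] at h2
  rw [ef, eg, mul_div_mul_left _ _ (pow_ne_zero _ hL0), h2, mul_div_cancel_right₀ _ hg0]
  exact (v₄.summable_norm hz hs).of_norm.hasSum

/-- The quotient f/f is considered over the full ring, where the leading coefficient is invertible
for free. -/
theorem Ser.eventually_ne_zero (hf : Ser R M D f) (hu : (PowerSeries.coeff 0 f).coeff D ≠ 0)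
    {Θ : ℝ} (hΘ : 0 < Θ) : ∀ᶠ w in nearZero Θ, ev f w ≠ 0 := by
  have hf' : Ser ⊤ M D f := ⟨fun n j => ⟨trivial, (hf.adm n j).2⟩, hf.bdd⟩
  obtain ⟨Y, -, -, hY⟩ := hf'.exists_ratio hf' hu trivial
  exact (hY Θ hΘ).mono fun w hw => hw.1

end

section

/-! ### From the first order system to the fifth Painlevé equation -/

/-- The right-hand side of the first order equation for `x dy/dx`. -/
noncomputable def rhsY (θ₀ θₓ θinf x y z : ℂ) : ℂ :=
  x * y - 2 * z * (y - 1) ^ 2 -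
    (y - 1) * ((θ₀ - θₓ + θinf) / 2 * y - (3 * θ₀ + θₓ + θinf) / 2)

/-- The right-hand side of the first order equation for `x dz/dx`. -/
noncomputable def rhsZ (θ₀ θₓ θinf y z : ℂ) : ℂ :=
  y * z * (z + (θ₀ - θₓ + θinf) / 2) - (z + θ₀) * (z + (θ₀ + θₓ + θinf) / 2) / y

variable {θ₀ θₓ θinf : ℂ}

/-- Once both derivatives are replaced by the right-hand sides, each side of (V) is a rational
function of x, y, z, and the two agree identically. -/
theorem isSolution_of_system {U : Set ℂ} (hU : IsOpen U) {y z : ℂ → ℂ}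
    (hy : ∀ ξ ∈ U, HasDerivAt y (rhsY θ₀ θₓ θinf (Complex.exp ξ) (y ξ) (z ξ)) ξ)
    (hz : ∀ ξ ∈ U, HasDerivAt z (rhsZ θ₀ θₓ θinf (y ξ) (z ξ)) ξ)
    (h0 : ∀ ξ ∈ U, y ξ ≠ 0) (h1 : ∀ ξ ∈ U, y ξ ≠ 1) : IsSolution θ₀ θₓ θinf U y := by
  refine ⟨fun ξ hξ => (hy ξ hξ).differentiableAt.differentiableWithinAt,
    fun ξ hξ => ⟨h0 ξ hξ, h1 ξ hξ, ?_⟩⟩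
  have e1 : ∀ η ∈ U, xDeriv y η =
      rhsY θ₀ θₓ θinf (Complex.exp η) (y η) (z η) / Complex.exp η := fun η hη => by
    rw [xDeriv, (hy η hη).deriv]
  have e2 : xDeriv y =ᶠ[𝓝 ξ] fun η =>
      rhsY θ₀ θₓ θinf (Complex.exp η) (y η) (z η) / Complex.exp η := by
    filter_upwards [hU.mem_nhds hξ] with η hη using e1 η hη
  have dy := hy ξ hξ
  have dz := hz ξ hξ
  have dx := Complex.hasDerivAt_exp ξ
  have d1 := ((dx.fun_mul dy).fun_sub ((dz.const_mul 2).fun_mul ((dy.sub_const 1).fun_pow 2))).fun_sub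
    ((dy.sub_const 1).fun_mul ((dy.const_mul ((θ₀ - θₓ + θinf) / 2)).sub_const
      ((3 * θ₀ + θₓ + θinf) / 2)))
  have d2 := d1.fun_div dx (Complex.exp_ne_zero ξ)
  have e3 : xDeriv (xDeriv y) ξ = deriv (fun η =>
      rhsY θ₀ θₓ θinf (Complex.exp η) (y η) (z η) / Complex.exp η) ξ / Complex.exp ξ := by
    rw [xDeriv, e2.deriv_eq]
  have e4 : deriv (fun η =>
      rhsY θ₀ θₓ θinf (Complex.exp η) (y η) (z η) / Complex.exp η) ξ = _ := d2.deriv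
  rw [e3, e4, e1 ξ hξ]
  have hy0 := h0 ξ hξ
  have hy1 : y ξ - 1 ≠ 0 := sub_ne_zero.2 (h1 ξ hξ)
  have hx0 := Complex.exp_ne_zero ξ
  simp only [rhsY, rhsZ]
  generalize y ξ = Y at *
  generalize z ξ = Z at *
  generalize Complex.exp ξ = x at *
  clear * - hy0 hy1 hx0
  field_simp
  ring

/-- The two determinant relations express r and c through p, q, b; what remains is a rational
identity. -/
theorem hasDerivAt_y {P Q B C R : ℂ → ℂ} {ξ t : ℂ} (ht : t = θinf / 2)
    (hP : HasDerivAt P (B ξ * R ξ - C ξ * Q ξ) ξ)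
    (hQ : HasDerivAt Q (-(2 * t * Q ξ) - 2 * B ξ * P ξ) ξ)
    (hB : HasDerivAt B (Complex.exp ξ * (B ξ - Q ξ)) ξ)
    (h0 : P ξ * P ξ + Q ξ * R ξ = θ₀ ^ 2 / 4)
    (h1 : (P ξ + t) * (P ξ + t) + (B ξ - Q ξ) * (C ξ - R ξ) = θₓ ^ 2 / 4)
    (hQ0 : Q ξ ≠ 0) (hP0 : P ξ + (t - θₓ / 2) ≠ 0) (hBQ : B ξ - Q ξ ≠ 0)
    {y : ℂ → ℂ} (hy : ∀ η, y η = 1 + (Q η * ((θ₀ + θₓ) / 2 - t) - B η * (P η + θ₀ / 2)) /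
      (Q η * (P η + (t - θₓ / 2)))) :
    HasDerivAt y (rhsY θ₀ θₓ θinf (Complex.exp ξ) (y ξ) (P ξ - θ₀ / 2)) ξ := by
  have d1 := (hQ.mul_const ((θ₀ + θₓ) / 2 - t)).fun_sub (hB.fun_mul (hP.add_const (θ₀ / 2)))
  have d2 := hQ.fun_mul (hP.add_const (t - θₓ / 2))
  have d3 := (d1.fun_div d2 (mul_ne_zero hQ0 hP0)).const_add 1
  rw [← funext hy] at d3
  refine d3.congr_deriv ?_
  rw [rhsY, hy]
  have hR : R ξ = (θ₀ ^ 2 / 4 - P ξ * P ξ) / Q ξ := by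
    rw [eq_div_iff hQ0]; linear_combination h0
  have hC : C ξ = (θ₀ ^ 2 / 4 - P ξ * P ξ) / Q ξ +
      (θₓ ^ 2 / 4 - (P ξ + t) * (P ξ + t)) / (B ξ - Q ξ) := by
    rw [← hR, ← sub_eq_iff_eq_add', eq_div_iff hBQ]; linear_combination h1
  rw [hR, hC]
  obtain rfl : θinf = 2 * t := by rw [ht]; ring
  generalize Q ξ = q at *
  generalize P ξ = p at *
  generalize B ξ = b at *
  generalize Complex.exp ξ = x at *
  clear * - hQ0 hP0 hBQ
  -- The denominators p + t - θₓ/2 and b - q are made into variables, so that clearing fractions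
  -- only meets atoms.
  have hP2 : p * 2 + (t * 2 - θₓ) ≠ 0 := fun h => hP0 (by linear_combination h / 2)
  have e1 : p + (t - θₓ / 2) = (p * 2 + (t * 2 - θₓ)) / 2 := by ring
  rw [e1]
  generalize hs : p * 2 + (t * 2 - θₓ) = s at *
  obtain rfl : θₓ = p * 2 + t * 2 - s := by rw [← hs]; ring
  generalize hv : b - q = v at *
  obtain rfl : b = v + q := by rw [← hv]; ring
  field_simp
  ring

/-- The determinants factor as (p - θ₀/2)(p + θ₀/2) = -q r and (p + t - θₓ/2)(p + t + θₓ/2) = -(b -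
q)(c - r). They turn the two terms of the right-hand side into (b - q) r and q (c - r). -/
theorem rhsZ_eq {P Q B C R t y : ℂ} (ht : t = θinf / 2)
    (h0 : P * P + Q * R = θ₀ ^ 2 / 4)
    (h1 : (P + t) * (P + t) + (B - Q) * (C - R) = θₓ ^ 2 / 4)
    (hQ0 : Q ≠ 0) (hP0 : P + (t - θₓ / 2) ≠ 0) (hBQ : B - Q ≠ 0) (hPθ : P + θ₀ / 2 ≠ 0)
    (hy : y = -((B - Q) * (P + θ₀ / 2)) / (Q * (P + (t - θₓ / 2)))) :
    rhsZ θ₀ θₓ θinf y (P - θ₀ / 2) = B * R - C * Q := by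
  obtain rfl : θinf = 2 * t := by rw [ht]; ring
  have hy' : y * (Q * (P + (t - θₓ / 2))) = -((B - Q) * (P + θ₀ / 2)) := by
    rw [hy, div_mul_cancel₀ _ (mul_ne_zero hQ0 hP0)]
  have e1 : y * (P - θ₀ / 2) * (P - θ₀ / 2 + (θ₀ - θₓ + 2 * t) / 2) = (B - Q) * R := by
    refine mul_right_cancel₀ hQ0 ?_
    linear_combination (P - θ₀ / 2) * hy' - (B - Q) * h0
  have e2 : (P - θ₀ / 2 + θ₀) * (P - θ₀ / 2 + (θ₀ + θₓ + 2 * t) / 2) / y = Q * (C - R) := by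
    have hy0 : y ≠ 0 := by
      rw [hy]
      exact div_ne_zero (neg_ne_zero.2 (mul_ne_zero hBQ hPθ)) (mul_ne_zero hQ0 hP0)
    rw [div_eq_iff hy0]
    refine mul_right_cancel₀ hP0 ?_
    linear_combination (-(C - R)) * hy' + (P + θ₀ / 2) * h1
  rw [rhsZ, e1, e2]
  ring

end

section

/-! ### The part of the expansion free of `x` -/

/-- The part of a power series in `z`, `s` that does not involve `z`. -/
noncomputable def row (φ : MvPowerSeries (Fin 2) ℂ) : PowerSeries ℂ :=
  PowerSeries.mk fun j => MvPowerSeries.coeff (expEquiv.symm (0, j)) φ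

theorem expEquiv_symm_zero_left (j : ℕ) : expEquiv.symm (0, j) = Finsupp.single 1 j := by
  refine expEquiv.injective ?_
  rw [Equiv.apply_symm_apply, expEquiv_apply]
  simp

theorem row_mul (φ ψ : MvPowerSeries (Fin 2) ℂ) : row (φ * ψ) = row φ * row ψ := by
  classical
  ext j
  simp only [row, PowerSeries.coeff_mul, PowerSeries.coeff_mk, expEquiv_symm_zero_left]
  rw [MvPowerSeries.coeff_mul, Finsupp.antidiagonal_single]
  simp

variable {R : Subalgebra ℚ ℂ} {M D k : ℕ} {f g : PowerSeries ℂ[X]} {a : ℂ}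

theorem coeff_row_expand (j : ℕ) : PowerSeries.coeff j (row (expand M D f)) =
    if j ≤ D then (PowerSeries.coeff 0 f).coeff (D - j) else 0 := by
  rw [row, PowerSeries.coeff_mk, coeff_expand, mul_zero, zero_add]

/-- B is a unit, so A and E have the same order of vanishing. -/
theorem PowerSeries.coeff_of_mul_eq {A B E : PowerSeries ℂ} (h : A * B = E)
    (hB : PowerSeries.coeff 0 B ≠ 0) (hE : ∀ j < k, PowerSeries.coeff j E = 0)
    (ha : PowerSeries.coeff k E = a * PowerSeries.coeff 0 B) :
    (∀ j < k, PowerSeries.coeff j A = 0) ∧ PowerSeries.coeff k A = a := by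
  have hu : IsUnit B := PowerSeries.isUnit_iff_constantCoeff.2 (by simpa using hB)
  have h1 : PowerSeries.X ^ k ∣ A := by
    rw [← hu.dvd_mul_right (b := A), h]
    exact PowerSeries.X_pow_dvd_iff.2 hE
  refine ⟨PowerSeries.X_pow_dvd_iff.1 h1, ?_⟩
  obtain ⟨A', rfl⟩ := h1
  have h2 : PowerSeries.coeff k E = PowerSeries.coeff 0 A' * PowerSeries.coeff 0 B := by
    rw [← h, mul_assoc]
    have := PowerSeries.coeff_X_pow_mul (A' * B) k 0
    rw [zero_add] at this
    rw [this]
    simp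
  have h3 := PowerSeries.coeff_X_pow_mul A' k 0
  rw [zero_add] at h3
  rw [h3]
  exact mul_right_cancel₀ hB (h2.symm.trans ha)

/-! ### Inverse logarithmic sums -/

/-- Since z^n s^j = x^n L^(M n - j), the row n = 0 gives the pure inverse powers of L and the rows n
≥ 1 the double series. -/
theorem isInvLogSum_of_hasSum {Y : MvPowerSeries (Fin 2) ℂ} {x L v : ℂ} (hL : L ≠ 0)
    (hlow : ∀ j < k, MvPowerSeries.coeff (expEquiv.symm (0, j)) Y = 0)
    (hk : MvPowerSeries.coeff (expEquiv.symm (0, k)) Y = a)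
    (h : HasSum (fun α => MvPowerSeries.coeff α Y * mon (x * L ^ M) L⁻¹ α) v) :
    IsInvLogSum a k M (fun j => MvPowerSeries.coeff (expEquiv.symm (0, j)) Y)
      (fun j n => MvPowerSeries.coeff (expEquiv.symm (n, j)) Y) x L (1 + v) := by
  set F : ℕ × ℕ → ℂ := fun p => MvPowerSeries.coeff (expEquiv.symm p) Y *
    ((x * L ^ M) ^ p.1 * L⁻¹ ^ p.2) with hF
  have hFv : HasSum F v := by
    convert expEquiv.symm.hasSum_iff.2 h using 1
    funext ⟨n, j⟩
    simp only [hF, Function.comp_apply, mon, expEquiv_symm_zero, expEquiv_symm_one]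
  have hS := hFv.summable
  have hrow : Summable fun j => F (0, j) := hS.prod_factor 0
  have hpos : Summable fun p : ℕ × ℕ => F (p.1 + 1, p.2) :=
    hS.comp_injective (i := fun p : ℕ × ℕ => (p.1 + 1, p.2)) fun p q hpq => by
      simp only [Prod.mk.injEq, Nat.add_right_cancel_iff] at hpq
      exact Prod.ext hpq.1 hpq.2
  have hv : v = ∑' j, F (0, j) + ∑' p : ℕ × ℕ, F (p.1 + 1, p.2) := by
    rw [← hFv.tsum_eq, hS.tsum_prod, hS.prod.tsum_eq_zero_add, hpos.tsum_prod]
  have hrow' : HasSum (fun i => F (0, i + (k + 1))) (∑' j, F (0, j) - a * L⁻¹ ^ k) := by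
    have h1 := (hasSum_nat_add_iff' (k + 1)).2 hrow.hasSum
    rw [sum_range_succ, sum_eq_zero fun j hj => by
      simp only [hF]; rw [hlow j (mem_range.1 hj), zero_mul]] at h1
    simpa [hF, hk] using h1
  refine ⟨∑' j, F (0, j) - a * L⁻¹ ^ k, ∑' p : ℕ × ℕ, F (p.1 + 1, p.2), ?_, ?_, ?_⟩
  · convert hrow' using 1
    funext i
    simp only [hF, pow_zero, one_mul]
    rw [zpow_neg, zpow_natCast, inv_pow, add_comm i]
  · convert hpos.hasSum using 1
    funext p
    simp only [hF]
    rw [zpow_sub₀ hL, zpow_natCast, zpow_natCast, pow_mul, mul_pow, inv_pow]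
    ring
  · rw [hv, zpow_neg, zpow_natCast, inv_pow]
    ring

/-! ### Families of solutions given by quotients -/

variable {θ₀ θₓ θinf : ℂ}

theorem exists_family_of_quotient (hk : 1 ≤ k) (hkD : k ≤ D) (ha : a ≠ 0)
    (hf : Ser R M D f) (hg : Ser R M D g)
    (hu : (PowerSeries.coeff 0 g).coeff D ≠ 0) (hu' : ((PowerSeries.coeff 0 g).coeff D)⁻¹ ∈ R)
    (hlow : ∀ j < k, (PowerSeries.coeff 0 f).coeff (D - j) = 0)
    (hlead : (PowerSeries.coeff 0 f).coeff (D - k) = a * (PowerSeries.coeff 0 g).coeff D)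
    {z : ℂ × ℂ → ℂ}
    (hsol : ∀ Θ : ℝ, 0 < Θ → ∀ᶠ w in nearZero Θ, ev g w ≠ 0 → ev f w ≠ 0 → ev (g + f) w ≠ 0 →
      HasDerivAt (fun ξ => 1 + ev f (w.1, ξ) / ev g (w.1, ξ))
        (rhsY θ₀ θₓ θinf (Complex.exp w.2) (1 + ev f w / ev g w) (z w)) w.2 ∧
      HasDerivAt (fun ξ => z (w.1, ξ)) (rhsZ θ₀ θₓ θinf (1 + ev f w / ev g w) (z w)) w.2) :
    ∃ (c : ℕ → ℂ) (d : ℕ → ℕ → ℂ), CoeffsIn R c d ∧ IsInvLogFamily θ₀ θₓ θinf a k M c d ∧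
      (Polynomial.X * PowerSeries.coeff 0 f = C a * PowerSeries.coeff 0 g → k = 1 →
        ∀ j, 2 ≤ j → c j = 0) := by
  obtain ⟨Y, hYR, hY, hYsum⟩ := hf.exists_ratio hg hu hu'
  have hrow : row Y * row (expand M D g) = row (expand M D f) := by rw [← row_mul, hY]
  have hg0 : PowerSeries.coeff 0 (row (expand M D g)) = (PowerSeries.coeff 0 g).coeff D := by
    rw [coeff_row_expand]; simp
  have hYk := PowerSeries.coeff_of_mul_eq (k := k) (a := a) hrow (by rwa [hg0])
    (fun j hj => by rw [coeff_row_expand, if_pos (by omega), hlow j hj])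
    (by rw [coeff_row_expand, if_pos hkD, hlead, hg0])
  simp only [row, PowerSeries.coeff_mk] at hYk
  have hf0 : (PowerSeries.coeff 0 f).coeff D = 0 := hlow 0 hk
  have hgf : Ser R M D (g + f) := hg.add hf
  -- For y ≠ 1 one needs f ≠ 0, but the coefficient of L^D in f vanishes. Trading k powers of L for
  -- a larger M makes L^(D - k) the leading power, with coefficient a times that of g.
  have hshift : Ser R (M + k) ((D - k : ℕ) : ℤ) f := by
    refine hf.shift (by omega) fun j => ⟨(hf.adm 0 j).1, fun hj => ?_⟩
    by_cases hjD : j ≤ D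
    · have := hlow (D - j) (by omega)
      rwa [Nat.sub_sub_self hjD] at this
    · exact (hf.adm 0 j).2 (by push_cast; omega)
  refine ⟨fun j => MvPowerSeries.coeff (expEquiv.symm (0, j)) Y,
    fun j n => MvPowerSeries.coeff (expEquiv.symm (n, j)) Y,
    ⟨fun j => hYR _, fun j n => hYR _⟩, fun Θ hΘ => ?_, ?_⟩
  · obtain ⟨ε, hε, hΩ⟩ := eventually_nearZero.1 ((hYsum Θ hΘ).and
      ((hshift.eventually_ne_zero (by rw [hlead]; exact mul_ne_zero ha hu) hΘ).and
      ((hgf.eventually_ne_zero (by rwa [map_add, coeff_add, hf0, add_zero]) hΘ).and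
      ((hsol Θ hΘ).and ((hf.exists_hasFDerivAt hΘ).and ((hg.exists_hasFDerivAt hΘ).and
      ((hf.summable hΘ).and ((hg.summable hΘ).and
      ((tendsto_norm_log Θ).eventually_ge_atTop 1)))))))))
    refine ⟨ε, hε, fun w => 1 + ev f w / ev g w, fun w hw => ?_, fun r => ?_, fun r ξ hw => ?_⟩
    · obtain ⟨⟨h1, -⟩, -, -, -, ⟨f', h2, -⟩, ⟨g', h3, -⟩, -⟩ := hΩ w hw
      exact ((differentiableAt_const 1).add
        (h2.differentiableAt.mul (h3.differentiableAt.inv h1))).differentiableWithinAt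
    · have hmem : ∀ ξ ∈ OmegaStarAt ε Θ r, ((r, ξ) : ℂ × ℂ) ∈ OmegaStar ε Θ := fun ξ hξ =>
        mem_OmegaStar.2 hξ
      refine isSolution_of_system (isOpen_OmegaStarAt ε Θ r) (z := fun ξ => z (r, ξ))
        (fun ξ hξ => ?_) (fun ξ hξ => ?_) (fun ξ hξ => ?_) (fun ξ hξ => ?_) <;>
        obtain ⟨⟨h1, -⟩, h2, h3, h4, -, -, h5, h6, -⟩ := hΩ _ (hmem ξ hξ)
      · exact (h4 h1 h2 h3).1
      · exact (h4 h1 h2 h3).2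
      · rw [ev_add h6 h5] at h3
        change 1 + ev f (r, ξ) / ev g (r, ξ) ≠ 0
        rw [one_add_div h1]
        exact div_ne_zero h3 h1
      · exact fun h => div_ne_zero h2 h1 (by simpa using h)
    · obtain ⟨⟨-, h1⟩, -, -, -, -, -, -, -, h2⟩ := hΩ _ hw
      exact isInvLogSum_of_hasSum (norm_pos_iff.1 (lt_of_lt_of_le one_pos h2)) hYk.1 hYk.2 h1
  · rintro hX rfl j hj
    -- Expansion reverses the order of coefficients, so L f₀ = a g₀ becomes multiplication of the
    -- row of g by a s; the x-free part of y - 1 is then exactly a/L.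
    have h1 : row (expand M D f) = (PowerSeries.C a * PowerSeries.X) * row (expand M D g) := by
      ext i
      rw [mul_assoc, PowerSeries.coeff_C_mul, coeff_row_expand]
      cases i with
      | zero => simpa using hf0
      | succ i =>
        rw [PowerSeries.coeff_succ_X_mul, coeff_row_expand]
        have h2 := congrArg (fun P => P.coeff (D - i)) hX
        simp only [coeff_C_mul] at h2
        by_cases hi : i + 1 ≤ D
        · rw [if_pos hi, if_pos (by omega), ← h2, show D - i = D - (i + 1) + 1 by omega,
            coeff_X_mul]
        · rw [if_neg hi]
          split_ifs with hi'
          · rw [← h2, show D - i = 0 by omega, mul_coeff_zero, coeff_X_zero, zero_mul]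
          · simp
    have h3 : row (expand M D g) ≠ 0 := fun h => hu (by rw [← hg0, h, map_zero])
    have h4 : row Y = PowerSeries.C a * PowerSeries.X :=
      mul_right_cancel₀ h3 (hrow.trans h1)
    have h5 := congrArg (PowerSeries.coeff j) h4
    rw [row, PowerSeries.coeff_mk, PowerSeries.coeff_C_mul, PowerSeries.coeff_X,
      if_neg (by omega), mul_zero] at h5
    exact h5

theorem Ser.hasDerivAt {D : ℤ} (hf : Ser R M D f) {Θ : ℝ} (hΘ : 0 < Θ) : ∀ᶠ w in nearZero Θ,
    HasDerivAt (fun ξ => ev f (w.1, ξ)) (ev (PainleveV.euler f) w) w.2 := by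
  filter_upwards [hf.exists_hasFDerivAt hΘ] with w ⟨f', h1, h2⟩
  have h3 : HasDerivAt (fun ξ : ℂ => ((w.1, ξ) : ℂ × ℂ)) (0, 1) w.2 :=
    (hasDerivAt_const w.2 w.1).prodMk (hasDerivAt_id w.2)
  rw [← h2]
  exact HasFDerivAt.comp_hasDerivAt (f := fun ξ : ℂ => ((w.1, ξ) : ℂ × ℂ)) w.2 h1 h3

end

section

/-! ### Families of solutions given by formal solutions -/

variable {θ₀ θₓ θinf : ℂ} {R : Subalgebra ℚ ℂ}

theorem ratCast_mem_subalgebra (R : Subalgebra ℚ ℂ) (q : ℚ) : (q : ℂ) ∈ R := R.algebraMap_mem q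

theorem half_mem {a : ℂ} (ha : a ∈ R) : a / 2 ∈ R := by
  have h := mul_mem ha (ratCast_mem_subalgebra R (1 / 2))
  convert h using 1
  push_cast
  ring

theorem adm_lin {e : ℤ} {a b : ℂ} (ha : a ∈ R) (hb : b ∈ R) (he : 1 ≤ e) :
    Adm R e (C a + C b * X) :=
  (Adm.C ha (by omega)).add (Adm.C_mul hb (Adm.X he))

theorem adm_quad {e : ℤ} {a b c : ℂ} (ha : a ∈ R) (hb : b ∈ R) (hc : c ∈ R) (he : 2 ≤ e) :
    Adm R e (C a + C b * X + C c * X ^ 2) := by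
  refine (adm_lin ha hb (by omega)).add (Adm.C_mul hc ?_)
  rw [pow_two]
  exact ((Adm.X le_rfl).mul (Adm.X le_rfl)).mono he

/-- A family of solutions from a nilpotent leading term of the isomonodromic system. -/
theorem exists_family_of_leadingTerm {m M D k : ℕ} {h : ℤ} {t b₀ c₀ a : ℂ} {p₀ q₀ r₀ : ℂ[X]}
    (H : LeadingTerm R m h t b₀ c₀ (p₀, q₀, r₀)) (ht : t = θinf / 2) (hθ₀ : θ₀ ∈ R) (hθₓ : θₓ ∈ R)
    (hdet₀ : p₀ * p₀ + q₀ * r₀ = C (θ₀ ^ 2 / 4))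
    (hdet₁ : (p₀ + C t) * (p₀ + C t) + (C b₀ - q₀) * (C c₀ - r₀) = C (θₓ ^ 2 / 4))
    (hM : m ≤ M) (hD : 2 * (m : ℤ) + h = D) (hk : 1 ≤ k) (hkD : k ≤ D) (ha : a ≠ 0)
    (hu : (q₀ * (p₀ + C (t - θₓ / 2))).coeff D ≠ 0)
    (hu' : ((q₀ * (p₀ + C (t - θₓ / 2))).coeff D)⁻¹ ∈ R)
    (hdeg : (q₀ * C ((θ₀ + θₓ) / 2 - t) - C b₀ * (p₀ + C (θ₀ / 2))).natDegree ≤ D - k)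
    (hlead : (q₀ * C ((θ₀ + θₓ) / 2 - t) - C b₀ * (p₀ + C (θ₀ / 2))).coeff (D - k) =
      a * (q₀ * (p₀ + C (t - θₓ / 2))).coeff D) :
    ∃ (c : ℕ → ℂ) (d : ℕ → ℕ → ℂ), CoeffsIn R c d ∧ IsInvLogFamily θ₀ θₓ θinf a k M c d ∧
      (X * (q₀ * C ((θ₀ + θₓ) / 2 - t) - C b₀ * (p₀ + C (θ₀ / 2))) =
        C a * (q₀ * (p₀ + C (t - θₓ / 2))) → k = 1 → ∀ j, 2 ≤ j → c j = 0) := by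
  obtain ⟨p, q, r, b, c, hS, sp, sq, sr, sb, sc, ep, eq, er, eb, ec⟩ := exists_isFormalSol H
  have tm := H.t_mem
  have hdet0 := hS.det_zero (a := θ₀ ^ 2 / 4) (by
    rw [← hdet₀]
    simp only [PowerSeries.coeff_zero_eq_constantCoeff] at ep eq er
    simp [ep, eq, er])
  have hdet1 := hS.det_one (a := θₓ ^ 2 / 4) (by
    rw [← hdet₁]
    simp only [PowerSeries.coeff_zero_eq_constantCoeff] at ep eq er eb ec
    simp [ep, eq, er, eb, ec, constSeries])
  have k1 : (θ₀ + θₓ) / 2 - t ∈ R := sub_mem (half_mem (add_mem hθ₀ hθₓ)) tm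
  have k2 : θ₀ / 2 ∈ R := half_mem hθ₀
  have k3 : t - θₓ / 2 ∈ R := sub_mem tm (half_mem hθₓ)
  have hm0 : (0 : ℤ) ≤ m := by positivity
  have m1 : (1 : ℤ) ≤ m := by exact_mod_cast H.one_le
  have sp2 : Ser R m m (p + constSeries (θ₀ / 2)) := sp.add (Ser.const k2 hm0)
  have sp3 : Ser R m m (p + constSeries (t - θₓ / 2)) := sp.add (Ser.const k3 hm0)
  have sf1 : Ser R m (m + h) (q * constSeries ((θ₀ + θₓ) / 2 - t)) := by
    simpa using sq.mul (Ser.const (M := m) k1 le_rfl)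
  have sf2 := sb.mul sp2
  have sg := sq.mul sp3
  have sf : Ser R m (m + h) (q * constSeries ((θ₀ + θₓ) / 2 - t) -
      b * (p + constSeries (θ₀ / 2))) := sf1.sub (sf2.mono le_rfl (by omega))
  set f := q * constSeries ((θ₀ + θₓ) / 2 - t) - b * (p + constSeries (θ₀ / 2)) with hf
  set g := q * (p + constSeries (t - θₓ / 2)) with hg
  have ef0 : PowerSeries.coeff 0 f =
      q₀ * C ((θ₀ + θₓ) / 2 - t) - C b₀ * (p₀ + C (θ₀ / 2)) := by
    simp only [PowerSeries.coeff_zero_eq_constantCoeff] at ep eq eb ⊢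
    simp [hf, ep, eq, eb, constSeries]
  have eg0 : PowerSeries.coeff 0 g = q₀ * (p₀ + C (t - θₓ / 2)) := by
    simp only [PowerSeries.coeff_zero_eq_constantCoeff] at ep eq ⊢
    simp [hg, ep, eq, constSeries]
  rw [← ef0] at hdeg hlead
  rw [← eg0] at hu hu' hlead
  rw [← ef0, ← eg0]
  refine exists_family_of_quotient (z := fun w => ev p w - θ₀ / 2) hk hkD ha
    (sf.mono hM (by omega)) (sg.mono hM (by omega)) hu hu'
    (fun j hj => coeff_eq_zero_of_natDegree_lt (by omega)) hlead fun Θ hΘ => ?_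
  have hev : ∀ v : ℂ × ℂ, (Summable fun n => ‖evTerm p v n‖) →
      (Summable fun n => ‖evTerm q v n‖) → (Summable fun n => ‖evTerm b v n‖) →
      ev f v = ev q v * ((θ₀ + θₓ) / 2 - t) - ev b v * (ev p v + θ₀ / 2) ∧
      ev g v = ev q v * (ev p v + (t - θₓ / 2)) := by
    intro v vp vq vb
    have c1 := summable_evTerm_const (θ₀ / 2) v
    have c2 := summable_evTerm_const (t - θₓ / 2) v
    have c3 := summable_evTerm_const ((θ₀ + θₓ) / 2 - t) v
    have c4 := summable_evTerm_add vp c1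
    have c5 := summable_evTerm_add vp c2
    rw [hf, hg, ev_sub (summable_evTerm_mul vq c3) (summable_evTerm_mul vb c4), ev_mul vq c3,
      ev_mul vb c4, ev_mul vq c5, ev_add vp c1, ev_add vp c2]
    simp
  filter_upwards [sp.summable hΘ, sq.summable hΘ, sr.summable hΘ, sb.summable hΘ, sc.summable hΘ,
    sp.hasDerivAt hΘ, sq.hasDerivAt hΘ, sb.hasDerivAt hΘ, sf.summable hΘ, sg.summable hΘ,
    eventually_mem_nhds_nearZero (sp.summable hΘ), eventually_mem_nhds_nearZero (sq.summable hΘ),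
    eventually_mem_nhds_nearZero (sb.summable hΘ)]
    with w vp vq vr vb vc dp dq db vf vg np nq nb hg0 hf0 hgf0
  obtain ⟨ef, eg⟩ := hev w vp vq vb
  have vt := summable_evTerm_const t w
  have v2 : Summable fun n => ‖evTerm 2 w n‖ := summable_evTerm_const 2 w
  have e2 : ev 2 w = 2 := ev_constSeries 2 w
  rw [hS.euler_p, ev_sub (summable_evTerm_mul vb vr) (summable_evTerm_mul vc vq), ev_mul vb vr,
    ev_mul vc vq] at dp
  have v3 := summable_evTerm_mul (summable_evTerm_mul v2 vt) vq
  have v4 := summable_evTerm_mul (summable_evTerm_mul v2 vb) vp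
  rw [hS.euler_q, sub_eq_add_neg, ← neg_add, ev_neg, ev_add v3 v4,
    ev_mul (summable_evTerm_mul v2 vt) vq, ev_mul (summable_evTerm_mul v2 vb) vp, ev_mul v2 vt,
    ev_mul v2 vb, e2, ev_constSeries, neg_add, ← sub_eq_add_neg] at dq
  rw [hS.euler_b, ev_X_mul (summable_evTerm_sub vb vq), ev_sub vb vq] at db
  have i0 := congrArg (fun F => ev F w) hdet0
  rw [ev_add (summable_evTerm_mul vp vp) (summable_evTerm_mul vq vr), ev_mul vp vp, ev_mul vq vr,
    ev_constSeries] at i0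
  have i1 := congrArg (fun F => ev F w) hdet1
  have v5 := summable_evTerm_add vp vt
  have v6 := summable_evTerm_sub vb vq
  have v7 := summable_evTerm_sub vc vr
  rw [ev_add (summable_evTerm_mul v5 v5) (summable_evTerm_mul v6 v7), ev_mul v5 v5, ev_mul v6 v7,
    ev_add vp vt, ev_sub vb vq, ev_sub vc vr, ev_constSeries, ev_constSeries] at i1
  rw [ev_add vg vf, ef, eg] at hgf0
  -- The sum g + f factors, so y ≠ 0 supplies b ≠ q and p ≠ -θ₀/2, while g ≠ 0 supplies the other
  -- two nonvanishing conditions.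
  have hgf1 : ev q w * (ev p w + (t - θₓ / 2)) + (ev q w * ((θ₀ + θₓ) / 2 - t) -
      ev b w * (ev p w + θ₀ / 2)) = -((ev b w - ev q w) * (ev p w + θ₀ / 2)) := by ring
  rw [hgf1] at hgf0
  have hgf2 := mul_ne_zero_iff.1 (neg_ne_zero.1 hgf0)
  have hg1 := hg0
  rw [eg] at hg1
  have hg2 := mul_ne_zero_iff.1 hg1
  have hcont : Tendsto (fun ξ : ℂ => ((w.1, ξ) : ℂ × ℂ)) (𝓝 w.2) (𝓝 w) :=
    (Continuous.prodMk_right w.1).tendsto' _ _ rfl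
  have dy := hasDerivAt_y (P := fun ξ => ev p (w.1, ξ)) (Q := fun ξ => ev q (w.1, ξ))
    (B := fun ξ => ev b (w.1, ξ)) (C := fun ξ => ev c (w.1, ξ)) (R := fun ξ => ev r (w.1, ξ))
    (ξ := w.2) (θ₀ := θ₀) (θₓ := θₓ) ht dp dq db i0 i1 hg2.1 hg2.2 hgf2.1 fun _ => rfl
  have hy : 1 + ev f w / ev g w = -((ev b w - ev q w) * (ev p w + θ₀ / 2)) /
      (ev q w * (ev p w + (t - θₓ / 2))) := by
    rw [one_add_div hg0, ← hgf1, ef, eg]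
  constructor
  · have hyw : 1 + ev f w / ev g w = 1 + (ev q w * ((θ₀ + θₓ) / 2 - t) -
        ev b w * (ev p w + θ₀ / 2)) / (ev q w * (ev p w + (t - θₓ / 2))) := by rw [ef, eg]
    rw [hyw]
    refine dy.congr_of_eventuallyEq ?_
    filter_upwards [hcont.eventually np, hcont.eventually nq, hcont.eventually nb] with ξ a1 a2 a3
    rw [(hev _ a1 a2 a3).1, (hev _ a1 a2 a3).2]
  · rw [rhsZ_eq ht i0 i1 hg2.1 hg2.2 hgf2.1 hgf2.2 hy]
    exact dp.sub_const _

end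

section

/-! ### The Riccati family -/

variable {θ₀ θₓ θinf : ℂ} {R : Subalgebra ℚ ℂ}

/-- The family of solutions of Riccati type for `θ_∞ = 0`, `θ₀ = -θₓ`. -/
theorem exists_family_of_riccati (hinf : θinf = 0) (hx : θ₀ = -θₓ) (hθ₀ : θ₀ ≠ 0) (hR : θ₀ ∈ R)
    (hR' : θ₀⁻¹ ∈ R) : ∃ (c : ℕ → ℂ) (d : ℕ → ℕ → ℂ), CoeffsIn R c d ∧
      IsInvLogFamily θ₀ θₓ θinf (1 / θ₀) 1 1 c d := by
  have H : LeadingTerm R 1 0 0 0 1 (C (θ₀ / 2), 0, C θ₀ * X) := by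
    refine ⟨le_rfl, by simp, by simp, zero_mem R, by simpa using Adm.zero,
      by simpa using Adm.C (one_mem R) le_rfl, ⟨Adm.C (half_mem hR) (by simp), Adm.zero,
        Adm.C_mul hR (Adm.X (by simp))⟩, ?_⟩
    have h2 : C θ₀ = 2 * C (θ₀ / 2) := by
      rw [show (2 : ℂ[X]) = C 2 from rfl, ← C_mul]; congr 1; ring
    simp [shift₃, adConst, ← h2]
  obtain ⟨p, q, r, b, c, hS, sp, sq, sr, sb, sc, ep, eq, er, eb, ec⟩ := exists_isFormalSol H
  -- Triangularity of the leading term propagates: b at order n + 1 depends on b and q at order n,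
  -- and then q at order n + 1 on b up to that order.
  have hbq : ∀ n, ∀ k ≤ n, PowerSeries.coeff k b = 0 ∧ PowerSeries.coeff k q = 0 := by
    intro n
    induction n with
    | zero =>
      intro k hk
      obtain rfl := Nat.le_zero.1 hk
      exact ⟨by rw [eb, C_0], eq⟩
    | succ n ih =>
      intro k hk
      rcases hk.lt_or_eq with hk | rfl
      · exact ih k (Nat.lt_succ_iff.1 hk)
      have h1 : PowerSeries.coeff (n + 1) b = 0 := by
        refine eq_zero_of_shift_eq_zero n.succ_ne_zero ?_
        rw [← coeff_euler, hS.euler_b, PowerSeries.coeff_succ_X_mul, map_sub, (ih n le_rfl).1,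
          (ih n le_rfl).2, sub_zero]
      refine ⟨h1, eq_zero_of_shift_eq_zero n.succ_ne_zero ?_⟩
      have h0 : constSeries 0 = 0 := by simp [constSeries]
      rw [← coeff_euler, hS.euler_q, h0, mul_zero, zero_mul, neg_zero, zero_sub, mul_assoc,
        two_mul, map_neg, map_add, PowerSeries.coeff_mul, sum_eq_zero, add_zero, neg_zero]
      intro x hx
      have hx := HasAntidiagonal.mem_antidiagonal.1 hx
      rcases Nat.lt_or_ge x.1 (n + 1) with hx1 | hx1
      · rw [(ih x.1 (Nat.lt_succ_iff.1 hx1)).1, zero_mul]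
      · rw [show x.1 = n + 1 by omega, h1, zero_mul]
  have hb : b = 0 := PowerSeries.ext fun n => (hbq n n le_rfl).1
  have hq : q = 0 := PowerSeries.ext fun n => (hbq n n le_rfl).2
  have hp : p = constSeries (θ₀ / 2) := by
    refine eq_constSeries_of_euler_eq_zero ?_ ep
    rw [hS.euler_p, hb, hq]
    ring
  have hr : euler r = constSeries θ₀ * c := by
    have h2 : constSeries θ₀ = 2 * constSeries (θ₀ / 2) := by
      rw [show (2 : PowerSeries ℂ[X]) = constSeries 2 from rfl, constSeries, constSeries,
        constSeries, ← map_mul, ← C_mul]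
      congr 2; ring
    have h0 : constSeries 0 = 0 := by simp [constSeries]
    rw [hS.euler_r, hp, h2, h0]
    ring
  have sr' : Ser R 1 (1 : ℕ) r := sr.mono le_rfl (by simp)
  have sc' : Ser R 1 (1 : ℕ) c := sc.mono le_rfl (by simp)
  have eg : PowerSeries.coeff 0 (r - c) = C θ₀ * X - 1 := by rw [map_sub, er, ec, C_1]
  have eg1 : (PowerSeries.coeff 0 (r - c)).coeff 1 = θ₀ := by
    rw [eg]; simp [coeff_one]
  -- The remaining linear system is x r' = θ₀ c, x c' = x (r - c), and y = 1 + c/(r - c) solves the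
  -- Riccati equation left at z = 0. The line z = 0 is invariant because θ₀ + θₓ + θ_∞ = 0.
  obtain ⟨c', d', h1, h2, -⟩ := exists_family_of_quotient (θ₀ := θ₀) (θₓ := θₓ) (θinf := θinf)
    (z := fun _ => 0) (a := 1 / θ₀) le_rfl le_rfl (one_div_ne_zero hθ₀) sc' (sr'.sub sc')
    (by rwa [eg1]) (by rwa [eg1])
    (fun j hj => by obtain rfl : j = 0 := by omega
                    rw [ec]; simp [coeff_one])
    (by rw [ec, eg1, one_div_mul_cancel hθ₀]; simp) fun Θ hΘ => by
      filter_upwards [sr.summable hΘ, sc.summable hΘ, sr.hasDerivAt hΘ, sc.hasDerivAt hΘ,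
        eventually_mem_nhds_nearZero (sr.summable hΘ), eventually_mem_nhds_nearZero
        (sc.summable hΘ)] with w vr vc dr dc nr nc hg0 hf0 hgf0
      rw [hr, ev_mul (summable_evTerm_const θ₀ w) vc, ev_constSeries] at dr
      rw [hS.euler_c, ev_X_mul (summable_evTerm_sub vr vc), ev_sub vr vc] at dc
      rw [ev_sub vr vc] at hg0
      rw [sub_add_cancel] at hgf0
      have hcont : Tendsto (fun ξ : ℂ => ((w.1, ξ) : ℂ × ℂ)) (𝓝 w.2) (𝓝 w) :=
        (Continuous.prodMk_right w.1).tendsto' _ _ rfl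
      have dy := (dc.fun_div (dr.fun_sub dc) hg0).const_add 1
      rw [ev_sub vr vc]
      obtain rfl : θₓ = -θ₀ := by rw [hx, neg_neg]
      constructor
      · have dy' := dy.congr_of_eventuallyEq
          (f₁ := fun ξ => 1 + ev c (w.1, ξ) / ev (r - c) (w.1, ξ)) (by
            filter_upwards [hcont.eventually nr, hcont.eventually nc] with ξ a1 a2
            rw [ev_sub a1 a2])
        refine dy'.congr_deriv ?_
        simp only [rhsY, hinf]
        generalize ev c w = A at *
        generalize ev r w = B at *
        field_simp
        ring
      · refine (hasDerivAt_const w.2 (0 : ℂ)).congr_deriv ?_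
        simp [rhsZ, hinf]
  exact ⟨c', d', h1, h2⟩

end

section

/-! ### Quadratic polynomials -/

/-- The polynomial `a + b X + c X ^ 2`. -/
noncomputable def quad (a b c : ℂ) : ℂ[X] := C a + C b * X + C c * X ^ 2

theorem eval_quad (a b c z : ℂ) : (quad a b c).eval z = a + b * z + c * z ^ 2 := by
  simp [quad]

theorem derivative_quad (a b c : ℂ) : derivative (quad a b c) = quad b (2 * c) 0 := by
  refine Polynomial.funext fun z => ?_
  rw [quad, derivative_add, derivative_add, derivative_C_mul, derivative_C_mul, eval_quad]
  simp
  ring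

theorem quad_add_C (a b c k : ℂ) : quad a b c + C k = quad (a + k) b c := by
  simp only [quad, C_add]; ring

theorem quad_mul_C (a b c k : ℂ) : quad a b c * C k = quad (a * k) (b * k) (c * k) := by
  simp only [quad, C_mul]; ring

theorem C_mul_quad (a b c k : ℂ) : C k * quad a b c = quad (k * a) (k * b) (k * c) := by
  simp only [quad, C_mul]; ring

theorem quad_sub_quad (a b c a' b' c' : ℂ) :
    quad a b c - quad a' b' c' = quad (a - a') (b - b') (c - c') := by
  simp only [quad, C_sub]; ring

theorem coeff_quad (a b c : ℂ) (n : ℕ) :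
    (quad a b c).coeff n = if n = 0 then a else if n = 1 then b else if n = 2 then c else 0 := by
  simp only [quad, coeff_add, coeff_C_mul, coeff_X_pow, coeff_X, coeff_C]
  rcases n with _ | _ | _ | n <;> simp

theorem natDegree_quad_le (a b c : ℂ) : (quad a b c).natDegree ≤ 2 :=
  natDegree_le_iff_coeff_eq_zero.2 fun n hn => by
    rw [coeff_quad, if_neg (by omega), if_neg (by omega), if_neg (by omega)]

theorem natDegree_quad_le_one {a b c : ℂ} (hc : c = 0) : (quad a b c).natDegree ≤ 1 :=
  natDegree_le_iff_coeff_eq_zero.2 fun n hn => by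
    rw [coeff_quad, if_neg (by omega), if_neg (by omega)]
    simp [hc]

theorem natDegree_quad_le_zero {a b c : ℂ} (hb : b = 0) (hc : c = 0) :
    (quad a b c).natDegree ≤ 0 :=
  natDegree_le_iff_coeff_eq_zero.2 fun n hn => by
    rw [coeff_quad, if_neg (by omega)]
    simp [hb, hc]

theorem coeff_one_quad_mul (a b c a' b' c' : ℂ) :
    (quad a b c * quad a' b' c').coeff 1 = a * b' + b * a' := by
  simp [coeff_mul, Finset.Nat.antidiagonal_succ, coeff_quad]

theorem coeff_two_quad_mul (a b c a' b' c' : ℂ) :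
    (quad a b c * quad a' b' c').coeff 2 = a * c' + b * b' + c * a' := by
  simp [coeff_mul, Finset.Nat.antidiagonal_succ, coeff_quad]; ring

theorem coeff_three_quad_mul (a b c a' b' c' : ℂ) :
    (quad a b c * quad a' b' c').coeff 3 = b * c' + c * b' := by
  simp [coeff_mul, Finset.Nat.antidiagonal_succ, coeff_quad]

theorem coeff_four_quad_mul (a b c a' b' c' : ℂ) :
    (quad a b c * quad a' b' c').coeff 4 = c * c' := by
  simp [coeff_mul, Finset.Nat.antidiagonal_succ, coeff_quad]

variable {θ₀ θₓ θinf : ℂ} {R : Subalgebra ℚ ℂ}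

theorem adm_quad_two {e : ℤ} {a b c : ℂ} (ha : a ∈ R) (hb : b ∈ R) (hc : c ∈ R) (he : 2 ≤ e) :
    Adm R e (quad a b c) := adm_quad ha hb hc he

theorem adm_quad_one {e : ℤ} {a b : ℂ} (ha : a ∈ R) (hb : b ∈ R) (he : 1 ≤ e) :
    Adm R e (quad a b 0) := by
  simpa [quad] using adm_lin ha hb he

theorem adm_quad_zero {e : ℤ} {a : ℂ} (ha : a ∈ R) (he : 0 ≤ e) :
    Adm R e (quad a 0 0) := by
  simpa [quad] using Adm.C ha he

theorem shift₃_zero_quad (a b c a' b' c' a'' b'' c'' : ℂ) :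
    shift₃ 0 (quad a b c, quad a' b' c', quad a'' b'' c'') =
      (quad b (2 * c) 0, quad b' (2 * c') 0, quad b'' (2 * c'') 0) := by
  simp [shift₃, derivative_quad]

/-! ### Leading terms -/

/-- Leading terms quadratic in the logarithm, for a nilpotent matrix with all entries nonzero. -/
theorem leadingTerm_quadratic {t p q : ℂ} (ht : t ∈ R) (hp : p ∈ R) (hq : q ∈ R) :
    LeadingTerm R 2 0 t t (-t)
      (quad p 0 (-(2 * t ^ 2 * (p + q))),
        quad q (-(2 * t * (p + q))) (2 * t ^ 2 * (p + q)),
        quad (-q) (-(2 * t * (p + q))) (-(2 * t ^ 2 * (p + q)))) := by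
  have hs : p + q ∈ R := add_mem hp hq
  have h2 : (2 : ℂ) ∈ R := ofNat_mem R 2
  have h3 : 2 * t ^ 2 * (p + q) ∈ R := mul_mem (mul_mem h2 (pow_mem ht 2)) hs
  have h4 : 2 * t * (p + q) ∈ R := mul_mem (mul_mem h2 ht) hs
  refine ⟨by norm_num, by simp, by ring, ht, Adm.C ht le_rfl, Adm.C (neg_mem ht) (by simp),
    ⟨adm_quad_two hp (zero_mem R) (neg_mem h3) (by simp), adm_quad_two hq (neg_mem h4) h3 (by simp),
      adm_quad_two (neg_mem hq) (neg_mem h4) (neg_mem h3) (by simp)⟩, ?_⟩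
  rw [shift₃_zero_quad]
  refine Prod.ext ?_ (Prod.ext ?_ ?_) <;> refine Polynomial.funext fun z => ?_ <;>
    simp [adConst, eval_quad] <;> ring

/-- Leading terms linear in the logarithm, for a nilpotent matrix with all entries nonzero. -/
theorem leadingTerm_linear {t η l : ℂ} (ht : t ∈ R) (hη : η ∈ R) (hl : l ∈ R) :
    LeadingTerm R 1 0 t t (-t)
      (quad l (2 * t * η) 0, quad (η - l) (-(2 * t * η)) 0, quad (η + l) (2 * t * η) 0) := by
  have h2 : (2 : ℂ) ∈ R := ofNat_mem R 2
  have h3 : 2 * t * η ∈ R := mul_mem (mul_mem h2 ht) hη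
  refine ⟨le_rfl, by simp, by ring, ht, Adm.C ht le_rfl, Adm.C (neg_mem ht) (by simp),
    ⟨adm_quad_one hl h3 (by simp), adm_quad_one (sub_mem hη hl) (neg_mem h3) (by simp),
      adm_quad_one (add_mem hη hl) h3 (by simp)⟩, ?_⟩
  rw [shift₃_zero_quad]
  refine Prod.ext ?_ (Prod.ext ?_ ?_) <;> refine Polynomial.funext fun z => ?_ <;>
    simp [adConst, eval_quad] <;> ring

/-- Conjugation by exp (L N₀) with N₀ strictly upper triangular: the entries have degrees 1, 2, 0 in
L, hence the weight h = 1. -/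
theorem leadingTerm_upper {κ g : ℂ} (hκ : κ ∈ R) (hg : g ∈ R) :
    LeadingTerm R 1 1 0 1 0 (quad 0 κ 0, quad g 0 (-κ), quad κ 0 0) := by
  refine ⟨le_rfl, by simp, by ring, zero_mem R, Adm.C (one_mem R) (by simp), by
    simpa using Adm.zero, ⟨adm_quad_one (zero_mem R) hκ (by simp),
      adm_quad_two hg (zero_mem R) (neg_mem hκ) (by simp), adm_quad_zero hκ (by simp)⟩, ?_⟩
  rw [shift₃_zero_quad]
  refine Prod.ext ?_ (Prod.ext ?_ ?_) <;> refine Polynomial.funext fun z => ?_ <;>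
    (simp [adConst, eval_quad]; try ring)

theorem leadingTerm_lower {κ g : ℂ} (hκ : κ ∈ R) (hg : g ∈ R) :
    LeadingTerm R 1 (-1) 0 0 1 (quad 0 (-κ) 0, quad κ 0 0, quad g 0 (-κ)) := by
  refine ⟨le_rfl, by simp, by ring, zero_mem R, by simpa using Adm.zero,
    Adm.C (one_mem R) (by simp), ⟨adm_quad_one (zero_mem R) (neg_mem hκ) (by simp),
      adm_quad_zero hκ (by simp), adm_quad_two hg (zero_mem R) (neg_mem hκ) (by simp)⟩, ?_⟩
  rw [shift₃_zero_quad]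
  refine Prod.ext ?_ (Prod.ext ?_ ?_) <;> refine Polynomial.funext fun z => ?_ <;>
    (simp [adConst, eval_quad]; try ring)

theorem ratCast_mul_mem (c : ℚ) {a : ℂ} (ha : a ∈ R) : (c : ℂ) * a ∈ R :=
  mul_mem (R.algebraMap_mem c) ha

/-! ### The families -/

/-- With s = p + q and v = p - q for the constant terms, the determinant conditions read s v = θ₀²/4
and s v + θ_∞ s = θₓ²/4, which determine s and v. -/
theorem exists_family_quadratic (hinf : θinf ≠ 0) (hΔ : θ₀ ^ 2 - θₓ ^ 2 ≠ 0) (m₀ : θ₀ ∈ R)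
    (mₓ : θₓ ∈ R) (mi : θinf ∈ R) (mi' : θinf⁻¹ ∈ R) (mΔ : (θ₀ ^ 2 - θₓ ^ 2)⁻¹ ∈ R) :
    ∃ (c : ℕ → ℂ) (d : ℕ → ℕ → ℂ), CoeffsIn R c d ∧
      IsInvLogFamily θ₀ θₓ θinf (4 / (θinf * (θ₀ - θₓ))) 2 2 c d := by
  set Δ := θ₀ ^ 2 - θₓ ^ 2 with hΔdef
  set s := -(Δ * θinf⁻¹) / 2 / 2 with hs
  set v := -(θinf * θ₀ ^ 2 * Δ⁻¹) with hv
  have mΔ' : Δ ∈ R := sub_mem (pow_mem m₀ 2) (pow_mem mₓ 2)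
  have ms : s ∈ R := half_mem (half_mem (neg_mem (mul_mem mΔ' mi')))
  have mv : v ∈ R := neg_mem (mul_mem (mul_mem mi (pow_mem m₀ 2)) mΔ)
  have H := leadingTerm_quadratic (R := R) (t := θinf / 2) (p := (s + v) / 2) (q := (s - v) / 2)
    (half_mem mi) (half_mem (add_mem ms mv)) (half_mem (sub_mem ms mv))
  have hpq : (s + v) / 2 + (s - v) / 2 = s := by ring
  rw [hpq] at H
  have h1 : s * v = θ₀ ^ 2 / 4 := by rw [hs, hv]; field_simp; ring
  have h2 : s * θinf = -Δ / 4 := by rw [hs]; field_simp; norm_num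
  have hsub : θ₀ - θₓ ≠ 0 := fun h => hΔ (by rw [hΔdef]; linear_combination (θ₀ + θₓ) * h)
  have hu0 : -(θinf * Δ) ^ 2 / 64 ≠ 0 :=
    div_ne_zero (neg_ne_zero.2 (pow_ne_zero 2 (mul_ne_zero hinf hΔ))) (by norm_num)
  have hu : 2 * (θinf / 2) ^ 2 * s * (-(2 * (θinf / 2) ^ 2 * s)) = -(θinf * Δ) ^ 2 / 64 := by
    linear_combination (-(θinf ^ 2) / 4) * (s * θinf - Δ / 4) * h2
  clear_value v s
  obtain ⟨c, d, h, h', -⟩ := exists_family_of_leadingTerm (M := 2) (D := 4) (k := 2)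
    (a := 4 / (θinf * (θ₀ - θₓ))) H rfl m₀ mₓ
    (Polynomial.funext fun z => by
      simp only [eval_add, eval_mul, eval_C, eval_quad]
      linear_combination h1)
    (Polynomial.funext fun z => by
      simp only [eval_add, eval_sub, eval_mul, eval_C, eval_quad]
      linear_combination h1 + h2)
    le_rfl (by norm_num) (by norm_num) (by norm_num)
    (div_ne_zero (by norm_num) (mul_ne_zero hinf hsub))
    (by rwa [quad_add_C, coeff_four_quad_mul, hu])
    (by
      rw [quad_add_C, coeff_four_quad_mul, hu]
      have h3 := ratCast_mul_mem (R := R) (-64) (pow_mem (mul_mem mi' mΔ) 2)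
      convert h3 using 1
      push_cast
      field_simp)
    (by
      rw [quad_add_C, C_mul_quad, quad_mul_C, quad_sub_quad]
      exact natDegree_quad_le _ _ _)
    (by
      rw [quad_add_C, C_mul_quad, quad_mul_C, quad_sub_quad, quad_add_C, coeff_four_quad_mul, hu,
        coeff_quad]
      norm_num
      field_simp
      linear_combination (64 * (θ₀ - θₓ) * (θ₀ + θₓ)) * h2)
  exact ⟨c, d, h, h'⟩

/-- When θ₀² = θₓ² the quadratic part of the leading term must vanish. What remains is the sign of η
= ±θ₀/2 and the constant l, which amounts to a translation of L. -/
theorem exists_family_linear {η l a : ℂ} {k : ℕ} (hinf : θinf ≠ 0) (hη : η ≠ 0)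
    (h₀ : η ^ 2 = θ₀ ^ 2 / 4) (hx : θₓ ^ 2 = θ₀ ^ 2) (m₀ : θ₀ ∈ R) (mₓ : θₓ ∈ R) (mη : η ∈ R)
    (mη' : η⁻¹ ∈ R) (ml : l ∈ R) (mi : θinf ∈ R) (mi' : θinf⁻¹ ∈ R) (hk : 1 ≤ k) (hk2 : k ≤ 2)
    (ha : a ≠ 0)
    (hdeg : (quad ((η - l) * ((θ₀ + θₓ) / 2 - θinf / 2) - θinf / 2 * (l + θ₀ / 2))
      (-(θinf * η) * ((θ₀ + θₓ) / 2)) 0).natDegree ≤ 2 - k)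
    (hlead : (quad ((η - l) * ((θ₀ + θₓ) / 2 - θinf / 2) - θinf / 2 * (l + θ₀ / 2))
      (-(θinf * η) * ((θ₀ + θₓ) / 2)) 0).coeff (2 - k) = a * (-(θinf * η) ^ 2)) :
    ∃ (c : ℕ → ℂ) (d : ℕ → ℕ → ℂ), CoeffsIn R c d ∧ IsInvLogFamily θ₀ θₓ θinf a k 1 c d ∧
      (X * quad ((η - l) * ((θ₀ + θₓ) / 2 - θinf / 2) - θinf / 2 * (l + θ₀ / 2))
          (-(θinf * η) * ((θ₀ + θₓ) / 2)) 0 =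
        C a * (quad (η - l) (-(θinf * η)) 0 * quad (l + (θinf / 2 - θₓ / 2)) (θinf * η) 0) →
        k = 1 → ∀ j, 2 ≤ j → c j = 0) := by
  have H := leadingTerm_linear (R := R) (t := θinf / 2) (half_mem mi) mη ml
  have ht : 2 * (θinf / 2) * η = θinf * η := by ring
  rw [ht] at H
  have e1 : quad l (θinf * η) 0 + C (θinf / 2 - θₓ / 2) =
      quad (l + (θinf / 2 - θₓ / 2)) (θinf * η) 0 := quad_add_C _ _ _ _
  have e2 : quad (η - l) (-(θinf * η)) 0 * C ((θ₀ + θₓ) / 2 - θinf / 2) -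
      C (θinf / 2) * (quad l (θinf * η) 0 + C (θ₀ / 2)) =
      quad ((η - l) * ((θ₀ + θₓ) / 2 - θinf / 2) - θinf / 2 * (l + θ₀ / 2))
      (-(θinf * η) * ((θ₀ + θₓ) / 2)) 0 := by
    rw [quad_add_C, C_mul_quad, quad_mul_C, quad_sub_quad]
    congr 1 <;> ring
  have hu : (quad (η - l) (-(θinf * η)) 0 * quad (l + (θinf / 2 - θₓ / 2)) (θinf * η) 0).coeff 2 =
      -(θinf * η) ^ 2 := by
    rw [coeff_two_quad_mul]; ring
  have key := exists_family_of_leadingTerm (M := 1) (D := 2) (k := k) (a := a) H rfl m₀ mₓ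
    (Polynomial.funext fun z => by
      simp only [eval_add, eval_mul, eval_C, eval_quad]
      linear_combination h₀)
    (Polynomial.funext fun z => by
      simp only [eval_add, eval_sub, eval_mul, eval_C, eval_quad]
      linear_combination h₀ - hx / 4)
    le_rfl (by norm_num) hk hk2 ha
  rw [e1, e2, hu] at key
  refine key (neg_ne_zero.2 (pow_ne_zero 2 (mul_ne_zero hinf hη))) ?_ hdeg hlead
  have h3 := neg_mem (pow_mem (mul_mem mi' mη') 2)
  convert h3 using 1
  rw [inv_neg, mul_pow, mul_inv, mul_pow, inv_pow, inv_pow]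

/-- The determinants impose κ g = θ₀²/4 and κ (g - 1) = θₓ²/4, so κ = (θ₀² - θₓ²)/4. The strictly
upper and strictly lower triangular choices of N₀ yield the two signs of a. -/
theorem exists_family_upper (hinf : θinf = 0) (hΔ : θ₀ ^ 2 - θₓ ^ 2 ≠ 0) (m₀ : θ₀ ∈ R)
    (mₓ : θₓ ∈ R) (mΔ : (θ₀ ^ 2 - θₓ ^ 2)⁻¹ ∈ R) :
    ∃ (c : ℕ → ℂ) (d : ℕ → ℕ → ℂ), CoeffsIn R c d ∧
      IsInvLogFamily θ₀ θₓ θinf (2 / (θ₀ - θₓ)) 1 2 c d := by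
  set Δ := θ₀ ^ 2 - θₓ ^ 2 with hΔdef
  have mΔ' : Δ ∈ R := sub_mem (pow_mem m₀ 2) (pow_mem mₓ 2)
  have H := leadingTerm_upper (R := R) (κ := Δ / 2 / 2) (g := θ₀ ^ 2 * Δ⁻¹)
    (half_mem (half_mem mΔ')) (mul_mem (pow_mem m₀ 2) mΔ)
  have hsub : θ₀ - θₓ ≠ 0 := fun h => hΔ (by rw [hΔdef]; linear_combination (θ₀ + θₓ) * h)
  have h1 : θ₀ ^ 2 * Δ⁻¹ * (Δ / 2 / 2) = θ₀ ^ 2 / 4 := by field_simp; norm_num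
  have hu0 : -(Δ ^ 2) / 16 ≠ 0 := div_ne_zero (neg_ne_zero.2 (pow_ne_zero 2 hΔ)) (by norm_num)
  have hu : (quad (θ₀ ^ 2 * Δ⁻¹) 0 (-(Δ / 2 / 2)) * (quad 0 (Δ / 2 / 2) 0 + C (0 - θₓ / 2))).coeff 3
      = -(Δ ^ 2) / 16 := by
    rw [quad_add_C, coeff_three_quad_mul]; ring
  obtain ⟨c, d, h, h', -⟩ := exists_family_of_leadingTerm (θinf := θinf) (M := 2) (D := 3) (k := 1)
    (a := 2 / (θ₀ - θₓ)) H (by rw [hinf, zero_div]) m₀ mₓ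
    (Polynomial.funext fun z => by
      simp only [eval_add, eval_mul, eval_C, eval_quad]
      linear_combination h1)
    (Polynomial.funext fun z => by
      simp only [eval_add, eval_sub, eval_mul, eval_C, eval_quad]
      linear_combination h1 - hΔdef / 4)
    (by norm_num) (by norm_num) (by norm_num) (by norm_num)
    (div_ne_zero (by norm_num) hsub) (by rwa [hu])
    (by
      rw [hu]
      have h3 := ratCast_mul_mem (R := R) (-16) (pow_mem mΔ 2)
      convert h3 using 1
      push_cast
      field_simp)
    (by
      rw [quad_add_C, C_mul_quad, quad_mul_C, quad_sub_quad]
      exact natDegree_quad_le _ _ _)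
    (by
      rw [hu, quad_add_C, C_mul_quad, quad_mul_C, quad_sub_quad, coeff_quad]
      norm_num
      field_simp
      rw [hΔdef]
      ring)
  exact ⟨c, d, h, h'⟩

theorem exists_family_lower (hinf : θinf = 0) (hΔ : θ₀ ^ 2 - θₓ ^ 2 ≠ 0) (m₀ : θ₀ ∈ R)
    (mₓ : θₓ ∈ R) (mΔ : (θ₀ ^ 2 - θₓ ^ 2)⁻¹ ∈ R) :
    ∃ (c : ℕ → ℂ) (d : ℕ → ℕ → ℂ), CoeffsIn R c d ∧
      IsInvLogFamily θ₀ θₓ θinf (-(2 / (θ₀ - θₓ))) 1 2 c d := by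
  set Δ := θ₀ ^ 2 - θₓ ^ 2 with hΔdef
  have mΔ' : Δ ∈ R := sub_mem (pow_mem m₀ 2) (pow_mem mₓ 2)
  have H := leadingTerm_lower (R := R) (κ := Δ / 2 / 2) (g := θ₀ ^ 2 * Δ⁻¹)
    (half_mem (half_mem mΔ')) (mul_mem (pow_mem m₀ 2) mΔ)
  have hsub : θ₀ - θₓ ≠ 0 := fun h => hΔ (by rw [hΔdef]; linear_combination (θ₀ + θₓ) * h)
  have h1 : θ₀ ^ 2 * Δ⁻¹ * (Δ / 2 / 2) = θ₀ ^ 2 / 4 := by field_simp; norm_num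
  have hu0 : -(Δ ^ 2) / 16 ≠ 0 := div_ne_zero (neg_ne_zero.2 (pow_ne_zero 2 hΔ)) (by norm_num)
  have hu : (quad (Δ / 2 / 2) 0 0 * (quad 0 (-(Δ / 2 / 2)) 0 + C (0 - θₓ / 2))).coeff 1
      = -(Δ ^ 2) / 16 := by
    rw [quad_add_C, coeff_one_quad_mul]; ring
  obtain ⟨c, d, h, h', -⟩ := exists_family_of_leadingTerm (θinf := θinf) (M := 2) (D := 1) (k := 1)
    (a := -(2 / (θ₀ - θₓ))) H (by rw [hinf, zero_div]) m₀ mₓ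
    (Polynomial.funext fun z => by
      simp only [eval_add, eval_mul, eval_C, eval_quad]
      linear_combination h1)
    (Polynomial.funext fun z => by
      simp only [eval_add, eval_sub, eval_mul, eval_C, eval_quad]
      linear_combination h1 - hΔdef / 4)
    (by norm_num) (by norm_num) (by norm_num) (by norm_num)
    (neg_ne_zero.2 (div_ne_zero (by norm_num) hsub)) (by rwa [hu])
    (by
      rw [hu]
      have h3 := ratCast_mul_mem (R := R) (-16) (pow_mem mΔ 2)
      convert h3 using 1
      push_cast
      field_simp)
    (by
      rw [quad_add_C, C_mul_quad, quad_mul_C, quad_sub_quad]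
      exact natDegree_quad_le_zero (by ring) (by ring))
    (by
      rw [hu, quad_add_C, C_mul_quad, quad_mul_C, quad_sub_quad, coeff_quad]
      norm_num
      field_simp
      rw [hΔdef]
      ring)
  exact ⟨c, d, h, h'⟩

end

end PainleveV

/-! ### The cases of the theorem -/

theorem mainTheorem4 (θ₀ θₓ θinf : ℂ) :
    -- (1)
    (θinf ≠ 0 → θ₀ ^ 2 - θₓ ^ 2 ≠ 0 →
      ∃ (c : ℕ → ℂ) (d : ℕ → ℕ → ℂ),
        PainleveV.CoeffsIn
          (Algebra.adjoin ℚ {θ₀, θₓ, θinf, θinf⁻¹, (θ₀ ^ 2 - θₓ ^ 2)⁻¹}) c d ∧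
        PainleveV.IsInvLogFamily θ₀ θₓ θinf (4 / (θinf * (θ₀ - θₓ))) 2 2 c d) ∧
    -- (2)(i)
    (θinf ≠ 0 → θ₀ = θₓ → θ₀ ≠ 0 →
      (∃ (c : ℕ → ℂ) (d : ℕ → ℕ → ℂ),
        PainleveV.CoeffsIn (Algebra.adjoin ℚ {θ₀, θ₀⁻¹, θinf, θinf⁻¹}) c d ∧
        (∀ j, 2 ≤ j → c j = 0) ∧
        PainleveV.IsInvLogFamily θ₀ θₓ θinf (-(2 / θinf)) 1 1 c d) ∧
      (∃ (c : ℕ → ℂ) (d : ℕ → ℕ → ℂ),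
        PainleveV.CoeffsIn (Algebra.adjoin ℚ {θ₀, θ₀⁻¹, θinf, θinf⁻¹}) c d ∧
        PainleveV.IsInvLogFamily θ₀ θₓ θinf (2 / θinf) 1 1 c d)) ∧
    -- (2)(ii)
    (θinf ≠ 0 → θ₀ = -θₓ → θ₀ ≠ 0 →
      ∃ (c : ℕ → ℂ) (d : ℕ → ℕ → ℂ),
        PainleveV.CoeffsIn (Algebra.adjoin ℚ {θ₀, θ₀⁻¹, θinf, θinf⁻¹}) c d ∧
        PainleveV.IsInvLogFamily θ₀ θₓ θinf (2 / (θ₀ * θinf)) 2 1 c d) ∧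
    -- (3)(i)
    (θinf = 0 → θ₀ ^ 2 - θₓ ^ 2 ≠ 0 →
      (∃ (c : ℕ → ℂ) (d : ℕ → ℕ → ℂ),
        PainleveV.CoeffsIn (Algebra.adjoin ℚ {θ₀, θₓ, (θ₀ ^ 2 - θₓ ^ 2)⁻¹}) c d ∧
        PainleveV.IsInvLogFamily θ₀ θₓ θinf (2 / (θ₀ - θₓ)) 1 2 c d) ∧
      (∃ (c : ℕ → ℂ) (d : ℕ → ℕ → ℂ),
        PainleveV.CoeffsIn (Algebra.adjoin ℚ {θ₀, θₓ, (θ₀ ^ 2 - θₓ ^ 2)⁻¹}) c d ∧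
        PainleveV.IsInvLogFamily θ₀ θₓ θinf (-(2 / (θ₀ - θₓ))) 1 2 c d)) ∧
    -- (3)(ii)
    (θinf = 0 → θ₀ = -θₓ → θ₀ ≠ 0 →
      ∃ (c : ℕ → ℂ) (d : ℕ → ℕ → ℂ),
        PainleveV.CoeffsIn (Algebra.adjoin ℚ {θ₀, θ₀⁻¹}) c d ∧
        PainleveV.IsInvLogFamily θ₀ θₓ θinf (1 / θ₀) 1 1 c d) := by
  have sub : ∀ {S : Set ℂ} {z : ℂ}, z ∈ S → z ∈ Algebra.adjoin ℚ S :=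
    fun h => Algebra.subset_adjoin h
  refine ⟨fun hinf hΔ => ?_, fun hinf hx h0 => ?_, fun hinf hx h0 => ?_, fun hinf hΔ => ?_,
    fun hinf hx h0 => ?_⟩
  · exact PainleveV.exists_family_quadratic hinf hΔ (sub (by simp)) (sub (by simp)) (sub (by simp))
      (sub (by simp)) (sub (by simp))
  · subst hx
    have m0 : θ₀ ∈ Algebra.adjoin ℚ {θ₀, θ₀⁻¹, θinf, θinf⁻¹} := sub (by simp)
    have m0' : θ₀⁻¹ ∈ Algebra.adjoin ℚ {θ₀, θ₀⁻¹, θinf, θinf⁻¹} := sub (by simp)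
    have mi : θinf ∈ Algebra.adjoin ℚ {θ₀, θ₀⁻¹, θinf, θinf⁻¹} := sub (by simp)
    have mi' : θinf⁻¹ ∈ Algebra.adjoin ℚ {θ₀, θ₀⁻¹, θinf, θinf⁻¹} := sub (by simp)
    have mh' : (θ₀ / 2)⁻¹ ∈ Algebra.adjoin ℚ {θ₀, θ₀⁻¹, θinf, θinf⁻¹} := by
      rw [inv_div, div_eq_mul_inv]
      exact mul_mem (ofNat_mem _ 2) m0'
    constructor
    -- With η = -θ₀/2 the leading parts satisfy q₀ = -(p₀ + θ₀/2), so the numerator is θ₀ q₀ and q₀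
    -- cancels. This l makes the other factor of the denominator a pure multiple of L, so all c_j
    -- with j ≥ 2 vanish.
    · obtain ⟨c, d, h1, h2, h3⟩ := PainleveV.exists_family_linear (θ₀ := θ₀) (θₓ := θ₀)
        (θinf := θinf) (η := -(θ₀ / 2)) (l := (θ₀ - θinf) / 2) (a := -(2 / θinf)) (k := 1) hinf
        (by simpa using h0) (by ring) rfl m0 m0 (neg_mem (PainleveV.half_mem m0))
        (by rw [inv_neg]; exact neg_mem mh') (PainleveV.half_mem (sub_mem m0 mi)) mi mi' le_rfl
        (by norm_num) (by simpa using hinf) (PainleveV.natDegree_quad_le_one rfl)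
        (by rw [PainleveV.coeff_quad]; norm_num; field_simp)
      refine ⟨c, d, h1, h3 (Polynomial.funext fun z => ?_) rfl, h2⟩
      simp only [Polynomial.eval_mul, Polynomial.eval_X, Polynomial.eval_C, PainleveV.eval_quad]
      field_simp
      ring
    · obtain ⟨c, d, h1, h2, -⟩ := PainleveV.exists_family_linear (θ₀ := θ₀) (θₓ := θ₀)
        (θinf := θinf) (η := θ₀ / 2) (l := 0) (a := 2 / θinf) (k := 1) hinf
        (by simpa using h0) (by ring) rfl m0 m0 (PainleveV.half_mem m0)
        mh' (zero_mem _) mi mi' le_rfl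
        (by norm_num) (by simpa using hinf) (PainleveV.natDegree_quad_le_one rfl)
        (by rw [PainleveV.coeff_quad]; norm_num; field_simp)
      exact ⟨c, d, h1, h2⟩
  · obtain rfl : θₓ = -θ₀ := by rw [hx, neg_neg]
    have m0 : θ₀ ∈ Algebra.adjoin ℚ {θ₀, θ₀⁻¹, θinf, θinf⁻¹} := sub (by simp)
    have m0' : θ₀⁻¹ ∈ Algebra.adjoin ℚ {θ₀, θ₀⁻¹, θinf, θinf⁻¹} := sub (by simp)
    have mi : θinf ∈ Algebra.adjoin ℚ {θ₀, θ₀⁻¹, θinf, θinf⁻¹} := sub (by simp)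
    have mi' : θinf⁻¹ ∈ Algebra.adjoin ℚ {θ₀, θ₀⁻¹, θinf, θinf⁻¹} := sub (by simp)
    have mh' : (θ₀ / 2)⁻¹ ∈ Algebra.adjoin ℚ {θ₀, θ₀⁻¹, θinf, θinf⁻¹} := by
      rw [inv_div, div_eq_mul_inv]
      exact mul_mem (ofNat_mem _ 2) m0'
    -- As θ₀ + θₓ = 0, the linear term of the numerator drops out, whence k = 2. Its constant is
    -- -(θ_∞/2)(η + θ₀/2), which forces η = θ₀/2.
    obtain ⟨c, d, h1, h2, -⟩ := PainleveV.exists_family_linear (θ₀ := θ₀) (θₓ := -θ₀)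
      (θinf := θinf) (η := θ₀ / 2) (l := 0) (a := 2 / (θ₀ * θinf)) (k := 2) hinf
      (by simpa using h0) (by ring) (by ring) m0 (neg_mem m0) (PainleveV.half_mem m0)
      mh' (zero_mem _) mi mi' (by norm_num) le_rfl
      (div_ne_zero (by norm_num) (mul_ne_zero h0 hinf))
      (PainleveV.natDegree_quad_le_zero (by ring) rfl)
      (by rw [PainleveV.coeff_quad]; norm_num; field_simp; ring)
    exact ⟨c, d, h1, h2⟩
  · exact ⟨PainleveV.exists_family_upper hinf hΔ (sub (by simp)) (sub (by simp)) (sub (by simp)),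
      PainleveV.exists_family_lower hinf hΔ (sub (by simp)) (sub (by simp)) (sub (by simp))⟩
  · exact PainleveV.exists_family_of_riccati hinf hx h0 (sub (by simp)) (sub (by simp))
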